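/- Let $n\ge 3$ and $k\ge 1$ be integers with $n\ge 2k$, and let $\theta,\rho\in\mathbb R$. For a positive smooth function $u$ on $\mathbb R^n$ let $g_u=u^{\frac{4k}{n+2k}}|dx|^2$, and for $1\le j\le k$ let $\sigma_j(g_u)$ be the $j$-th elementary symmetric function of the eigenvalues of $g_u^{-1}A_{g_u}$, where $$A_g=\frac1{n-2}\Big(\mathrm{Ric}_g-\frac{R_g}{2(n-1)}\,g\Big)$$ is the Schouten tensor. Call $u$ *admissible* if $g_u\in\Gamma_k^+$, i.e. $\sigma_1(g_u),\dots,\sigma_k(g_u)>0$ at every point of $\mathbb R^n$, and *non-trivial* if the function $\sigma_k(g_u)$ is not constant on $\mathbb R^n$. Consider on $\mathbb R^n$ the equation $$\sigma_k^{1/k}\Big(D^2\big(u^{-\frac{2k}{n+2k}}\big)-\frac{u^{\frac{2k}{n+2k}}}{2}\big|D\big(u^{-\frac{2k}{n+2k}}\big)\big|^2 I\Big)=u^{\frac{2k}{n+2k}-1}\Big[(2\theta+\rho)\,u+\frac{4k\theta}{n+2k}\,x\cdot Du\Big],\qquad(\ast)$$ where $\sigma_k$ of a symmetric matrix is the $k$-th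 elementary symmetric function of its eigenvalues and all derivatives and norms in $(\ast)$ are Euclidean. **Theorem.** For every $\alpha>0$, equation $(\ast)$ has a non-trivial, admissible, radially symmetric, positive smooth solution $u_\alpha$ on $\mathbb R^n$ with $u_\alpha(0)=\alpha$ if and only if $$\theta>0\quad\text{and}\quad 2\theta+\rho>0 .$$ -/

import Mathlib

open scoped ContDiff

noncomputable section

namespace KYamabe

/-- Euclidean `n`-space. -/
abbrev E (n : ℕ) : Type := EuclideanSpace ℝ (Fin n)

/-- The partial derivative of `f` in the `i`-th coordinate direction. -/
def pd {n : ℕ} (i : Fin n) (f : E n → ℝ) (x : E n) : ℝ :=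
  fderiv ℝ f x (EuclideanSpace.single i 1)

/-- The (Euclidean) Hessian matrix `D² f`. -/
def hess {n : ℕ} (f : E n → ℝ) (x : E n) : Matrix (Fin n) (Fin n) ℝ :=
  Matrix.of fun i j => pd i (pd j f) x

/-- The squared Euclidean norm `|D f|²` of the gradient. -/
def gradSq {n : ℕ} (f : E n → ℝ) (x : E n) : ℝ :=
  ∑ i, pd i f x ^ 2

/-- `σ_j(A)`: the `j`-th elementary symmetric function of the eigenvalues of `A`, listed with
their algebraic multiplicities. It is used for matrices that are diagonalizable over `ℝ`. -/
def sigma {n : ℕ} (j : ℕ) (A : Matrix (Fin n) (Fin n) ℝ) : ℝ :=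
  A.charpoly.roots.esymm j

/-- A Riemannian metric on `ℝⁿ` in the standard chart: the matrix of its coefficients
`g_{ij}` at each point. -/
abbrev Metric (n : ℕ) : Type := E n → Matrix (Fin n) (Fin n) ℝ

/-- The Christoffel symbols `Γ^l_{ij}` of the Levi-Civita connection of `g`. -/
def christoffel {n : ℕ} (g : Metric n) (l i j : Fin n) (x : E n) : ℝ :=
  (1 / 2) * ∑ m, (g x)⁻¹ l m *
    (pd i (fun y => g y j m) x + pd j (fun y => g y i m) x - pd m (fun y => g y i j) x)

/-- The Ricci tensor
`R_{ij} = ∂_l Γ^l_{ij} - ∂_j Γ^l_{il} + Γ^l_{lm} Γ^m_{ij} - Γ^l_{jm} Γ^m_{il}`. -/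
def ricci {n : ℕ} (g : Metric n) (x : E n) : Matrix (Fin n) (Fin n) ℝ :=
  Matrix.of fun i j => ∑ l,
    (pd l (christoffel g l i j) x - pd j (christoffel g l i l) x
      + ∑ m, (christoffel g l l m x * christoffel g m i j x
              - christoffel g l j m x * christoffel g m i l x))

/-- The scalar curvature `g^{ij} R_{ij}`. -/
def scalarCurv {n : ℕ} (g : Metric n) (x : E n) : ℝ :=
  ((g x)⁻¹ * ricci g x).trace

/-- The Schouten tensor `A_g = (Ric_g - R_g / (2 (n - 1)) g) / (n - 2)`. -/
def schouten {n : ℕ} (g : Metric n) (x : E n) : Matrix (Fin n) (Fin n) ℝ :=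
  (1 / ((n : ℝ) - 2)) • (ricci g x - (scalarCurv g x / (2 * ((n : ℝ) - 1))) • g x)

/-- The curvature `σ_j(g)`: the `j`-th elementary symmetric function of the eigenvalues of the
`(1,1)`-tensor `g⁻¹ A_g`. -/
def sigmaCurv {n : ℕ} (j : ℕ) (g : Metric n) (x : E n) : ℝ :=
  sigma j ((g x)⁻¹ * schouten g x)

/-- The conformally flat metric `g_u = u^{4k/(n+2k)} |dx|²`. -/
def confMetric (n k : ℕ) (u : E n → ℝ) : Metric n :=
  fun x => (u x ^ (4 * (k : ℝ) / ((n : ℝ) + 2 * k))) • (1 : Matrix (Fin n) (Fin n) ℝ)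

/-- `u` is admissible: `g_u` lies in the positive cone `Γ_k^+`, that is,
`σ_1(g_u), …, σ_k(g_u) > 0` at every point. -/
def Admissible (n k : ℕ) (u : E n → ℝ) : Prop :=
  ∀ x, ∀ j ∈ Finset.Icc 1 k, 0 < sigmaCurv j (confMetric n k u) x

/-- `u` is trivial: `g_u` has constant `σ_k`-curvature. -/
def Trivial (n k : ℕ) (u : E n → ℝ) : Prop :=
  ∃ c : ℝ, ∀ x, sigmaCurv k (confMetric n k u) x = c

/-- `u` is radially symmetric. -/
def Radial {n : ℕ} (u : E n → ℝ) : Prop :=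
  ∀ x y, ‖x‖ = ‖y‖ → u x = u y

/-- The elliptic equation, for a positive function `u`, with `v = u^{-2k/(n+2k)}`:
`σ_k^{1/k}(D²v - (u^{2k/(n+2k)} / 2) |Dv|² I)
  = u^{2k/(n+2k) - 1} ((2θ + ρ) u + (4kθ/(n+2k)) x · Du)` on `ℝⁿ`. -/
def SolvesEquation (n k : ℕ) (θ ρ : ℝ) (u : E n → ℝ) : Prop :=
  let q : ℝ := 2 * (k : ℝ) / ((n : ℝ) + 2 * k)
  let v : E n → ℝ := fun x => u x ^ (-q)
  ∀ x, sigma k (hess v x - (u x ^ q / 2 * gradSq v x) • (1 : Matrix (Fin n) (Fin n) ℝ))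
      ^ (1 / (k : ℝ))
    = u x ^ (q - 1) *
        ((2 * θ + ρ) * u x + 4 * (k : ℝ) * θ / ((n : ℝ) + 2 * k) * fderiv ℝ u x x)

end KYamabe

end

/-! ### Elementary symmetric functions of scalar matrices perturbed by a rank-one matrix. -/

namespace KYamabe
open Polynomial

/-! With v = u^{-2k/(n+2k)} the metric is v^{-2}|dx|², its Schouten endomorphism is v D²v - |Dv|²/2
I, and (∗) becomes σ_k^{1/k} = 2θ + ρ - 2θ x·Dv/v (`equation_iff`). For v = φ(|x|²) the eigenvalues
are L, with multiplicity n-1, and L + d (`sigma_radial`). In t = log r put Y = d/dt log(v/r) and Z =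
r²/v². Then LZ = (1-Y²)/2, Y' = Z(d+2L), Z' = -2YZ, L' = -dY, and with C = binom(n-1,k-1) and f = ρ
- 2θY the equation reads C L^{k-1}(nL + kd) = k f^k. The origin is t → -∞, where Y → -1, Z → 0, d →
0.

Necessity. At x = 0 the drift vanishes, so 2θ+ρ = σ_k^{1/k} > 0. If θ = 0, then σ_k is constant.
Suppose θ < 0 (`not_neg_of_entire`). From σ_1 > 0 and entireness |Y| < 1, hence L > 0. The quantity
G = Z^{n/2}(Cn L^k/k - f^k) satisfies G' = -Z^{n/2}(f^k)', because the terms in d cancel. It starts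
at 0 and becomes negative as Y begins to increase; while G ≤ 0 one has d ≥ 0, so Y keeps increasing
and G keeps decreasing. But then Y becomes at least 1/2, Z^{n/2} decays exponentially while f^k
stays bounded, so -G is bounded by a quantity tending to 0: a contradiction.

Sufficiency. Near the origin L is sought as a function of z = s/φ², s = |x|². Then M = L^k solves
the singular equation z M' = Φ(z M^{1/k}) - (n/2) M, whose smooth solution is a fixed point of a
dilation average (`exists_singular_solution`); φ follows from a regular ODE
(`exists_local_profile`). For θ > 0 this solution has d ≤ 0 for s ≥ 0. Away from the origin, the
variables artanh Y and -log L satisfy an autonomous system. The region f > 0, d ≤ 0 is forward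
invariant when θ > 0 and n ≥ 2k (`source_pos_of_phase`, `mul_exp_le_of_phase`), and on it the field
is bounded, so the solution is global (`exists_global_profile`). The scaling φ ↦ cφ(s/c²) prescribes
u(0). -/

lemma esymm_replicate (m j : ℕ) (a : ℝ) :
    (Multiset.replicate m a).esymm j = (m.choose j : ℝ) * a ^ j := by
  have h : ((Multiset.replicate m a).powersetCard j).map Multiset.prod =
      Multiset.replicate (m.choose j) (a ^ j) := by
    rw [Multiset.eq_replicate]
    refine ⟨by simp, fun b hb => ?_⟩
    obtain ⟨s, hs, rfl⟩ := Multiset.mem_map.1 hb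
    obtain ⟨hs1, hs2⟩ := Multiset.mem_powersetCard.1 hs
    have : s = Multiset.replicate j a :=
      Multiset.eq_replicate.2 ⟨hs2, fun b hb => Multiset.eq_of_mem_replicate (Multiset.mem_of_le hs1 hb)⟩
    rw [this, Multiset.prod_replicate]
  rw [Multiset.esymm, h, Multiset.sum_replicate, nsmul_eq_mul]

lemma esymm_cons_replicate (m j : ℕ) (a b : ℝ) :
    (b ::ₘ Multiset.replicate m a).esymm (j + 1) =
      (m.choose (j + 1) : ℝ) * a ^ (j + 1) + (m.choose j : ℝ) * (b * a ^ j) := by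
  have h := esymm_replicate m j a
  have h' := esymm_replicate m (j + 1) a
  rw [Multiset.esymm] at h h' ⊢
  rw [Multiset.powersetCard_cons, Multiset.map_add, Multiset.sum_add, h', Multiset.map_map]
  congr 1
  simp only [Function.comp_def, Multiset.prod_cons]
  rw [Multiset.sum_map_mul_left, h]
  ring

lemma charpoly_smul_one_add_vecMulVec {n : ℕ} (hn : 1 ≤ n) (a b : ℝ) (x : Fin n → ℝ) :
    (a • (1 : Matrix (Fin n) (Fin n) ℝ) + b • Matrix.vecMulVec x x).charpoly =
      (X - C a) ^ (n - 1) * (X - C (a + b * ∑ i, x i ^ 2)) := by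
  have h1 : a • (1 : Matrix (Fin n) (Fin n) ℝ) + b • Matrix.vecMulVec x x =
      Matrix.vecMulVec (b • x) x - Matrix.scalar (Fin n) (-a) := by
    rw [Matrix.smul_vecMulVec, map_neg, sub_neg_eq_add, add_comm]
    congr 1
    ext i j
    simp [Matrix.diagonal_apply, Matrix.one_apply]
  rw [h1, Matrix.charpoly_sub_scalar, Matrix.charpoly_vecMulVec]
  obtain ⟨m, rfl⟩ : ∃ m, n = m + 1 := ⟨n - 1, by omega⟩
  have h2 : (b • x) ⬝ᵥ x = b * ∑ i, x i ^ 2 := by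
    simp [dotProduct, Finset.mul_sum, sq, mul_assoc]
  simp only [h2, Fintype.card_fin, Nat.add_sub_cancel, smul_eq_C_mul, map_neg, map_add]
  simp
  ring

/-- `σ_j` of a multiple of the identity plus a multiple of `x xᵀ`. -/
lemma sigma_smul_one_add_vecMulVec {n : ℕ} (hn : 1 ≤ n) (j : ℕ) (a b : ℝ) (x : Fin n → ℝ) :
    sigma (j + 1) (a • (1 : Matrix (Fin n) (Fin n) ℝ) + b • Matrix.vecMulVec x x) =
      ((n - 1).choose (j + 1) : ℝ) * a ^ (j + 1) +
        ((n - 1).choose j : ℝ) * ((a + b * ∑ i, x i ^ 2) * a ^ j) := by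
  rw [sigma, charpoly_smul_one_add_vecMulVec hn, roots_mul, roots_pow, roots_X_sub_C,
    roots_X_sub_C, Multiset.nsmul_singleton, add_comm, Multiset.singleton_add,
    esymm_cons_replicate]
  exact mul_ne_zero (pow_ne_zero _ (X_sub_C_ne_zero a)) (X_sub_C_ne_zero _)

lemma charpoly_smul {n : ℕ} {c : ℝ} (hc : c ≠ 0) (A : Matrix (Fin n) (Fin n) ℝ) :
    (c • A).charpoly = A.charpoly.scaleRoots c := by
  refine Polynomial.funext fun r => ?_
  -- Evaluation at c x suffices, since det(c x - cA) = cⁿ det(x - A).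
  obtain ⟨x, rfl⟩ : ∃ x, r = c * x := ⟨r / c, by field_simp⟩
  rw [scaleRoots_eval_mul, Matrix.eval_charpoly, Matrix.eval_charpoly, Matrix.charpoly_natDegree_eq_dim]
  rw [← Matrix.det_smul]
  congr 1
  ext i j
  simp [Matrix.diagonal_apply]
  split_ifs <;> ring

lemma sigma_smul {n : ℕ} {c : ℝ} (hc : c ≠ 0) (j : ℕ) (A : Matrix (Fin n) (Fin n) ℝ) :
    sigma j (c • A) = c ^ j * sigma j A := by
  rw [sigma, charpoly_smul hc, roots_scaleRoots _ (IsUnit.mk0 c hc), sigma, Multiset.esymm,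
    Multiset.esymm, Multiset.powersetCard_map, Multiset.map_map, ← Multiset.sum_map_mul_left]
  congr 1
  refine Multiset.map_congr rfl fun s hs => ?_
  rw [Function.comp_apply, Multiset.prod_map_mul, Multiset.map_const', Multiset.prod_replicate,
    (Multiset.mem_powersetCard.1 hs).2, Multiset.map_id']

end KYamabe
-- The Schouten tensor of a conformally flat metric.
namespace KYamabe
variable {n : ℕ}

lemma pd_congr {f g : E n → ℝ} {x : E n} (h : f =ᶠ[nhds x] g) (i : Fin n) :
    pd i f x = pd i g x := by
  rw [pd, pd, h.fderiv_eq]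

lemma contDiff_pd {f : E n → ℝ} (hf : ContDiff ℝ ∞ f) (i : Fin n) : ContDiff ℝ ∞ (pd i f) :=
  (hf.fderiv_right (m := ∞) (by simp)).clm_apply contDiff_const

lemma differentiable_pd {f : E n → ℝ} (hf : ContDiff ℝ ∞ f) (i : Fin n) :
    Differentiable ℝ (pd i f) :=
  (contDiff_pd hf i).differentiable (by simp)

lemma pd_comm {f : E n → ℝ} (hf : ContDiff ℝ ∞ f) (i j : Fin n) (x : E n) :
    pd i (pd j f) x = pd j (pd i f) x := by
  have hd : Differentiable ℝ (fderiv ℝ f) :=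
    (hf.fderiv_right (m := ∞) (by simp)).differentiable (by simp)
  have key : ∀ i j : Fin n, pd i (pd j f) x =
      fderiv ℝ (fderiv ℝ f) x (EuclideanSpace.single i 1) (EuclideanSpace.single j 1) := by
    intro i j
    have : HasFDerivAt (pd j f) ((fderiv ℝ (fderiv ℝ f) x).flip (EuclideanSpace.single j 1)) x := by
      have h := (hd x).hasFDerivAt.clm_apply
        (hasFDerivAt_const (EuclideanSpace.single j (1 : ℝ)) x)
      simp only [ContinuousLinearMap.comp_zero, zero_add] at h
      exact h.congr_fderiv (by ext; simp)
    rw [pd, this.fderiv]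
    rfl
  rw [key, key]
  exact ((hf.contDiffAt (x := x)).of_le (WithTop.coe_le_coe.2 le_top) : ContDiffAt ℝ 2 f x).isSymmSndFDerivAt (by simp) _ _

/-- A metric conformal to the flat one, with conformal factor `e^{2h}`. -/
noncomputable def expMetric (h : E n → ℝ) : Metric n := fun x => Real.exp (2 * h x) • (1 : Matrix (Fin n) (Fin n) ℝ)

lemma pd_exp_mul {h : E n → ℝ} {x : E n} (hd : DifferentiableAt ℝ h x) (c : ℝ) (i : Fin n) :
    pd i (fun y => Real.exp (2 * h y) * c) x = 2 * Real.exp (2 * h x) * c * pd i h x := by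
  have h1 : HasFDerivAt (fun y => Real.exp (2 * h y) * c)
      (c • (Real.exp (2 * h x) • ((2 : ℝ) • fderiv ℝ h x))) x :=
    ((hd.hasFDerivAt.const_mul 2).exp).mul_const c
  rw [pd, h1.fderiv]
  simp [pd]
  ring

lemma inv_expMetric (h : E n → ℝ) (x : E n) :
    (expMetric h x)⁻¹ = Real.exp (-(2 * h x)) • (1 : Matrix (Fin n) (Fin n) ℝ) := by
  refine Matrix.inv_eq_left_inv ?_
  rw [expMetric, Matrix.smul_mul, Matrix.mul_smul, smul_smul, ← Real.exp_add]
  simp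

lemma christoffel_expMetric {h : E n → ℝ} {x : E n} (hd : DifferentiableAt ℝ h x)
    (l i j : Fin n) :
    christoffel (expMetric h) l i j x =
      (1 : Matrix (Fin n) (Fin n) ℝ) l j * pd i h x + (1 : Matrix (Fin n) (Fin n) ℝ) l i * pd j h x
        - (1 : Matrix (Fin n) (Fin n) ℝ) i j * pd l h x := by
  have hp : ∀ a b c : Fin n, pd a (fun y => expMetric h y b c) x =
      2 * Real.exp (2 * h x) * (1 : Matrix (Fin n) (Fin n) ℝ) b c * pd a h x := fun a b c =>
    pd_exp_mul hd _ a
  rw [christoffel, inv_expMetric]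
  simp only [hp, Matrix.smul_apply, smul_eq_mul]
  rw [Finset.sum_eq_single l]
  · have : Real.exp (-(2 * h x)) * Real.exp (2 * h x) = 1 := by rw [← Real.exp_add]; simp
    rw [Matrix.one_apply_eq]
    have e1 : (1 : Matrix (Fin n) (Fin n) ℝ) j l = (1 : Matrix (Fin n) (Fin n) ℝ) l j := by
      simp [Matrix.one_apply, eq_comm]
    have e2 : (1 : Matrix (Fin n) (Fin n) ℝ) i l = (1 : Matrix (Fin n) (Fin n) ℝ) l i := by
      simp [Matrix.one_apply, eq_comm]
    rw [e1, e2]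
    linear_combination ((1 : Matrix (Fin n) (Fin n) ℝ) l j * pd i h x + (1 : Matrix (Fin n) (Fin n) ℝ) l i * pd j h x
        - (1 : Matrix (Fin n) (Fin n) ℝ) i j * pd l h x) * this
  · intro b _ hb
    simp [Matrix.one_apply_ne hb.symm]
  · simp

lemma pd_christoffel_expMetric {h : E n → ℝ} (hh : ContDiff ℝ ∞ h) (a l i j : Fin n) (x : E n) :
    pd a (christoffel (expMetric h) l i j) x =
      (1 : Matrix (Fin n) (Fin n) ℝ) l j * hess h x a i + (1 : Matrix (Fin n) (Fin n) ℝ) l i * hess h x a j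
        - (1 : Matrix (Fin n) (Fin n) ℝ) i j * hess h x a l := by
  have hd : Differentiable ℝ h := hh.differentiable (by simp)
  have e : christoffel (expMetric h) l i j = fun x =>
      (1 : Matrix (Fin n) (Fin n) ℝ) l j * pd i h x + (1 : Matrix (Fin n) (Fin n) ℝ) l i * pd j h x
        - (1 : Matrix (Fin n) (Fin n) ℝ) i j * pd l h x :=
    funext fun x => christoffel_expMetric (hd x) l i j
  have D : ∀ b : Fin n, HasFDerivAt (pd b h) (fderiv ℝ (pd b h) x) x := fun b =>
    (differentiable_pd hh b x).hasFDerivAt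
  have := (((D i).const_mul ((1 : Matrix (Fin n) (Fin n) ℝ) l j)).add
    ((D j).const_mul ((1 : Matrix (Fin n) (Fin n) ℝ) l i))).sub
    ((D l).const_mul ((1 : Matrix (Fin n) (Fin n) ℝ) i j))
  rw [e, pd]
  erw [this.fderiv]
  simp [hess, pd]

/-- The classical conformal change formula from a flat background. All Christoffel symbols are
Kronecker deltas times first derivatives, so each contraction collapses; symmetry of the Hessian is
what matches the off-diagonal entries. -/
lemma ricci_expMetric {h : E n → ℝ} (hh : ContDiff ℝ ∞ h) (x : E n) :
    ricci (expMetric h) x = (-((n : ℝ) - 2)) • (hess h x - Matrix.vecMulVec (pd · h x) (pd · h x))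
      - ((hess h x).trace + ((n : ℝ) - 2) * gradSq h x) • (1 : Matrix (Fin n) (Fin n) ℝ) := by
  have hd : Differentiable ℝ h := hh.differentiable (by simp)
  have hs : ∀ a b, hess h x a b = hess h x b a := fun a b => pd_comm hh a b x
  ext i j
  rw [ricci, Matrix.of_apply]
  simp only [pd_christoffel_expMetric hh, christoffel_expMetric (hd x)]
  simp only [Matrix.sub_apply, Matrix.smul_apply, Matrix.vecMulVec_apply, smul_eq_mul, gradSq,
    Matrix.trace, Matrix.diag_apply]
  generalize hess h x = H at *
  generalize (fun i => pd i h x) = a at *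
  simp only [Matrix.one_apply]
  simp only [mul_add, add_mul, mul_sub, sub_mul, ite_mul, mul_ite, one_mul, mul_one, zero_mul,
    mul_zero, Finset.sum_add_distrib, Finset.sum_sub_distrib, Finset.sum_ite_eq,
    Finset.sum_ite_eq', Finset.mem_univ, if_true]
  by_cases hij : i = j
  · subst hij
    simp only [if_true, Finset.sum_ite_irrel, Finset.sum_const_zero, Finset.sum_ite_eq,
      Finset.mem_univ, Finset.sum_add_distrib, Finset.sum_sub_distrib, Finset.sum_const,
      Finset.card_univ, Fintype.card_fin, nsmul_eq_mul, sq]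
    ring
  · simp only [hij, Ne.symm hij, if_false, Finset.sum_ite_irrel, Finset.sum_const_zero,
      Finset.sum_ite_eq, Finset.mem_univ, if_true, Finset.sum_add_distrib, Finset.sum_sub_distrib,
      Finset.sum_const, Finset.card_univ, Fintype.card_fin, nsmul_eq_mul, hs j i]
    ring


/-- The Laplacian of h cancels between the Ricci tensor and the scalar curvature, and division by n
- 2 removes the dimension from the result. -/
lemma inv_mul_schouten_expMetric (hn : 3 ≤ n) {h : E n → ℝ} (hh : ContDiff ℝ ∞ h) (x : E n) :
    (expMetric h x)⁻¹ * schouten (expMetric h) x =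
      Real.exp (-(2 * h x)) • (Matrix.vecMulVec (pd · h x) (pd · h x) - hess h x
        - (gradSq h x / 2) • (1 : Matrix (Fin n) (Fin n) ℝ)) := by
  have hn' : (3 : ℝ) ≤ n := by exact_mod_cast hn
  have h1 : (n : ℝ) - 1 ≠ 0 := by linarith
  have h2 : (n : ℝ) - 2 ≠ 0 := by linarith
  have htr : (Matrix.vecMulVec (pd · h x) (pd · h x)).trace = gradSq h x := by
    simp [Matrix.trace, Matrix.vecMulVec_apply, gradSq, sq]
  have hsc : scalarCurv (expMetric h) x = Real.exp (-(2 * h x)) *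
      (-(2 * ((n : ℝ) - 1)) * (hess h x).trace - ((n : ℝ) - 1) * ((n : ℝ) - 2) * gradSq h x) := by
    rw [scalarCurv, inv_expMetric, Matrix.smul_mul, one_mul, Matrix.trace_smul, ricci_expMetric hh]
    simp only [Matrix.trace_sub, Matrix.trace_smul, htr, Matrix.trace_one, Fintype.card_fin,
      smul_eq_mul]
    ring
  have hE : Real.exp (-(2 * h x)) * Real.exp (2 * h x) = 1 := by rw [← Real.exp_add]; simp
  rw [inv_expMetric, Matrix.smul_mul, one_mul, schouten, hsc, ricci_expMetric hh]
  congr 1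
  ext i j
  simp only [expMetric, Matrix.smul_apply, Matrix.sub_apply, smul_eq_mul]
  field_simp
  linear_combination (-((1 : Matrix (Fin n) (Fin n) ℝ) i j) *
     (-(2 * (hess h x).trace) - ((n : ℝ) - 2) * gradSq h x)) * hE

/-- The Schouten tensor of a conformally flat metric `v^{-2} |dx|^2`. -/
lemma inv_mul_schouten_of_eq_exp_neg (hn : 3 ≤ n) {h v : E n → ℝ} (hh : ContDiff ℝ ∞ h)
    (hv : ∀ x, v x = Real.exp (-h x)) (x : E n) :
    (expMetric h x)⁻¹ * schouten (expMetric h) x =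
      v x • hess v x - (gradSq v x / 2) • (1 : Matrix (Fin n) (Fin n) ℝ) := by
  have hd : Differentiable ℝ h := hh.differentiable (by simp)
  have hp : ∀ i, pd i v = fun y => -(v y * pd i h y) := by
    intro i
    funext y
    have : HasFDerivAt v (Real.exp (-h y) • (-fderiv ℝ h y)) y := by
      rw [show v = fun y => Real.exp (-h y) from funext hv]
      exact (hd y).hasFDerivAt.neg.exp
    rw [pd, this.fderiv, hv]
    simp [pd]
  have hvd : Differentiable ℝ v := by
    rw [show v = fun y => Real.exp (-h y) from funext hv]
    exact hd.neg.exp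
  have hp2 : ∀ i j, hess v x i j = v x * pd i h x * pd j h x - v x * hess h x i j := by
    intro i j
    have : HasFDerivAt (pd j v) (-(v x • fderiv ℝ (pd j h) x + pd j h x • fderiv ℝ v x)) x := by
      rw [hp j]
      exact ((hvd x).hasFDerivAt.mul (differentiable_pd hh j x).hasFDerivAt).neg
    have h3 : fderiv ℝ v x (EuclideanSpace.single i 1) = -(v x * pd i h x) := congrFun (hp i) x
    rw [hess, Matrix.of_apply, pd, this.fderiv]
    simp only [neg_apply, add_apply, smul_apply, smul_eq_mul, h3]
    simp only [hess, Matrix.of_apply, pd]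
    ring
  have hg : gradSq v x = v x ^ 2 * gradSq h x := by
    simp only [gradSq, hp, Finset.mul_sum]
    exact Finset.sum_congr rfl fun i _ => by ring
  have hE : Real.exp (-(2 * h x)) = v x ^ 2 := by
    rw [hv, ← Real.exp_nat_mul]; congr 1; push_cast; ring
  rw [inv_mul_schouten_expMetric hn hh, hE, hg]
  ext i j
  simp only [Matrix.smul_apply, Matrix.sub_apply, smul_eq_mul, hp2, Matrix.vecMulVec_apply]
  ring

lemma conf_exponent_pos {k : ℕ} (hk : 1 ≤ k) : 0 < 2 * (k : ℝ) / ((n : ℝ) + 2 * k) := by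
  have : (1 : ℝ) ≤ k := by exact_mod_cast hk
  positivity

lemma sigmaCurv_confMetric (hn : 3 ≤ n) {k : ℕ} {u v : E n → ℝ}
    (hu : ContDiff ℝ ∞ u) (hpos : ∀ x, 0 < u x)
    (hv : ∀ x, v x = u x ^ (-(2 * (k : ℝ) / ((n : ℝ) + 2 * k)))) (j : ℕ) (x : E n) :
    sigmaCurv j (confMetric n k u) x =
      sigma j (v x • hess v x - (gradSq v x / 2) • (1 : Matrix (Fin n) (Fin n) ℝ)) := by
  set q : ℝ := 2 * (k : ℝ) / ((n : ℝ) + 2 * k) with hq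
  -- Chosen so that u^{4k/(n+2k)} = e^{2h} and v = e^{-h}.
  let h : E n → ℝ := fun x => q * Real.log (u x)
  have hh : ContDiff ℝ ∞ h := contDiff_const.mul (hu.log fun x => (hpos x).ne')
  have hg : confMetric n k u = expMetric h := by
    funext x
    rw [confMetric, expMetric, Real.rpow_def_of_pos (hpos x)]
    congr 2
    simp only [h, hq]
    ring
  rw [sigmaCurv, hg, inv_mul_schouten_of_eq_exp_neg hn hh]
  intro y
  rw [hv, Real.rpow_def_of_pos (hpos y)]
  congr 1
  simp only [h]
  ring

end KYamabe
-- Radial functions and the reduction to an ordinary differential equation.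
namespace KYamabe
open Filter Topology
variable {n : ℕ}

/-- Profiles are taken in the variable |x|², which is smooth at the origin, unlike |x|. -/
lemma hasFDerivAt_radial {φ : ℝ → ℝ} {x : E n} (hφ : DifferentiableAt ℝ φ (‖x‖ ^ 2)) :
    HasFDerivAt (fun y : E n => φ (‖y‖ ^ 2)) (deriv φ (‖x‖ ^ 2) • ((2 : ℝ) • innerSL ℝ x)) x := by
  have h1 : HasFDerivAt (fun y : E n => ‖y‖ ^ 2) ((2 : ℝ) • innerSL ℝ x) x :=
    (hasStrictFDerivAt_norm_sq x).hasFDerivAt.congr_fderiv (by ext; simp [two_mul])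
  exact hφ.hasDerivAt.comp_hasFDerivAt x h1

lemma innerSL_single (x : E n) (i : Fin n) :
    innerSL ℝ x (EuclideanSpace.single i (1 : ℝ)) = x i := by
  simp [EuclideanSpace.inner_single_right]

lemma fderiv_radial_apply {φ : ℝ → ℝ} {v : E n → ℝ} {x : E n}
    (hv : v =ᶠ[𝓝 x] fun y => φ (‖y‖ ^ 2)) (hφ : DifferentiableAt ℝ φ (‖x‖ ^ 2)) :
    fderiv ℝ v x x = 2 * ‖x‖ ^ 2 * deriv φ (‖x‖ ^ 2) := by
  rw [hv.fderiv_eq, (hasFDerivAt_radial hφ).fderiv]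
  simp
  ring

lemma pd_radial {φ : ℝ → ℝ} {v : E n → ℝ} {x : E n}
    (hv : v =ᶠ[𝓝 x] fun y => φ (‖y‖ ^ 2)) (hφ : DifferentiableAt ℝ φ (‖x‖ ^ 2)) (i : Fin n) :
    pd i v x = 2 * deriv φ (‖x‖ ^ 2) * x i := by
  rw [pd, hv.fderiv_eq, (hasFDerivAt_radial hφ).fderiv]
  simp only [smul_apply, innerSL_single, smul_eq_mul]
  ring

lemma gradSq_radial {φ : ℝ → ℝ} {v : E n → ℝ} {x : E n}
    (hv : v =ᶠ[𝓝 x] fun y => φ (‖y‖ ^ 2)) (hφ : DifferentiableAt ℝ φ (‖x‖ ^ 2)) :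
    gradSq v x = 4 * ‖x‖ ^ 2 * deriv φ (‖x‖ ^ 2) ^ 2 := by
  simp only [gradSq, pd_radial hv hφ, EuclideanSpace.real_norm_sq_eq, Finset.mul_sum,
    Finset.sum_mul]
  exact Finset.sum_congr rfl fun i _ => by ring

lemma tendsto_norm_sq (x : E n) : Tendsto (fun y : E n => ‖y‖ ^ 2) (𝓝 x) (𝓝 (‖x‖ ^ 2)) :=
  (continuous_norm.pow 2).tendsto x

lemma contDiffAt_deriv {φ : ℝ → ℝ} {s : ℝ} {m N : WithTop ℕ∞} (hφ : ContDiffAt ℝ N φ s)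
    (h : m + 1 ≤ N) : ContDiffAt ℝ m (deriv φ) s := by
  rw [show deriv φ = fun y => fderiv ℝ φ y 1 from funext fun y => (fderiv_apply_one_eq_deriv).symm]
  exact (hφ.fderiv_right h).clm_apply contDiffAt_const

lemma hess_radial {φ : ℝ → ℝ} {v : E n → ℝ} {x : E n}
    (hv : v =ᶠ[𝓝 x] fun y => φ (‖y‖ ^ 2)) (hφ : ContDiffAt ℝ 2 φ (‖x‖ ^ 2)) :
    hess v x = (2 * deriv φ (‖x‖ ^ 2)) • (1 : Matrix (Fin n) (Fin n) ℝ) +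
      (4 * deriv (deriv φ) (‖x‖ ^ 2)) • Matrix.vecMulVec x x := by
  have hd : ∀ᶠ y in 𝓝 x, DifferentiableAt ℝ φ (‖y‖ ^ 2) :=
    (tendsto_norm_sq x).eventually
      ((hφ.eventually (by simp)).mono fun s hs => hs.differentiableAt (by simp))
  have hd2 : DifferentiableAt ℝ (deriv φ) (‖x‖ ^ 2) :=
    (contDiffAt_deriv (m := 1) hφ (by norm_num)).differentiableAt (by simp)
  ext i j
  have hj : pd j v =ᶠ[𝓝 x] fun y => 2 * deriv φ (‖y‖ ^ 2) * y j := by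
    filter_upwards [hd, hv.eventuallyEq_nhds] with y h1 h2 using pd_radial h2 h1 j
  have h3 : HasFDerivAt (fun y : E n => y j) (EuclideanSpace.proj j : E n →L[ℝ] ℝ) x :=
    (EuclideanSpace.proj j : E n →L[ℝ] ℝ).hasFDerivAt
  have h4 : HasFDerivAt (fun y : E n => 2 * deriv φ (‖y‖ ^ 2) * y j) _ x :=
    ((hasFDerivAt_radial hd2).const_mul 2).mul h3
  rw [hess, Matrix.of_apply, pd_congr hj, pd, h4.fderiv]
  simp only [add_apply, smul_apply, innerSL_single, smul_eq_mul, Matrix.add_apply,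
    Matrix.smul_apply, Matrix.vecMulVec_apply]
  have h5 : (EuclideanSpace.proj j : E n →L[ℝ] ℝ) (EuclideanSpace.single i 1) =
      (1 : Matrix (Fin n) (Fin n) ℝ) i j := by
    simp [PiLp.single_apply, Matrix.one_apply, eq_comm]
  rw [h5]
  ring

/-- The eigenvalue, in the directions tangent to the spheres, of `g⁻¹ A_g` for the metric
`g = φ(|x|²)^{-2} |dx|²`, as a function of `s = |x|²`. -/
noncomputable def angular (φ : ℝ → ℝ) (s : ℝ) : ℝ := 2 * φ s * deriv φ s - 2 * s * deriv φ s ^ 2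

/-- The difference of the radial and the angular eigenvalue. -/
noncomputable def defect (φ : ℝ → ℝ) (s : ℝ) : ℝ := 4 * s * φ s * deriv (deriv φ) s

/-- `σ_j` in terms of an eigenvalue `L` of multiplicity `n - 1` and the simple eigenvalue `L + d`. -/
noncomputable def radialSigma (n j : ℕ) (L d : ℝ) : ℝ :=
  ((n - 1).choose j : ℝ) * L ^ j + ((n - 1).choose (j - 1) : ℝ) * ((L + d) * L ^ (j - 1))

lemma sigma_radial (hn : 1 ≤ n) {φ : ℝ → ℝ} {v : E n → ℝ} {x : E n}
    (hv : v =ᶠ[𝓝 x] fun y => φ (‖y‖ ^ 2)) (hφ : ContDiffAt ℝ 2 φ (‖x‖ ^ 2)) {j : ℕ} (hj : 1 ≤ j) :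
    sigma j (v x • hess v x - (gradSq v x / 2) • (1 : Matrix (Fin n) (Fin n) ℝ)) =
      radialSigma n j (angular φ (‖x‖ ^ 2)) (defect φ (‖x‖ ^ 2)) := by
  obtain ⟨i, rfl⟩ : ∃ i, j = i + 1 := ⟨j - 1, by omega⟩
  have hd : DifferentiableAt ℝ φ (‖x‖ ^ 2) := hφ.differentiableAt (by simp)
  have : v x • hess v x - (gradSq v x / 2) • (1 : Matrix (Fin n) (Fin n) ℝ) =
      angular φ (‖x‖ ^ 2) • (1 : Matrix (Fin n) (Fin n) ℝ) +
        (4 * φ (‖x‖ ^ 2) * deriv (deriv φ) (‖x‖ ^ 2)) • Matrix.vecMulVec x x := by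
    rw [hess_radial hv hφ, gradSq_radial hv hd, hv.eq_of_nhds]
    ext i j
    simp only [angular, Matrix.add_apply, Matrix.sub_apply, Matrix.smul_apply, smul_eq_mul]
    ring
  rw [this, sigma_smul_one_add_vecMulVec hn, radialSigma, ← EuclideanSpace.real_norm_sq_eq, defect]
  simp only [Nat.add_sub_cancel]
  ring

section Equation
variable {k : ℕ} {u v : E n → ℝ}

lemma contDiff_rpow_of_pos (hu : ContDiff ℝ ∞ u) (hpos : ∀ x, 0 < u x) (p : ℝ) :
    ContDiff ℝ ∞ fun x => u x ^ p :=
  hu.rpow_const_of_ne fun x => (hpos x).ne'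

/-- The right-hand side of the equation and the `σ_k`-curvature. -/
lemma equation_iff (hk : 1 ≤ k) (θ ρ : ℝ) (hu : ContDiff ℝ ∞ u) (hpos : ∀ x, 0 < u x)
    (hv : ∀ x, v x = u x ^ (-(2 * (k : ℝ) / ((n : ℝ) + 2 * k)))) {x : E n}
    (hS : 0 ≤ sigma k (v x • hess v x - (gradSq v x / 2) • (1 : Matrix (Fin n) (Fin n) ℝ))) :
    sigma k (hess v x - (u x ^ (2 * (k : ℝ) / ((n : ℝ) + 2 * k)) / 2 * gradSq v x) •
        (1 : Matrix (Fin n) (Fin n) ℝ)) ^ (1 / (k : ℝ)) =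
      u x ^ (2 * (k : ℝ) / ((n : ℝ) + 2 * k) - 1) * ((2 * θ + ρ) * u x +
        4 * (k : ℝ) * θ / ((n : ℝ) + 2 * k) * fderiv ℝ u x x) ↔
    sigma k (v x • hess v x - (gradSq v x / 2) • (1 : Matrix (Fin n) (Fin n) ℝ)) ^ (1 / (k : ℝ)) =
      2 * θ + ρ - 2 * θ * fderiv ℝ v x x / v x := by
  have hk1 : (1 : ℝ) ≤ k := by exact_mod_cast hk
  have hden : (0 : ℝ) < (n : ℝ) + 2 * k := by positivity
  set q : ℝ := 2 * (k : ℝ) / ((n : ℝ) + 2 * k) with hq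
  have hux := hpos x
  have hvx : 0 < v x := by rw [hv]; exact Real.rpow_pos_of_pos hux _
  have huq : u x ^ q = (v x)⁻¹ := by rw [hv, Real.rpow_neg hux.le, inv_inv]
  have hW : v x • hess v x - (gradSq v x / 2) • (1 : Matrix (Fin n) (Fin n) ℝ) =
      v x • (hess v x - (u x ^ q / 2 * gradSq v x) • (1 : Matrix (Fin n) (Fin n) ℝ)) := by
    rw [smul_sub, smul_smul, huq]
    congr 2
    field_simp
  rw [hW, sigma_smul hvx.ne'] at hS ⊢
  set S := sigma k (hess v x - (u x ^ q / 2 * gradSq v x) • (1 : Matrix (Fin n) (Fin n) ℝ))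
  have hS0 : 0 ≤ S := nonneg_of_mul_nonneg_right hS (pow_pos hvx k)
  have h1 : (v x ^ k * S) ^ (1 / (k : ℝ)) = v x * S ^ (1 / (k : ℝ)) := by
    rw [Real.mul_rpow (by positivity) hS0, one_div, Real.pow_rpow_inv_natCast hvx.le (by omega)]
  have h2 : fderiv ℝ v x x = -q * v x / u x * fderiv ℝ u x x := by
    have hd : HasFDerivAt u (fderiv ℝ u x) x := (hu.differentiable (by simp) x).hasFDerivAt
    have := hd.rpow_const (p := -q) (Or.inl hux.ne')
    rw [show v = fun x => u x ^ (-q) from funext hv, this.fderiv]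
    simp only [smul_apply, smul_eq_mul]
    rw [Real.rpow_sub_one hux.ne']
    ring
  have h3 : u x ^ (q - 1) = (v x)⁻¹ / u x := by rw [Real.rpow_sub_one hux.ne', huq]
  rw [h1, h2, h3]
  have h4 : 4 * (k : ℝ) * θ / ((n : ℝ) + 2 * k) = 2 * q * θ := by rw [hq]; ring
  rw [h4]
  have h5 : (v x)⁻¹ / u x * ((2 * θ + ρ) * u x + 2 * q * θ * fderiv ℝ u x x) =
    (v x)⁻¹ * (2 * θ + ρ - 2 * θ * (-q * v x / u x * fderiv ℝ u x x) / v x) := by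
    field_simp
    ring
  rw [h5, eq_inv_mul_iff_mul_eq₀ hvx.ne']

end Equation

end KYamabe
-- The phase plane and the exclusion of negative θ.
namespace KYamabe
open Filter Topology Set

/-- A function with positive derivative wherever it is nonnegative stays nonnegative. -/
lemma nonneg_of_deriv_pos_of_nonneg {g g' : ℝ → ℝ} {a : ℝ} (hg : ∀ t, a ≤ t → HasDerivAt g (g' t) t)
    (h0 : 0 ≤ g a) (h : ∀ t, a ≤ t → 0 ≤ g t → 0 < g' t) : ∀ t, a ≤ t → 0 ≤ g t := by
  intro b hb
  have := image_le_of_deriv_right_lt_deriv_boundary (f := fun t => -g t) (f' := fun t => -g' t)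
    (a := a) (b := b) (B := fun _ => 0) (B' := fun _ => 0)
    (fun t ht => (hg t ht.1).neg.continuousAt.continuousWithinAt)
    (fun t ht => (hg t ht.1).neg.hasDerivWithinAt) (by simpa using h0)
    (fun t => hasDerivAt_const t 0)
    (fun t ht h1 => by
      have : g t = 0 := by simpa using h1
      simpa using h t ht.1 this.ge) (right_mem_Icc.2 hb)
  simpa using this

lemma strictMonoOn_Ici_of_deriv_pos {g g' : ℝ → ℝ} {a : ℝ}
    (hg : ∀ t, a ≤ t → HasDerivAt g (g' t) t) (h : ∀ t, a ≤ t → 0 < g' t) :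
    StrictMonoOn g (Ici a) := by
  refine strictMonoOn_of_deriv_pos (convex_Ici a)
    (fun t ht => (hg t ht).continuousAt.continuousWithinAt) fun t ht => ?_
  rw [interior_Ici] at ht
  rw [(hg t (le_of_lt ht)).deriv]
  exact h t (le_of_lt ht)

lemma monotoneOn_Ici_of_deriv_nonneg {g g' : ℝ → ℝ} {a : ℝ}
    (hg : ∀ t, a ≤ t → HasDerivAt g (g' t) t) (h : ∀ t, a ≤ t → 0 ≤ g' t) :
    MonotoneOn g (Ici a) := by
  refine monotoneOn_of_deriv_nonneg (convex_Ici a)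
    (fun t ht => (hg t ht).continuousAt.continuousWithinAt)
    (fun t ht => ?_) fun t ht => ?_
  · rw [interior_Ici] at ht
    exact (hg t (le_of_lt ht)).differentiableAt.differentiableWithinAt
  · rw [interior_Ici] at ht
    rw [(hg t (le_of_lt ht)).deriv]
    exact h t (le_of_lt ht)

section Entire
variable {Y Z L d : ℝ → ℝ} {n : ℕ}

/-- Since nL + d > 0, the derivative of Y exceeds (n-2)(Y²-1)/2. If Y ≤ -1 somewhere, then backwards
in time Y moves strictly away from -1, contrary to its limit at -∞. -/
lemma neg_one_lt_of_sigma_one_pos (hn : 3 ≤ n)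
    (hY : ∀ t, HasDerivAt Y (Z t * (d t + 2 * L t)) t) (hZpos : ∀ t, 0 < Z t)
    (hLZ : ∀ t, L t * Z t = (1 - Y t ^ 2) / 2) (h1 : ∀ t, 0 < n * L t + d t)
    (hYlim : Tendsto Y atBot (𝓝 (-1))) (t : ℝ) : -1 < Y t := by
  have hn' : (3 : ℝ) ≤ n := by exact_mod_cast hn
  have hlow : ∀ t, -((n : ℝ) - 2) * ((1 - Y t ^ 2) / 2) < Z t * (d t + 2 * L t) := fun t => by
    have := mul_pos (hZpos t) (h1 t)
    rw [← hLZ]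
    nlinarith
  by_contra hcon
  push Not at hcon
  -- Time is reversed from t, so that the forward barrier lemma applies.
  have hg : ∀ τ, (0 : ℝ) ≤ τ → HasDerivAt (fun τ => -1 - Y (t - τ))
      (Z (t - τ) * (d (t - τ) + 2 * L (t - τ))) τ := fun τ _ => by
    have := ((hY (t - τ)).comp τ ((hasDerivAt_id τ).const_sub t)).const_sub (-1)
    exact this.congr_deriv (by ring)
  have hpos : ∀ τ, (0 : ℝ) ≤ τ → 0 ≤ -1 - Y (t - τ) →
      0 < Z (t - τ) * (d (t - τ) + 2 * L (t - τ)) := fun τ _ h => by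
    refine lt_of_le_of_lt ?_ (hlow (t - τ))
    have : 0 ≤ Y (t - τ) ^ 2 - 1 := by nlinarith
    nlinarith
  have hnn := nonneg_of_deriv_pos_of_nonneg hg (by simpa using hcon) hpos
  have hmono := strictMonoOn_Ici_of_deriv_pos hg fun τ h => hpos τ h (hnn τ h)
  have h0 : 0 < -1 - Y (t - 1) :=
    (hnn 0 le_rfl).trans_lt (hmono (by simp) (by simp : (1 : ℝ) ∈ Ici (0 : ℝ)) one_pos)
  have hlim : Tendsto (fun τ : ℝ => -1 - Y (t - τ)) atTop (𝓝 (-1 - -1)) :=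
    (hYlim.comp (tendsto_atBot_add_const_left _ t tendsto_neg_atTop_atBot)).const_sub (-1)
  have : -1 - Y (t - 1) ≤ -1 - -1 := by
    refine ge_of_tendsto hlim ?_
    filter_upwards [eventually_ge_atTop (1 : ℝ)] with τ hτ
    exact hmono.monotoneOn (by simp : (1 : ℝ) ∈ Ici (0 : ℝ)) (by simp; linarith) hτ
  linarith

/-- Once Y ≥ 1, the bound Y' > (n-2)(Y²-1)/2 gives the Riccati inequality Y' > (Y-1)²/2, whose
solutions blow up in finite time; Y is defined for all t. -/
lemma lt_one_of_sigma_one_pos (hn : 3 ≤ n)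
    (hY : ∀ t, HasDerivAt Y (Z t * (d t + 2 * L t)) t) (hZpos : ∀ t, 0 < Z t)
    (hLZ : ∀ t, L t * Z t = (1 - Y t ^ 2) / 2) (h1 : ∀ t, 0 < n * L t + d t)
    (t : ℝ) : Y t < 1 := by
  have hn' : (3 : ℝ) ≤ n := by exact_mod_cast hn
  have hlow : ∀ t, -((n : ℝ) - 2) * ((1 - Y t ^ 2) / 2) < Z t * (d t + 2 * L t) := fun t => by
    have := mul_pos (hZpos t) (h1 t)
    rw [← hLZ]
    nlinarith
  by_contra hcon
  push Not at hcon
  have hg : ∀ τ, t ≤ τ → HasDerivAt (fun τ => Y τ - 1) (Z τ * (d τ + 2 * L τ)) τ :=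
    fun τ _ => (hY τ).sub_const 1
  have hric : ∀ τ, 0 ≤ Y τ - 1 → (Y τ - 1) ^ 2 / 2 < Z τ * (d τ + 2 * L τ) := fun τ h => by
    refine lt_of_le_of_lt ?_ (hlow τ)
    have : 0 ≤ Y τ ^ 2 - 1 := by nlinarith
    nlinarith
  have hpos : ∀ τ, t ≤ τ → 0 ≤ Y τ - 1 → 0 < Z τ * (d τ + 2 * L τ) := fun τ _ h =>
    (by positivity : 0 ≤ (Y τ - 1) ^ 2 / 2).trans_lt (hric τ h)
  have hnn := nonneg_of_deriv_pos_of_nonneg hg (by simpa using hcon) hpos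
  have hmono := strictMonoOn_Ici_of_deriv_pos hg fun τ h => hpos τ h (hnn τ h)
  set a := t + 1 with ha
  have hYpos : ∀ τ, a ≤ τ → 0 < Y τ - 1 := fun τ hτ =>
    (hnn t le_rfl).trans_lt (hmono self_mem_Ici (show t ≤ τ by linarith) (by linarith))
  have hinv : ∀ τ, a ≤ τ → HasDerivAt (fun τ => -(Y τ - 1)⁻¹ - τ / 2)
      (Z τ * (d τ + 2 * L τ) / (Y τ - 1) ^ 2 - 1 / 2) τ := fun τ hτ => by
    have := ((((hY τ).sub_const 1).fun_inv (hYpos τ hτ).ne').neg).sub ((hasDerivAt_id τ).div_const 2)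
    exact this.congr_deriv (by simp; ring)
  have hm := monotoneOn_Ici_of_deriv_nonneg hinv fun τ hτ => by
    have h2 := hric τ (hYpos τ hτ).le
    have h3 : 0 < (Y τ - 1) ^ 2 := pow_pos (hYpos τ hτ) 2
    rw [sub_nonneg, le_div_iff₀ h3]
    linarith
  have hb : (0 : ℝ) < (Y a - 1)⁻¹ := inv_pos.2 (hYpos a le_rfl)
  -- The comparison solution of the Riccati equation blows up exactly at a + 2/(Y(a)-1).
  have hle : a ≤ a + 2 * (Y a - 1)⁻¹ := by linarith
  have h4 := hm self_mem_Ici (show a ≤ a + 2 * (Y a - 1)⁻¹ from hle) hle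
  have h5 : 0 < (Y (a + 2 * (Y a - 1)⁻¹) - 1)⁻¹ := inv_pos.2 (hYpos _ hle)
  simp only at h4
  linarith

/-- For `θ < 0` there is no entire admissible radial solution. -/
theorem not_neg_of_entire (hn : 3 ≤ n) {k : ℕ} (hk : 1 ≤ k) {C θ ρ L₀ : ℝ} (hC : 0 < C)
    (hY : ∀ t, HasDerivAt Y (Z t * (d t + 2 * L t)) t) (hZ : ∀ t, HasDerivAt Z (-2 * Y t * Z t) t)
    (hL : ∀ t, HasDerivAt L (-d t * Y t) t)
    (hZpos : ∀ t, 0 < Z t)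
    (hLZ : ∀ t, L t * Z t = (1 - Y t ^ 2) / 2) (h1 : ∀ t, 0 < n * L t + d t)
    (heq : ∀ t, C * L t ^ (k - 1) * (n * L t + k * d t) = k * (ρ - 2 * θ * Y t) ^ k)
    (hf : ∀ t, 0 < ρ - 2 * θ * Y t) (h0 : 0 < 2 * θ + ρ)
    (hYlim : Tendsto Y atBot (𝓝 (-1))) (hZlim : Tendsto Z atBot (𝓝 0))
    (hLlim : Tendsto L atBot (𝓝 L₀)) (hL₀ : C * n * L₀ ^ k = k * (2 * θ + ρ) ^ k) : ¬ θ < 0 := by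
  intro hθ
  have hn' : (3 : ℝ) ≤ n := by exact_mod_cast hn
  have hk' : (1 : ℝ) ≤ k := by exact_mod_cast hk
  have hYm := neg_one_lt_of_sigma_one_pos hn hY hZpos hLZ h1 hYlim
  have hYp := lt_one_of_sigma_one_pos hn hY hZpos hLZ h1
  have hLpos : ∀ t, 0 < L t := fun t => by
    have : 0 < L t * Z t := by rw [hLZ]; nlinarith [hYm t, hYp t]
    exact pos_of_mul_pos_left this (hZpos t).le
  have hL₀pos : 0 < L₀ := by
    have h2 : 0 ≤ L₀ := ge_of_tendsto' hLlim fun t => (hLpos t).le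
    refine lt_of_le_of_ne h2 fun h => ?_
    rw [← h, zero_pow (by omega)] at hL₀
    have : 0 < k * (2 * θ + ρ) ^ k := by positivity
    linarith
  -- The equation solved for d: D = -C L^{k-1} d, so D and d have opposite signs.
  set D : ℝ → ℝ := fun t => C * n / k * L t ^ k - (ρ - 2 * θ * Y t) ^ k with hD
  have hkd : ∀ t, d t * (C * L t ^ (k - 1)) = -D t := fun t => by
    have h2 : L t ^ k = L t ^ (k - 1) * L t := by rw [← pow_succ]; congr 1; omega
    have h3 : k * (d t * (C * L t ^ (k - 1))) = k * -D t := by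
      simp only [hD]
      have : (k : ℝ) * -(C * n / k * L t ^ k - (ρ - 2 * θ * Y t) ^ k) =
        -(C * n * L t ^ k) + k * (ρ - 2 * θ * Y t) ^ k := by field_simp; ring
      rw [this, ← heq t, h2]
      ring
    exact mul_left_cancel₀ (by positivity) h3
  have hden : ∀ t, 0 < C * L t ^ (k - 1) := fun t => mul_pos hC (pow_pos (hLpos t) _)
  have hd : ∀ t, d t = -D t / (C * L t ^ (k - 1)) := fun t => by
    rw [eq_div_iff (hden t).ne', hkd]
  -- An integrating factor: E' = -nYE cancels the contribution nYD of L^k to D', so that (E D)'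
  -- involves only the derivative of the source term.
  set E : ℝ → ℝ := fun t => Z t ^ ((n : ℝ) / 2) with hE
  have hEpos : ∀ t, 0 < E t := fun t => Real.rpow_pos_of_pos (hZpos t) _
  have hE' : ∀ t, HasDerivAt E (-(n * Y t * E t)) t := fun t => by
    have := (hZ t).rpow_const (p := (n : ℝ) / 2) (Or.inl (hZpos t).ne')
    refine this.congr_deriv ?_
    rw [Real.rpow_sub_one (hZpos t).ne']
    have := (hZpos t).ne'
    simp only [hE]
    field_simp
  set G : ℝ → ℝ := fun t => E t * D t with hG
  have hG' : ∀ t, HasDerivAt G (-(E t * (k * (ρ - 2 * θ * Y t) ^ (k - 1) * (-(2 * θ)) *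
      (Z t * (d t + 2 * L t))))) t := fun t => by
    have h2 := ((hL t).pow k).const_mul (C * n / k)
    have h3 := (((hY t).const_mul (2 * θ)).const_sub ρ).pow k
    refine ((hE' t).mul (h2.sub h3)).congr_deriv ?_
    have h4 := hkd t
    have h5 : C * n / k * (k * L t ^ (k - 1) * (-d t * Y t)) = n * Y t * D t := by
      have h6 : C * n / k * (k * L t ^ (k - 1) * (-d t * Y t)) =
          -(n * Y t) * (d t * (C * L t ^ (k - 1))) := by field_simp
      rw [h6, h4]
      ring
    rw [h5]
    simp only [hD, Pi.sub_apply, Pi.pow_apply]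
    ring
  have hfac : ∀ t, 0 < E t * (k * (ρ - 2 * θ * Y t) ^ (k - 1) * (-(2 * θ))) := fun t => by
    have := hEpos t
    have := pow_pos (hf t) (k - 1)
    have : 0 < -(2 * θ) := by linarith
    positivity
  have hDlim : Tendsto D atBot (𝓝 0) := by
    have h2 := ((hLlim.pow k).const_mul (C * n / k)).sub
      (((hYlim.const_mul (2 * θ)).const_sub ρ).pow k)
    have h3 : C * n / k * L₀ ^ k - (ρ - 2 * θ * -1) ^ k = 0 := by
      have : C * n / k * L₀ ^ k = (2 * θ + ρ) ^ k := by
        rw [div_mul_eq_mul_div, hL₀]; field_simp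
      rw [this]
      ring
    rwa [h3] at h2
  have hElim : Tendsto E atBot (𝓝 0) := by
    have := hZlim.rpow_const (p := (n : ℝ) / 2) (Or.inr (by positivity))
    rwa [Real.zero_rpow (by positivity)] at this
  have hGlim : Tendsto G atBot (𝓝 0) := by simpa using hElim.mul hDlim
  have hY'lim : Tendsto (fun t => d t + 2 * L t) atBot (𝓝 (2 * L₀)) := by
    have h2 : Tendsto d atBot (𝓝 0) := by
      rw [show d = fun t => -D t / (C * L t ^ (k - 1)) from funext hd]
      have := hDlim.neg.div ((hLlim.pow (k - 1)).const_mul C) (by positivity)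
      rw [neg_zero, zero_div] at this
      exact this
    simpa using h2.add (hLlim.const_mul 2)
  -- Near the origin d → 0 and L → L₀ > 0, so Y increases there. Hence G decreases strictly from its
  -- limit 0 and is negative at T.
  obtain ⟨T, hT⟩ : ∃ T, ∀ t ≤ T, 0 < d t + 2 * L t :=
    eventually_atBot.1 (hY'lim.eventually (lt_mem_nhds (by positivity)))
  have hGanti : StrictAntiOn G (Iic T) := by
    refine strictAntiOn_of_deriv_neg (convex_Iic T)
      (fun t _ => (hG' t).continuousAt.continuousWithinAt) fun t ht => ?_
    rw [interior_Iic] at ht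
    rw [(hG' t).deriv, neg_lt_zero, ← mul_assoc]
    exact mul_pos (hfac t) (mul_pos (hZpos t) (hT t (le_of_lt ht)))
  have hGT : G T < 0 := by
    have h2 : G T < G (T - 1) := hGanti (show T - 1 ≤ T by linarith) (le_refl T) (by linarith)
    refine h2.trans_le (ge_of_tendsto hGlim ?_)
    filter_upwards [eventually_le_atBot (T - 1)] with t ht
    exact hGanti.antitoneOn (show t ≤ T by linarith) (show T - 1 ≤ T by linarith) ht
  have hDG : ∀ t, 0 ≤ -G t → D t ≤ 0 := fun t h => by
    by_contra hc
    push Not at hc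
    have := mul_pos (hEpos t) hc
    simp only [hG] at h
    linarith
  -- D ≤ 0 means d ≥ 0, and 2LZ = 1 - Y². Thus G ≤ 0 forces Y' > 0, which in turn makes G decrease:
  -- the sign is self-sustaining.
  have hY'pos : ∀ t, D t ≤ 0 → 1 - Y t ^ 2 ≤ Z t * (d t + 2 * L t) := fun t h => by
    have h2 : 0 ≤ d t := by rw [hd]; exact div_nonneg (by linarith) (hden t).le
    have h3 := hLZ t
    have h4 := mul_nonneg (hZpos t).le h2
    nlinarith
  have hone : ∀ t, 0 < 1 - Y t ^ 2 := fun t => by nlinarith [hYm t, hYp t]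
  have hgpos : ∀ t, T ≤ t → 0 ≤ -G t → 0 < E t * (k * (ρ - 2 * θ * Y t) ^ (k - 1) * (-(2 * θ)) *
      (Z t * (d t + 2 * L t))) := fun t _ h => by
    rw [← mul_assoc]
    exact mul_pos (hfac t) ((hone t).trans_le (hY'pos t (hDG t h)))
  have hg' : ∀ t, T ≤ t → HasDerivAt (fun t => -G t)
      (E t * (k * (ρ - 2 * θ * Y t) ^ (k - 1) * (-(2 * θ)) * (Z t * (d t + 2 * L t)))) t :=
    fun t _ => (hG' t).neg.congr_deriv (by ring)
  have hgnn := nonneg_of_deriv_pos_of_nonneg hg' (by linarith) hgpos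
  have hgmono := (strictMonoOn_Ici_of_deriv_pos hg' fun t h => hgpos t h (hgnn t h)).monotoneOn
  have hYd : ∀ t, T ≤ t → 1 - Y t ^ 2 ≤ Z t * (d t + 2 * L t) := fun t h =>
    hY'pos t (hDG t (hgnn t h))
  have hYmono := monotoneOn_Ici_of_deriv_nonneg (fun t _ => hY t)
    fun t (h : T ≤ t) => (hone t).le.trans (hYd t h)
  obtain ⟨T₂, hT₂, hYT₂⟩ : ∃ T₂, T ≤ T₂ ∧ 1 / 2 ≤ Y T₂ := by
    by_contra hc
    push Not at hc
    -- While Y(T) ≤ Y < 1/2, Y' ≥ (1+Y)(1-Y) ≥ c; after time 2/c, Y would have grown by 2 from above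
    -- -1, contradicting Y < 1.
    set c := (1 + Y T) / 2 with hcdef
    have hcpos : 0 < c := by have := hYm T; simp only [hcdef]; linarith
    have hm := monotoneOn_Ici_of_deriv_nonneg
      (fun t _ => (hY t).sub ((hasDerivAt_id t).const_mul c)) fun t (h : T ≤ t) => by
        have h2 := hYd t h
        have h3 := hc t h
        have h4 : Y T ≤ Y t := hYmono self_mem_Ici h h
        have h5 : c ≤ 1 - Y t ^ 2 := by
          have h6 : 0 ≤ 1 + Y t := by linarith [hYm t]
          have h7 : c ≤ (1 + Y t) * (1 / 2) := by simp only [hcdef]; linarith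
          nlinarith
        linarith
    have hle : T ≤ T + 2 / c := by have : 0 < 2 / c := by positivity
                                   linarith
    have h2 := hm self_mem_Ici hle hle
    have h3 : c * (T + 2 / c) = c * T + 2 := by field_simp
    simp only [Pi.sub_apply, id] at h2
    have := hYp (T + 2 / c)
    have := hYm T
    linarith
  have hYhalf : ∀ t, T₂ ≤ t → 1 / 2 ≤ Y t := fun t h =>
    hYT₂.trans (hYmono hT₂ (hT₂.trans h) h)
  -- E'/E = -nY ≤ -n/2 ≤ -1 once Y ≥ 1/2, so e^t E is nonincreasing.
  have hEbd : ∀ t, T₂ ≤ t → E t ≤ E T₂ * Real.exp (T₂ - t) := fun t h => by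
    have hm := monotoneOn_Ici_of_deriv_nonneg (a := T₂)
      (fun t _ => ((hE' t).mul (hasDerivAt_id t).exp).neg) fun t (h : T₂ ≤ t) => by
        have h2 := hYhalf t h
        have h3 := hEpos t
        have h4 := Real.exp_pos t
        have h5 : 0 ≤ (n * Y t - 1) := by nlinarith
        have := mul_nonneg (mul_nonneg h5 h3.le) h4.le
        simp only [id]
        linarith
    have h2 := hm self_mem_Ici h h
    simp only [Pi.neg_apply, Pi.mul_apply, id] at h2
    rw [Real.exp_sub, ← mul_div_assoc, le_div_iff₀ (Real.exp_pos t)]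
    linarith
  have hElim' : Tendsto (fun t => E T₂ * Real.exp (T₂ - t) * (ρ - 2 * θ) ^ k) atTop (𝓝 0) := by
    have h2 : Tendsto (fun t => Real.exp (T₂ - t)) atTop (𝓝 0) :=
      Real.tendsto_exp_atBot.comp (tendsto_atBot_add_const_left _ T₂ tendsto_neg_atTop_atBot)
    simpa using (h2.const_mul (E T₂)).mul_const ((ρ - 2 * θ) ^ k)
  obtain ⟨t, ht1, ht2⟩ := ((hElim'.eventually (gt_mem_nhds (show 0 < -G T by linarith))).and
    (eventually_ge_atTop T₂)).exists
  have h2 : -G T ≤ -G t := hgmono self_mem_Ici (hT₂.trans ht2) (hT₂.trans ht2)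
  have h3 : (ρ - 2 * θ * Y t) ^ k ≤ (ρ - 2 * θ) ^ k :=
    pow_le_pow_left₀ (hf t).le (by nlinarith [hYp t]) k
  have h4 : E t * (ρ - 2 * θ * Y t) ^ k ≤ E T₂ * Real.exp (T₂ - t) * (ρ - 2 * θ) ^ k :=
    mul_le_mul (hEbd t ht2) h3 (pow_pos (hf t) k).le ((hEpos t).le.trans (hEbd t ht2))
  have h5 : G t = E t * (C * n / k * L t ^ k) - E t * (ρ - 2 * θ * Y t) ^ k := by
    simp only [hG, hD]; ring
  have h6 : 0 < E t * (C * n / k * L t ^ k) := by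
    have := hEpos t
    have := hLpos t
    positivity
  linarith

end Entire
end KYamabe
-- Radial solutions as phase curves, and necessity of the two inequalities.
namespace KYamabe
open Filter Topology Set

/-- From k·binom(n-1,k) = (n-k)·binom(n-1,k-1). The factored form exposes the sign of nL + kd and
makes the equation linear in d. -/
lemma k_mul_radialSigma {n k : ℕ} (hn : 1 ≤ n) (hk : 1 ≤ k) (hkn : k ≤ n) (L d : ℝ) :
    k * radialSigma n k L d =
      ((n - 1).choose (k - 1) : ℝ) * L ^ (k - 1) * (n * L + k * d) := by
  obtain ⟨m, rfl⟩ : ∃ m, k = m + 1 := ⟨k - 1, by omega⟩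
  obtain ⟨N, rfl⟩ : ∃ N, n = N + 1 := ⟨n - 1, by omega⟩
  have h := Nat.choose_succ_right_eq N m
  have h2 : ((N.choose (m + 1) : ℝ)) * (m + 1) = N.choose m * (N - m) := by
    rw [← Nat.cast_sub (by omega)]
    exact_mod_cast h
  simp only [radialSigma, Nat.add_sub_cancel]
  push_cast
  rw [pow_succ]
  linear_combination (L ^ m * L) * h2

/-- The logarithmic derivative of `φ(r²) / r` with respect to `log r`. -/
noncomputable def phaseSlope (φ : ℝ → ℝ) (t : ℝ) : ℝ :=
  -1 + 2 * Real.exp (2 * t) * deriv φ (Real.exp (2 * t)) / φ (Real.exp (2 * t))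

/-- The conformal factor of `φ(|x|²)^{-2} |dx|²` with respect to the cylindrical metric. -/
noncomputable def phaseFactor (φ : ℝ → ℝ) (t : ℝ) : ℝ :=
  Real.exp (2 * t) / φ (Real.exp (2 * t)) ^ 2

section Phase
variable {φ : ℝ → ℝ} {t : ℝ}

lemma hasDerivAt_exp_two_mul (t : ℝ) :
    HasDerivAt (fun t => Real.exp (2 * t)) (2 * Real.exp (2 * t)) t :=
  (((hasDerivAt_id t).const_mul 2).exp).congr_deriv (by simp; ring)

lemma angular_mul_phaseFactor (h : φ (Real.exp (2 * t)) ≠ 0) :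
    angular φ (Real.exp (2 * t)) * phaseFactor φ t = (1 - phaseSlope φ t ^ 2) / 2 := by
  rw [angular, phaseFactor, phaseSlope]
  field_simp
  ring

lemma hasDerivAt_phaseSlope (hφ : ContDiffAt ℝ 2 φ (Real.exp (2 * t)))
    (h : φ (Real.exp (2 * t)) ≠ 0) :
    HasDerivAt (phaseSlope φ) (phaseFactor φ t *
      (defect φ (Real.exp (2 * t)) + 2 * angular φ (Real.exp (2 * t)))) t := by
  have h1 : HasDerivAt φ (deriv φ (Real.exp (2 * t))) (Real.exp (2 * t)) :=
    (hφ.differentiableAt (by simp)).hasDerivAt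
  have h2 : HasDerivAt (deriv φ) (deriv (deriv φ) (Real.exp (2 * t))) (Real.exp (2 * t)) :=
    ((contDiffAt_deriv (m := 1) hφ (by norm_num)).differentiableAt (by simp)).hasDerivAt
  have h3 := hasDerivAt_exp_two_mul t
  have h4 := ((((h3.const_mul 2).mul (h2.comp t h3)).div (h1.comp t h3) h).const_add (-1))
  refine h4.congr_deriv ?_
  rw [phaseFactor, defect, angular]
  simp only [Function.comp_apply, Pi.mul_apply]
  field_simp
  ring

lemma hasDerivAt_phaseFactor (hφ : DifferentiableAt ℝ φ (Real.exp (2 * t)))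
    (h : φ (Real.exp (2 * t)) ≠ 0) :
    HasDerivAt (phaseFactor φ) (-2 * phaseSlope φ t * phaseFactor φ t) t := by
  have h3 := hasDerivAt_exp_two_mul t
  refine (h3.div ((hφ.hasDerivAt.comp t h3).pow 2) (pow_ne_zero 2 h)).congr_deriv ?_
  rw [phaseFactor, phaseSlope]
  simp only [Function.comp_apply, Pi.pow_apply]
  field_simp
  ring

lemma hasDerivAt_angular_exp (hφ : ContDiffAt ℝ 2 φ (Real.exp (2 * t)))
    (h : φ (Real.exp (2 * t)) ≠ 0) :
    HasDerivAt (fun t => angular φ (Real.exp (2 * t)))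
      (-defect φ (Real.exp (2 * t)) * phaseSlope φ t) t := by
  have h1 : HasDerivAt φ (deriv φ (Real.exp (2 * t))) (Real.exp (2 * t)) :=
    (hφ.differentiableAt (by simp)).hasDerivAt
  have h2 : HasDerivAt (deriv φ) (deriv (deriv φ) (Real.exp (2 * t))) (Real.exp (2 * t)) :=
    ((contDiffAt_deriv (m := 1) hφ (by norm_num)).differentiableAt (by simp)).hasDerivAt
  have h3 := hasDerivAt_exp_two_mul t
  refine ((((h1.comp t h3).const_mul 2).mul (h2.comp t h3)).sub
    ((h3.const_mul 2).mul ((h2.comp t h3).pow 2))).congr_deriv ?_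
  rw [defect, phaseSlope]
  simp only [Function.comp_apply, Pi.pow_apply]
  field_simp
  ring

end Phase

/-- Behaviour at the origin of the profile of a smooth radial function. -/
lemma tendsto_profile {V : ℝ → ℝ} (hV : ContDiff ℝ ∞ V) (heven : ∀ r, V (-r) = V r)
    (h0 : V 0 ≠ 0) :
    Tendsto (phaseSlope fun s => V √s) atBot (𝓝 (-1)) ∧
    Tendsto (phaseFactor fun s => V √s) atBot (𝓝 0) ∧
    Tendsto (fun t => angular (fun s => V √s) (Real.exp (2 * t))) atBot
      (𝓝 (V 0 * deriv (deriv V) 0)) ∧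
    Tendsto (fun t => defect (fun s => V √s) (Real.exp (2 * t))) atBot (𝓝 0) := by
  have hV1 : ContDiff ℝ ∞ (deriv V) := contDiff_iff_contDiffAt.2 fun r =>
    contDiffAt_deriv hV.contDiffAt (by simp)
  have hV2 : ContDiff ℝ ∞ (deriv (deriv V)) := contDiff_iff_contDiffAt.2 fun r =>
    contDiffAt_deriv hV1.contDiffAt (by simp)
  have hd : ∀ r, HasDerivAt V (deriv V r) r := fun r =>
    (hV.differentiable (by simp) r).hasDerivAt
  have hd1 : ∀ r, HasDerivAt (deriv V) (deriv (deriv V) r) r := fun r =>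
    (hV1.differentiable (by simp) r).hasDerivAt
  -- V is even. Consequently V'(r)/r tends to V''(0), which makes all four limits finite.
  have hdz : deriv V 0 = 0 := by
    have h1 : HasDerivAt V (-deriv V 0) 0 := by
      have : HasDerivAt (fun r => V (-r)) (deriv V (-0) * -1) 0 :=
        (hd (-0)).comp (0 : ℝ) (hasDerivAt_neg (0 : ℝ))
      simpa [heven] using this
    have := h1.unique (hd 0)
    linarith
  have hφ1 : ∀ s, 0 < s → HasDerivAt (fun s => V √s) (deriv V √s / (2 * √s)) s := fun s hs =>
    ((hd √s).comp s (Real.hasDerivAt_sqrt hs.ne')).congr_deriv (by ring)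
  have hφ1' : ∀ s, 0 < s → deriv (fun s => V √s) s = deriv V √s / (2 * √s) := fun s hs =>
    (hφ1 s hs).deriv
  -- The factor s in `defect` cancels this 1/s, leaving V(V'' - V'/r), which tends to 0.
  have hφ2 : ∀ s, 0 < s → deriv (deriv fun s => V √s) s =
      (deriv (deriv V) √s - deriv V √s / √s) / (4 * s) := fun s hs => by
    have he : (deriv fun s => V √s) =ᶠ[𝓝 s] fun s => deriv V √s / (2 * √s) := by
      filter_upwards [lt_mem_nhds hs] with r hr using hφ1' r hr
    have hsq := Real.sqrt_pos.2 hs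
    have h1 := Real.hasDerivAt_sqrt hs.ne'
    have h2 := ((hd1 √s).comp s h1).div (h1.const_mul 2) (by positivity)
    rw [he.deriv_eq]
    refine h2.deriv.trans ?_
    have h3 : s = √s ^ 2 := (Real.sq_sqrt hs.le).symm
    simp only [Function.comp_apply]
    set r := √s
    rw [h3]
    field_simp
    ring
  have hsq : ∀ t, √(Real.exp (2 * t)) = Real.exp t := fun t => by
    rw [two_mul, Real.exp_add, Real.sqrt_mul_self (Real.exp_pos t).le]
  have hexp : ∀ t, Real.exp (2 * t) = Real.exp t ^ 2 := fun t => by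
    rw [two_mul, Real.exp_add, sq]
  have hr : Tendsto Real.exp atBot (𝓝 0) := Real.tendsto_exp_atBot
  have hrne : Tendsto Real.exp atBot (𝓝[≠] 0) :=
    tendsto_nhdsWithin_iff.2 ⟨hr, Eventually.of_forall fun t => (Real.exp_pos t).ne'⟩
  have hv0 : Tendsto (fun t => V (Real.exp t)) atBot (𝓝 (V 0)) := (hV.continuous.tendsto 0).comp hr
  have hv1 : Tendsto (fun t => deriv V (Real.exp t)) atBot (𝓝 0) := by
    have := (hV1.continuous.tendsto 0).comp hr
    rwa [hdz] at this
  have hv2 : Tendsto (fun t => deriv (deriv V) (Real.exp t)) atBot (𝓝 (deriv (deriv V) 0)) :=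
    (hV2.continuous.tendsto 0).comp hr
  have hv1r : Tendsto (fun t => deriv V (Real.exp t) / Real.exp t) atBot
      (𝓝 (deriv (deriv V) 0)) := by
    have := (hasDerivAt_iff_tendsto_slope.1 (hd1 0)).comp hrne
    refine this.congr fun t => ?_
    simp [slope_def_field, hdz]
  refine ⟨?_, ?_, ?_, ?_⟩
  · have : Tendsto (fun t => -1 + Real.exp t * deriv V (Real.exp t) / V (Real.exp t)) atBot
        (𝓝 (-1 + 0 * 0 / V 0)) := ((hr.mul hv1).div hv0 h0).const_add (-1)
    simp only [zero_mul, zero_div, add_zero] at this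
    refine this.congr fun t => ?_
    have := Real.exp_pos t
    rw [phaseSlope, hφ1' _ (Real.exp_pos _), hsq, hexp]
    field_simp
  · have : Tendsto (fun t => Real.exp t ^ 2 / V (Real.exp t) ^ 2) atBot (𝓝 (0 ^ 2 / V 0 ^ 2)) :=
      (hr.pow 2).div (hv0.pow 2) (pow_ne_zero 2 h0)
    simp only [zero_pow two_ne_zero, zero_div] at this
    refine this.congr fun t => ?_
    rw [phaseFactor, hsq, hexp]
  · have := (hv0.mul hv1r).sub ((hv1.pow 2).div_const 2)
    simp only [zero_pow two_ne_zero, zero_div, sub_zero] at this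
    refine this.congr fun t => ?_
    have := Real.exp_pos t
    rw [angular, hφ1' _ (Real.exp_pos _), hsq, hexp]
    field_simp
  · have := hv0.mul (hv2.sub hv1r)
    rw [sub_self, mul_zero] at this
    refine this.congr fun t => ?_
    have := Real.exp_pos t
    rw [defect, hφ2 _ (Real.exp_pos _), hsq, hexp]
    field_simp

section Necessity
variable {n k : ℕ} {θ ρ : ℝ} {u : E n → ℝ}

/-- The drift x·Du vanishes at the origin, where the equation identifies 2θ + ρ with σ_k^{1/k}. -/
lemma sum_pos_of_solution (hn : 3 ≤ n) (hk : 1 ≤ k) (hu : ContDiff ℝ ∞ u) (hpos : ∀ x, 0 < u x)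
    (hsol : SolvesEquation n k θ ρ u) (hadm : Admissible n k u) : 0 < 2 * θ + ρ := by
  have hS := hadm 0 k (by simp [hk])
  rw [sigmaCurv_confMetric hn hu hpos (fun _ => rfl)] at hS
  have h := (equation_iff hk θ ρ hu hpos (fun _ => rfl) hS.le).1 (hsol 0)
  have h2 := Real.rpow_pos_of_pos hS (1 / (k : ℝ))
  rw [h] at h2
  simpa using h2

/-- For θ = 0 the equation says σ_k = ρ^k everywhere. -/
lemma ne_zero_of_solution (hn : 3 ≤ n) (hk : 1 ≤ k) (hu : ContDiff ℝ ∞ u) (hpos : ∀ x, 0 < u x)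
    (hsol : SolvesEquation n k θ ρ u) (hadm : Admissible n k u) (hnt : ¬ Trivial n k u) :
    θ ≠ 0 := by
  rintro rfl
  refine hnt ⟨ρ ^ k, fun x => ?_⟩
  have hS := hadm x k (by simp [hk])
  rw [sigmaCurv_confMetric hn hu hpos (fun _ => rfl)] at hS ⊢
  have h := (equation_iff hk 0 ρ hu hpos (fun _ => rfl) hS.le).1 (hsol x)
  simp only [mul_zero, zero_mul, zero_div, sub_zero, zero_add] at h
  rw [← h, one_div, Real.rpow_inv_natCast_pow hS.le (by omega)]

lemma not_neg_of_solution (hn : 3 ≤ n) (hk : 1 ≤ k) (hkn : 2 * k ≤ n)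
    (hu : ContDiff ℝ ∞ u) (hpos : ∀ x, 0 < u x) (hrad : Radial u)
    (hsol : SolvesEquation n k θ ρ u) (hadm : Admissible n k u) : ¬ θ < 0 := by
  have h0 := sum_pos_of_solution hn hk hu hpos hsol hadm
  set q : ℝ := 2 * (k : ℝ) / ((n : ℝ) + 2 * k) with hq
  let v : E n → ℝ := fun x => u x ^ (-q)
  have hv : ContDiff ℝ ∞ v := contDiff_rpow_of_pos hu hpos _
  have hvpos : ∀ x, 0 < v x := fun x => Real.rpow_pos_of_pos (hpos x) _
  let e : E n := EuclideanSpace.single ⟨0, by omega⟩ 1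
  have hnorm : ∀ r : ℝ, ‖r • e‖ = |r| := fun r => by simp [e, norm_smul]
  let V : ℝ → ℝ := fun r => v (r • e)
  have hV : ContDiff ℝ ∞ V := hv.comp (contDiff_id.smul contDiff_const)
  have hVrad : ∀ x y : E n, ‖x‖ = ‖y‖ → v x = v y := fun x y h => by
    simp only [v, hrad x y h]
  have heven : ∀ r, V (-r) = V r := fun r => hVrad _ _ (by rw [hnorm, hnorm, abs_neg])
  have hV0 : V 0 ≠ 0 := (hvpos _).ne'
  -- Smoothness of φ is needed only for s > 0, that is s = e^{2t}; the behaviour at the origin comes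
  -- from `tendsto_profile`.
  set φ : ℝ → ℝ := fun s => V √s with hφdef
  have hvφ : v = fun y => φ (‖y‖ ^ 2) := funext fun y => hVrad _ _ (by
    rw [hnorm, Real.sqrt_sq (norm_nonneg y), abs_of_nonneg (norm_nonneg y)])
  have hφpos : ∀ s, φ s ≠ 0 := fun s => (hvpos _).ne'
  have hφs : ∀ s, 0 < s → ContDiffAt ℝ 2 φ s := fun s hs =>
    (hV.contDiffAt.of_le (WithTop.coe_le_coe.2 le_top)).comp s (Real.contDiffAt_sqrt hs.ne')
  obtain ⟨hY, hZ, hL, hd⟩ := tendsto_profile hV heven hV0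
  have hxt : ∀ t, ‖Real.exp t • e‖ ^ 2 = Real.exp (2 * t) := fun t => by
    rw [hnorm, sq_abs, two_mul, Real.exp_add, sq]
  have hσ : ∀ t, ∀ j ∈ Finset.Icc 1 k,
      0 < radialSigma n j (angular φ (Real.exp (2 * t))) (defect φ (Real.exp (2 * t))) := by
    intro t j hj
    have h := hadm (Real.exp t • e) j hj
    have hs := hφs _ (Real.exp_pos (2 * t))
    rw [← hxt] at hs ⊢
    rwa [sigmaCurv_confMetric hn hu hpos (v := v) (fun _ => rfl),
      sigma_radial (by omega) hvφ.eventuallyEq hs (Finset.mem_Icc.1 hj).1] at h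
  have heq : ∀ t, radialSigma n k (angular φ (Real.exp (2 * t))) (defect φ (Real.exp (2 * t))) ^
      (1 / (k : ℝ)) = ρ - 2 * θ * phaseSlope φ t := by
    intro t
    have hS := hσ t k (by simp [hk])
    have hs := hφs _ (Real.exp_pos (2 * t))
    rw [← hxt] at hs hS ⊢
    rw [← sigma_radial (by omega) hvφ.eventuallyEq hs hk] at hS ⊢
    rw [(equation_iff hk θ ρ hu hpos (v := v) (fun _ => rfl) hS.le).1 (hsol _),
      fderiv_radial_apply hvφ.eventuallyEq (hs.differentiableAt (by simp)), phaseSlope, ← hxt,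
      congrFun hvφ]
    ring
  have hf : ∀ t, 0 < ρ - 2 * θ * phaseSlope φ t := fun t => by
    rw [← heq]
    exact Real.rpow_pos_of_pos (hσ t k (by simp [hk])) _
  have heq' : ∀ t, ((n - 1).choose (k - 1) : ℝ) * angular φ (Real.exp (2 * t)) ^ (k - 1) *
      (n * angular φ (Real.exp (2 * t)) + k * defect φ (Real.exp (2 * t))) =
      k * (ρ - 2 * θ * phaseSlope φ t) ^ k := fun t => by
    rw [← k_mul_radialSigma (by omega) hk (by omega), ← heq, one_div,
      Real.rpow_inv_natCast_pow (hσ t k (by simp [hk])).le (by omega)]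
  have hC : (0 : ℝ) < ((n - 1).choose (k - 1) : ℝ) := by
    exact_mod_cast Nat.choose_pos (by omega)
  refine not_neg_of_entire (L₀ := V 0 * deriv (deriv V) 0) hn hk hC
    (fun t => hasDerivAt_phaseSlope (hφs _ (Real.exp_pos _)) (hφpos _))
    (fun t => hasDerivAt_phaseFactor ((hφs _ (Real.exp_pos _)).differentiableAt (by simp)) (hφpos _))
    (fun t => hasDerivAt_angular_exp (hφs _ (Real.exp_pos _)) (hφpos _))
    (fun t => div_pos (Real.exp_pos _) (by have := hφpos (Real.exp (2 * t)); positivity))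
    (fun t => angular_mul_phaseFactor (hφpos _)) (fun t => ?_) heq' hf h0 hY hZ hL ?_
  · have h := hσ t 1 (by simp [hk])
    have h2 := k_mul_radialSigma (n := n) (k := 1) (by omega) le_rfl (by omega)
      (angular φ (Real.exp (2 * t))) (defect φ (Real.exp (2 * t)))
    simp at h2
    rwa [h2] at h
  -- The algebraic relation for L₀ is the limit of the equation as t → -∞, where d → 0 and Y → -1.
  · have h1 := ((hL.pow (k - 1)).const_mul ((n - 1).choose (k - 1) : ℝ)).mul
      ((hL.const_mul (n : ℝ)).add (hd.const_mul (k : ℝ)))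
    have h2 := (((hY.const_mul (2 * θ)).const_sub ρ).pow k).const_mul (k : ℝ)
    have h3 := tendsto_nhds_unique (h1.congr heq') h2
    have h4 : V 0 * deriv (deriv V) 0 * (V 0 * deriv (deriv V) 0) ^ (k - 1) =
        (V 0 * deriv (deriv V) 0) ^ k := by
      rw [← pow_succ']; congr 1; omega
    rw [← h4]
    rw [mul_zero, add_zero] at h3
    rw [show 2 * θ + ρ = ρ - 2 * θ * -1 by ring, ← h3]
    ring

end Necessity
end KYamabe
-- Dilation averages: fixed points and regularity.
namespace KYamabe
open Filter Topology Set MeasureTheory BoundedContinuousFunction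

/-- The average `∫₀¹ w(τ) h(τ z) dτ` over dilations. -/
noncomputable def dilationAvg (w h : ℝ → ℝ) (z : ℝ) : ℝ := ∫ τ in (0 : ℝ)..1, w τ * h (τ * z)

lemma continuous_dilationAvg {w h : ℝ → ℝ} (hw : Continuous w) (hh : Continuous h) :
    Continuous (dilationAvg w h) := by
  refine intervalIntegral.continuous_parametric_intervalIntegral_of_continuous' ?_ 0 1
  simp only [Function.uncurry_def]
  fun_prop

lemma abs_dilationAvg_le {w : ℝ → ℝ} (hw1 : ∀ τ ∈ Icc (0 : ℝ) 1, |w τ| ≤ 1)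
    {h : ℝ → ℝ} {B : ℝ} {z : ℝ} (hB : ∀ τ ∈ Icc (0 : ℝ) 1, |h (τ * z)| ≤ B) :
    |dilationAvg w h z| ≤ B := by
  have := intervalIntegral.norm_integral_le_of_norm_le_const (a := (0 : ℝ)) (b := 1) (C := B)
    (f := fun τ => w τ * h (τ * z)) (fun τ hτ => by
      rw [uIoc_of_le zero_le_one] at hτ
      have h1 := hw1 τ ⟨hτ.1.le, hτ.2⟩
      have h2 := hB τ ⟨hτ.1.le, hτ.2⟩
      rw [Real.norm_eq_abs, abs_mul]
      calc |w τ| * |h (τ * z)| ≤ 1 * B := mul_le_mul h1 h2 (abs_nonneg _) zero_le_one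
        _ = B := one_mul B)
  simpa [dilationAvg] using this

lemma dilationAvg_sub {w h h' : ℝ → ℝ} (hw : Continuous w) {z : ℝ}
    (hh : ContinuousOn (fun τ => h (τ * z)) (Icc 0 1))
    (hh' : ContinuousOn (fun τ => h' (τ * z)) (Icc 0 1)) :
    dilationAvg w h z - dilationAvg w h' z = dilationAvg w (fun z => h z - h' z) z := by
  rw [dilationAvg, dilationAvg, dilationAvg, ← intervalIntegral.integral_sub]
  · simp only [mul_sub]
  · exact (hw.continuousOn.mul (by rwa [uIcc_of_le zero_le_one])).intervalIntegrable
  · exact (hw.continuousOn.mul (by rwa [uIcc_of_le zero_le_one])).intervalIntegrable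

/-- With a weight bounded by 1 the average does not increase the sup norm, so the map M ↦ average of
Ψ(z, M(z)) inherits the Lipschitz constant 1/2 and contracts the bounded continuous functions. -/
lemma exists_dilation_fixedPoint {w : ℝ → ℝ} (hw : Continuous w)
    (hw1 : ∀ τ ∈ Icc (0 : ℝ) 1, |w τ| ≤ 1) {Ψ : ℝ → ℝ → ℝ} (hΨ : Continuous (Function.uncurry Ψ))
    {B : ℝ} (hB : ∀ z m, |Ψ z m| ≤ B)
    (hlip : ∀ z m m', |Ψ z m - Ψ z m'| ≤ 1 / 2 * |m - m'|) :
    ∃ M : ℝ → ℝ, Continuous M ∧ ∀ z, M z = dilationAvg w (fun z => Ψ z (M z)) z := by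
  have hc : ∀ M : ℝ →ᵇ ℝ, Continuous fun z => Ψ z (M z) := fun M =>
    hΨ.comp (continuous_id.prodMk M.continuous)
  let T : (ℝ →ᵇ ℝ) → (ℝ →ᵇ ℝ) := fun M =>
    ofNormedAddCommGroup (dilationAvg w fun z => Ψ z (M z)) (continuous_dilationAvg hw (hc M)) B
      fun z => abs_dilationAvg_le hw1 fun τ _ => hB _ _
  have hT : ContractingWith (1 / 2) T := by
    refine ⟨by rw [← NNReal.coe_lt_coe]; norm_num, LipschitzWith.of_dist_le_mul fun M M' => ?_⟩
    refine (BoundedContinuousFunction.dist_le (by positivity)).2 fun z => ?_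
    change |dilationAvg w (fun z => Ψ z (M z)) z - dilationAvg w (fun z => Ψ z (M' z)) z| ≤ _
    have hcz : Continuous fun τ : ℝ => τ * z := continuous_id.mul continuous_const
    rw [dilationAvg_sub hw ((hc M).comp hcz).continuousOn ((hc M').comp hcz).continuousOn]
    refine abs_dilationAvg_le hw1 fun τ _ => (hlip _ _ _).trans ?_
    have := M.dist_coe_le_dist (g := M') (τ * z)
    rw [Real.dist_eq] at this
    simpa using this
  obtain ⟨M, hM⟩ : ∃ M, Function.IsFixedPt T M := ⟨_, hT.fixedPoint_isFixedPt⟩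
  refine ⟨M, M.continuous, fun z => ?_⟩
  have := congrArg (fun F : ℝ →ᵇ ℝ => F z) hM
  exact this.symm

section Regularity
variable {w h : ℝ → ℝ} {ε : ℝ}

lemma mul_mem_Icc_of_mem {τ x r : ℝ} (hτ : τ ∈ Icc (0 : ℝ) 1) (hx : x ∈ Icc (-r) r) :
    τ * x ∈ Icc (-r) r := by
  rw [mem_Icc, ← abs_le] at hx ⊢
  rw [abs_mul, abs_of_nonneg hτ.1]
  exact (mul_le_of_le_one_left (abs_nonneg x) hτ.2).trans hx

lemma continuousOn_comp_mul (hh : ContinuousOn h (Ioo (-ε) ε)) {z : ℝ} (hz : z ∈ Ioo (-ε) ε) :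
    ContinuousOn (fun τ => h (τ * z)) (Icc 0 1) := by
  have hz' : |z| < ε := abs_lt.2 hz
  refine hh.comp (continuous_id.mul continuous_const).continuousOn fun τ hτ => ?_
  have := mul_mem_Icc_of_mem hτ (abs_le.1 le_rfl : z ∈ Icc (-|z|) |z|)
  exact ⟨by linarith [this.1], by linarith [this.2]⟩

lemma continuousOn_dilationAvg (hw : Continuous w) (hh : ContinuousOn h (Ioo (-ε) ε)) :
    ContinuousOn (dilationAvg w h) (Ioo (-ε) ε) := by
  intro z hz
  obtain ⟨r, hr1, hr2⟩ := exists_between (abs_lt.2 hz)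
  have hr0 : -r ≤ r := by linarith [abs_nonneg z]
  -- A globally continuous extension of h from [-r, r]; the averages at |y| < r only see that
  -- interval.
  let g : ℝ → ℝ := fun y => h (projIcc (-r) r hr0 y)
  have hg : Continuous g := hh.comp_continuous (continuous_subtype_val.comp continuous_projIcc)
    fun y => ⟨by linarith [(projIcc (-r) r hr0 y).2.1], by linarith [(projIcc (-r) r hr0 y).2.2]⟩
  refine ((continuous_dilationAvg hw hg).continuousAt.congr ?_).continuousWithinAt
  filter_upwards [Ioo_mem_nhds (abs_lt.1 hr1).1 (abs_lt.1 hr1).2] with y hy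
  refine intervalIntegral.integral_congr fun τ hτ => ?_
  rw [uIcc_of_le zero_le_one] at hτ
  simp only [g, projIcc_of_mem hr0 (mul_mem_Icc_of_mem hτ (Ioo_subset_Icc_self hy))]

lemma hasDerivAt_dilationAvg (hw : Continuous w) (hh : ContDiffOn ℝ 1 h (Ioo (-ε) ε)) {z : ℝ}
    (hz : z ∈ Ioo (-ε) ε) :
    HasDerivAt (dilationAvg w h) (dilationAvg (fun τ => w τ * τ) (deriv h) z) z := by
  obtain ⟨r, hr1, hr2⟩ := exists_between (abs_lt.2 hz)
  have hsub : Icc (-r) r ⊆ Ioo (-ε) ε := fun y hy => ⟨by linarith [hy.1], by linarith [hy.2]⟩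
  have hd : ContinuousOn (deriv h) (Ioo (-ε) ε) :=
    hh.continuousOn_deriv_of_isOpen isOpen_Ioo le_rfl
  obtain ⟨B, hB⟩ := isCompact_Icc.exists_bound_of_continuousOn (hd.mono hsub)
  obtain ⟨A, hA⟩ := (isCompact_Icc (a := (0 : ℝ)) (b := 1)).exists_bound_of_continuousOn
    hw.continuousOn
  have hmem : ∀ {x τ}, x ∈ Ioo (-r) r → τ ∈ uIoc (0 : ℝ) 1 → τ * x ∈ Icc (-r) r := fun hx hτ => by
    rw [uIoc_of_le zero_le_one] at hτ
    exact mul_mem_Icc_of_mem ⟨hτ.1.le, hτ.2⟩ (Ioo_subset_Icc_self hx)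
  have hs : Ioo (-r) r ∈ 𝓝 z := Ioo_mem_nhds (abs_lt.1 hr1).1 (abs_lt.1 hr1).2
  have hcon : ∀ x ∈ Ioo (-r) r, ContinuousOn (fun τ => w τ * h (τ * x)) (Icc 0 1) := fun x hx =>
    hw.continuousOn.mul (continuousOn_comp_mul hh.continuousOn (hsub (Ioo_subset_Icc_self hx)))
  have hsubI : uIoc (0 : ℝ) 1 ⊆ Icc 0 1 := by
    rw [uIoc_of_le zero_le_one]; exact Ioc_subset_Icc_self
  have key := intervalIntegral.hasDerivAt_integral_of_dominated_loc_of_deriv_le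
    (F := fun x τ => w τ * h (τ * x)) (F' := fun x τ => w τ * τ * deriv h (τ * x))
    (x₀ := z) (s := Ioo (-r) r) (bound := fun _ => A * 1 * B) (a := 0) (b := 1) (μ := volume) hs
    (by
      filter_upwards [hs] with x hx
      exact ((hcon x hx).mono hsubI).aestronglyMeasurable measurableSet_uIoc)
    (by
      refine ContinuousOn.intervalIntegrable ?_
      rw [uIcc_of_le zero_le_one]
      exact hcon z (mem_of_mem_nhds hs))
    (by
      refine ContinuousOn.aestronglyMeasurable ?_ measurableSet_uIoc
      exact ((hw.mul continuous_id).continuousOn.mul (continuousOn_comp_mul hd hz)).mono hsubI)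
    (Eventually.of_forall fun τ hτ x hx => by
      have h1 := hA τ (hsubI hτ)
      have h2 := hB _ (hmem hx hτ)
      have h3 : ‖τ‖ ≤ 1 := by
        rw [Real.norm_eq_abs, abs_of_nonneg (hsubI hτ).1]; exact (hsubI hτ).2
      rw [norm_mul, norm_mul]
      have hA0 : 0 ≤ A := (norm_nonneg _).trans h1
      gcongr)
    (by simp)
    (Eventually.of_forall fun τ hτ x hx => by
      have h1 : HasDerivAt h (deriv h (τ * x)) (τ * x) :=
        ((hh.differentiableOn one_ne_zero).differentiableAt
          (isOpen_Ioo.mem_nhds (hsub (hmem hx hτ)))).hasDerivAt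
      have h2 : HasDerivAt (fun x => τ * x) τ x := by simpa using (hasDerivAt_id x).const_mul τ
      exact ((h1.comp x h2).const_mul (w τ)).congr_deriv (by ring))
  exact key.2

/-- The derivative of an average is again an average, of h' with weight τ w(τ); the induction
therefore runs over all weights. -/
lemma contDiffOn_dilationAvg (m : ℕ) (hw : Continuous w) (hh : ContDiffOn ℝ m h (Ioo (-ε) ε)) :
    ContDiffOn ℝ m (dilationAvg w h) (Ioo (-ε) ε) := by
  induction m generalizing w h with
  | zero =>
    rw [Nat.cast_zero, contDiffOn_zero] at hh ⊢
    exact continuousOn_dilationAvg hw hh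
  | succ m ih =>
    have h1 : ContDiffOn ℝ 1 h (Ioo (-ε) ε) := hh.of_le (by exact_mod_cast Nat.le_add_left 1 m)
    push_cast at hh ⊢
    rw [contDiffOn_succ_iff_deriv_of_isOpen isOpen_Ioo] at hh ⊢
    refine ⟨fun z hz => (hasDerivAt_dilationAvg hw h1 hz).differentiableAt.differentiableWithinAt,
      by simp, (ih (hw.mul continuous_id) hh.2.2).congr fun z hz =>
        (hasDerivAt_dilationAvg hw h1 hz).deriv⟩

lemma dilationAvg_rpow_eq {a : ℝ} {z : ℝ} (hz : 0 < z) :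
    dilationAvg (fun τ => τ ^ (a - 1)) h z =
      z ^ (-a) * ∫ σ in (0 : ℝ)..z, σ ^ (a - 1) * h σ := by
  have h1 := intervalIntegral.integral_comp_mul_right (a := 0) (b := 1)
    (fun σ => σ ^ (a - 1) * h σ) hz.ne'
  rw [zero_mul, one_mul, smul_eq_mul] at h1
  have h2 : ∫ τ in (0 : ℝ)..1, (τ * z) ^ (a - 1) * h (τ * z) =
      z ^ (a - 1) * dilationAvg (fun τ => τ ^ (a - 1)) h z := by
    rw [dilationAvg, ← intervalIntegral.integral_const_mul]
    refine intervalIntegral.integral_congr fun τ hτ => ?_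
    rw [uIcc_of_le zero_le_one] at hτ
    simp only [Real.mul_rpow hτ.1 hz.le]
    ring
  rw [h2] at h1
  rw [Real.rpow_neg hz.le, Real.rpow_sub_one hz.ne'] at *
  have := (Real.rpow_pos_of_pos hz a).ne'
  field_simp at h1 ⊢
  exact h1

/-- After σ = τz the average is z^{-a} times a primitive, so away from 0 it is differentiable for
merely continuous h and solves the Euler equation z M' + a M = h. -/
lemma hasDerivAt_dilationAvg_rpow_of_pos {a : ℝ} (ha : 1 ≤ a) (hh : ContinuousOn h (Ioo (-ε) ε))
    {z : ℝ} (hz : z ∈ Ioo (-ε) ε) (hz0 : 0 < z) :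
    HasDerivAt (dilationAvg (fun τ => τ ^ (a - 1)) h)
      ((h z - a * dilationAvg (fun τ => τ ^ (a - 1)) h z) / z) z := by
  have hw : Continuous fun τ : ℝ => τ ^ (a - 1) := Real.continuous_rpow_const (by linarith)
  have hsub : uIcc 0 z ⊆ Ioo (-ε) ε := by
    rw [uIcc_of_le hz0.le]
    exact fun y hy => ⟨by linarith [hy.1, hz.1, hz.2], by linarith [hy.2, hz.2]⟩
  have hc : ContinuousOn (fun σ => σ ^ (a - 1) * h σ) (Ioo (-ε) ε) := hw.continuousOn.mul hh
  have h1 : HasDerivAt (fun z => ∫ σ in (0 : ℝ)..z, σ ^ (a - 1) * h σ) (z ^ (a - 1) * h z) z :=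
    intervalIntegral.integral_hasDerivAt_right (hc.mono hsub).intervalIntegrable
      (hc.stronglyMeasurableAtFilter isOpen_Ioo z hz)
      (hc.continuousAt (isOpen_Ioo.mem_nhds hz))
  have h2 := (Real.hasDerivAt_rpow_const (p := -a) (Or.inl hz0.ne')).mul h1
  have h3 : dilationAvg (fun τ => τ ^ (a - 1)) h =ᶠ[𝓝 z]
      fun z => z ^ (-a) * ∫ σ in (0 : ℝ)..z, σ ^ (a - 1) * h σ := by
    filter_upwards [lt_mem_nhds hz0] with y hy using dilationAvg_rpow_eq hy
  refine (h2.congr_of_eventuallyEq h3).congr_deriv ?_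
  rw [dilationAvg_rpow_eq hz0, Real.rpow_sub_one hz0.ne', Real.rpow_sub_one hz0.ne',
    Real.rpow_neg hz0.le]
  have := (Real.rpow_pos_of_pos hz0 a).ne'
  field_simp
  ring

lemma hasDerivAt_dilationAvg_rpow {a : ℝ} (ha : 1 ≤ a) (hh : ContinuousOn h (Ioo (-ε) ε))
    {z : ℝ} (hz : z ∈ Ioo (-ε) ε) (hz0 : z ≠ 0) :
    HasDerivAt (dilationAvg (fun τ => τ ^ (a - 1)) h)
      ((h z - a * dilationAvg (fun τ => τ ^ (a - 1)) h z) / z) z := by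
  rcases lt_or_gt_of_ne hz0 with hneg | hpos
  · have hrefl : ∀ y, dilationAvg (fun τ => τ ^ (a - 1)) h y =
        dilationAvg (fun τ => τ ^ (a - 1)) (fun y => h (-y)) (-y) := fun y => by
      simp [dilationAvg]
    have hz' : -z ∈ Ioo (-ε) ε := ⟨by linarith [hz.2], by linarith [hz.1]⟩
    have hh' : ContinuousOn (fun y => h (-y)) (Ioo (-ε) ε) :=
      hh.comp continuous_neg.continuousOn fun y hy => ⟨by linarith [hy.2], by linarith [hy.1]⟩
    have h1 := hasDerivAt_dilationAvg_rpow_of_pos ha hh' hz' (by linarith)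
    have h2 := h1.comp z (hasDerivAt_neg z)
    rw [← hrefl, neg_neg] at h2
    refine (h2.congr_of_eventuallyEq (Eventually.of_forall hrefl)).congr_deriv ?_
    field_simp
  · exact hasDerivAt_dilationAvg_rpow_of_pos ha hh hz hpos

end Regularity

end KYamabe
-- A singular first-order equation.
namespace KYamabe
open Filter Topology Set MeasureTheory

lemma dilationAvg_rpow_const {a : ℝ} (ha : 1 ≤ a) (c z : ℝ) :
    dilationAvg (fun τ => τ ^ (a - 1)) (fun _ => c) z = c / a := by
  rw [dilationAvg, intervalIntegral.integral_mul_const, integral_rpow (Or.inl (by linarith))]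
  rw [Real.one_rpow, sub_add_cancel, Real.zero_rpow (by linarith)]
  ring

lemma exists_lipschitz_Icc {f : ℝ → ℝ} {U : Set ℝ} (hU : IsOpen U) {x : ℝ} (hx : x ∈ U)
    (hf : ContDiffOn ℝ ∞ f U) : ∃ K : ℝ, 0 ≤ K ∧ ∃ δ > 0, Icc (x - δ) (x + δ) ⊆ U ∧
      ∀ y ∈ Icc (x - δ) (x + δ), ∀ y' ∈ Icc (x - δ) (x + δ), |f y - f y'| ≤ K * |y - y'| := by
  obtain ⟨K, t, ht, hK⟩ := ((hf.contDiffAt (hU.mem_nhds hx)).of_le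
    (WithTop.coe_le_coe.2 le_top) : ContDiffAt ℝ 1 f x).exists_lipschitzOnWith
  obtain ⟨δ, hδ, hsub⟩ := Metric.nhds_basis_closedBall.mem_iff.1 (inter_mem ht (hU.mem_nhds hx))
  rw [Real.closedBall_eq_Icc] at hsub
  refine ⟨K, K.2, δ, hδ, fun y hy => (hsub hy).2, fun y hy y' hy' => ?_⟩
  simpa [Real.dist_eq] using hK.dist_le_mul y (hsub hy).1 y' (hsub hy').1

lemma exists_pos_mul_le {c d : ℝ} (hc : 0 ≤ c) (hd : 0 < d) : ∃ e > 0, ∀ x, 0 ≤ x → x ≤ e → x * c ≤ d := by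
  refine ⟨d / (c + 1), by positivity, fun x hx h => ?_⟩
  rw [le_div_iff₀ (by positivity)] at h
  nlinarith

/-- The integral form of z M' + a M = Φ(z P(M)). The factor z makes the nonlinearity weakly
dependent on M for small z; z and M are truncated by projections to obtain a global contraction, and
the truncations turn out to be inactive. -/
lemma exists_singular_solution_continuous {a : ℝ} (ha : 1 ≤ a) {Φ P : ℝ → ℝ} {U W : Set ℝ}
    (hU : IsOpen U) (hU0 : (0 : ℝ) ∈ U) (hΦ : ContDiffOn ℝ ∞ Φ U) (hW : IsOpen W)
    (hW0 : Φ 0 / a ∈ W) (hP : ContDiffOn ℝ ∞ P W) :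
    ∃ ε > 0, ∃ M : ℝ → ℝ, Continuous M ∧ ∀ z ∈ Ioo (-ε) ε, M z ∈ W ∧ z * P (M z) ∈ U ∧
      M z = dilationAvg (fun τ => τ ^ (a - 1)) (fun z => Φ (z * P (M z))) z := by
  set m₀ := Φ 0 / a with hm₀
  set w : ℝ → ℝ := fun τ => τ ^ (a - 1) with hwdef
  have hw : Continuous w := Real.continuous_rpow_const (by linarith)
  have hw1 : ∀ τ ∈ Icc (0 : ℝ) 1, |w τ| ≤ 1 := fun τ hτ => by
    rw [abs_of_nonneg (Real.rpow_nonneg hτ.1 _)]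
    exact Real.rpow_le_one hτ.1 hτ.2 (by linarith)
  obtain ⟨K, hK0, η, hη, hηU, hK⟩ := exists_lipschitz_Icc hU hU0 hΦ
  obtain ⟨K', hK'0, δ, hδ, hδW, hK'⟩ := exists_lipschitz_Icc hW hW0 hP
  rw [zero_sub, zero_add] at hηU hK
  have hm₀mem : m₀ ∈ Icc (m₀ - δ) (m₀ + δ) := ⟨by linarith, by linarith⟩
  set B : ℝ := |P m₀| + K' * δ with hB
  have hB0 : 0 ≤ B := by positivity
  have hPB : ∀ m ∈ Icc (m₀ - δ) (m₀ + δ), |P m| ≤ B := fun m hm => by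
    have h1 := hK' m hm m₀ hm₀mem
    have h2 : |m - m₀| ≤ δ := abs_le.2 ⟨by linarith [hm.1], by linarith [hm.2]⟩
    have h3 : |P m| ≤ |P m₀| + |P m - P m₀| := by
      calc |P m| = |P m₀ + (P m - P m₀)| := by ring_nf
        _ ≤ _ := abs_add_le _ _
    have h4 : K' * |m - m₀| ≤ K' * δ := mul_le_mul_of_nonneg_left h2 hK'0
    linarith
  -- The three bounds on ε in turn keep z P(m) where Φ is controlled, give the contraction constant
  -- 1/2, and keep the values of Φ within δ of Φ(0).
  obtain ⟨e₁, he₁, h₁⟩ := exists_pos_mul_le hB0 hη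
  obtain ⟨e₂, he₂, h₂⟩ := exists_pos_mul_le (mul_nonneg hK0 hK'0) (by norm_num : (0 : ℝ) < 1 / 2)
  obtain ⟨e₃, he₃, h₃⟩ := exists_pos_mul_le (mul_nonneg hK0 hB0) hδ
  obtain ⟨ε, hε, hε'⟩ : ∃ ε > 0, ε ≤ e₁ ∧ ε ≤ e₂ ∧ ε ≤ e₃ :=
    ⟨min e₁ (min e₂ e₃), by positivity, min_le_left _ _, (min_le_right _ _).trans (min_le_left _ _),
      (min_le_right _ _).trans (min_le_right _ _)⟩
  have h₁ := h₁ ε hε.le hε'.1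
  have h₂ := h₂ ε hε.le hε'.2.1
  have h₃ := h₃ ε hε.le hε'.2.2
  have hεle : -ε ≤ ε := by linarith
  have hδle : m₀ - δ ≤ m₀ + δ := by linarith
  let cz : ℝ → ℝ := fun z => projIcc (-ε) ε hεle z
  let cm : ℝ → ℝ := fun m => projIcc (m₀ - δ) (m₀ + δ) hδle m
  have hcz : ∀ z, |cz z| ≤ ε := fun z => abs_le.2 (projIcc (-ε) ε hεle z).2
  have hcm : ∀ m, cm m ∈ Icc (m₀ - δ) (m₀ + δ) := fun m => (projIcc _ _ hδle m).2
  have hcmlip : ∀ m m', |cm m - cm m'| ≤ |m - m'| := fun m m' => by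
    simpa [Real.dist_eq, Subtype.dist_eq] using (LipschitzWith.projIcc hδle).dist_le_mul m m'
  have hczc : Continuous cz := continuous_subtype_val.comp continuous_projIcc
  have hcmc : Continuous cm := continuous_subtype_val.comp continuous_projIcc
  have hmul : ∀ z m, |cz z * P (cm m)| ≤ ε * B := fun z m => by
    rw [abs_mul]
    exact mul_le_mul (hcz z) (hPB _ (hcm m)) (abs_nonneg _) hε.le
  have hmem : ∀ z m, cz z * P (cm m) ∈ Icc (-η) η := fun z m => abs_le.1 ((hmul z m).trans h₁)
  have h0mem : (0 : ℝ) ∈ Icc (-η) η := ⟨by linarith, hη.le⟩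
  let Ψ : ℝ → ℝ → ℝ := fun z m => Φ (cz z * P (cm m))
  have hΨc : Continuous (Function.uncurry Ψ) := by
    refine hΦ.continuousOn.comp_continuous (f := fun p : ℝ × ℝ => cz p.1 * P (cm p.2)) ?_
      fun p => hηU (hmem _ _)
    exact (hczc.comp continuous_fst).mul
      (hP.continuousOn.comp_continuous (hcmc.comp continuous_snd) fun p => hδW (hcm _))
  have hΨ0 : ∀ z m, |Ψ z m - Φ 0| ≤ δ := fun z m => by
    have h4 := hK _ (hmem z m) 0 h0mem
    rw [sub_zero] at h4
    have h5 := mul_le_mul_of_nonneg_left (hmul z m) hK0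
    refine h4.trans (h5.trans (le_trans (le_of_eq (by ring)) h₃))
  have hΨlip : ∀ z m m', |Ψ z m - Ψ z m'| ≤ 1 / 2 * |m - m'| := fun z m m' => by
    have h4 := hK _ (hmem z m) _ (hmem z m')
    rw [← mul_sub, abs_mul] at h4
    have h5 : |P (cm m) - P (cm m')| ≤ K' * |m - m'| :=
      (hK' _ (hcm m) _ (hcm m')).trans (mul_le_mul_of_nonneg_left (hcmlip m m') hK'0)
    have h6 : |cz z| * |P (cm m) - P (cm m')| ≤ ε * (K' * |m - m'|) :=
      mul_le_mul (hcz z) h5 (abs_nonneg _) hε.le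
    calc |Ψ z m - Ψ z m'| ≤ K * (|cz z| * |P (cm m) - P (cm m')|) := h4
      _ ≤ K * (ε * (K' * |m - m'|)) := mul_le_mul_of_nonneg_left h6 hK0
      _ = ε * (K * K') * |m - m'| := by ring
      _ ≤ _ := mul_le_mul_of_nonneg_right h₂ (abs_nonneg _)
  have hΨB : ∀ z m, |Ψ z m| ≤ |Φ 0| + δ := fun z m => by
    have h4 := hΨ0 z m
    calc |Ψ z m| = |Φ 0 + (Ψ z m - Φ 0)| := by ring_nf
      _ ≤ |Φ 0| + |Ψ z m - Φ 0| := abs_add_le _ _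
      _ ≤ _ := by linarith
  obtain ⟨M, hMc, hM⟩ := exists_dilation_fixedPoint hw hw1 hΨc hΨB hΨlip
  -- m₀ = Φ(0)/a is the average of the constant Φ(0), so M - m₀ averages a function bounded by δ.
  have hMmem : ∀ z, M z ∈ Icc (m₀ - δ) (m₀ + δ) := fun z => by
    have hcont : Continuous fun z => Ψ z (M z) := hΨc.comp (continuous_id.prodMk hMc)
    have h4 : M z - m₀ = dilationAvg w (fun z => Ψ z (M z) - Φ 0) z := by
      rw [← dilationAvg_sub (h' := fun _ => Φ 0) hw, dilationAvg_rpow_const ha, ← hM]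
      · exact (hcont.comp (continuous_id.mul continuous_const)).continuousOn
      · exact continuousOn_const
    have h5 : |M z - m₀| ≤ δ := h4 ▸ abs_dilationAvg_le hw1 fun τ _ => hΨ0 _ _
    exact ⟨by linarith [(abs_le.1 h5).1], by linarith [(abs_le.1 h5).2]⟩
  have hcmM : ∀ z, cm (M z) = M z := fun z => by simp only [cm, projIcc_of_mem hδle (hMmem z)]
  have hczz : ∀ z ∈ Icc (-ε) ε, cz z = z := fun z hz => by simp only [cz, projIcc_of_mem hεle hz]
  refine ⟨ε, hε, M, hMc, fun z hz => ⟨hδW (hMmem z), ?_, ?_⟩⟩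
  · have := hmem z (M z)
    rw [hcmM, hczz z (Ioo_subset_Icc_self hz)] at this
    exact hηU this
  · rw [hM z]
    refine intervalIntegral.integral_congr fun τ hτ => ?_
    rw [uIcc_of_le zero_le_one] at hτ
    simp only [Ψ, hcmM, hczz _ (mul_mem_Icc_of_mem hτ (Ioo_subset_Icc_self hz))]

/-- Smooth solutions of the singular equation `z M' = Φ(z P(M)) - a M`. -/
theorem exists_singular_solution {a : ℝ} (ha : 1 ≤ a) {Φ P : ℝ → ℝ} {U W : Set ℝ}
    (hU : IsOpen U) (hU0 : (0 : ℝ) ∈ U) (hΦ : ContDiffOn ℝ ∞ Φ U) (hW : IsOpen W)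
    (hW0 : Φ 0 / a ∈ W) (hP : ContDiffOn ℝ ∞ P W) :
    ∃ ε > 0, ∃ M : ℝ → ℝ, M 0 = Φ 0 / a ∧ ContDiffOn ℝ ∞ M (Ioo (-ε) ε) ∧
      ∀ z ∈ Ioo (-ε) ε, M z ∈ W ∧ z * P (M z) ∈ U ∧
        z * deriv M z = Φ (z * P (M z)) - a * M z ∧
        M z = dilationAvg (fun τ => τ ^ (a - 1)) (fun z => Φ (z * P (M z))) z := by
  obtain ⟨ε, hε, M, hMc, hM⟩ := exists_singular_solution_continuous ha hU hU0 hΦ hW hW0 hP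
  set w : ℝ → ℝ := fun τ => τ ^ (a - 1) with hwdef
  have hw : Continuous w := Real.continuous_rpow_const (by linarith)
  set l : ℝ → ℝ := fun z => z * P (M z) with hl
  have h0I : (0 : ℝ) ∈ Ioo (-ε) ε := ⟨by linarith, hε⟩
  have hM0 : M 0 = Φ 0 / a := by
    rw [(hM 0 h0I).2.2, ← dilationAvg_rpow_const ha (Φ 0) 0]
    simp [dilationAvg, hwdef]
  have hPM : ContinuousOn (fun z => P (M z)) (Ioo (-ε) ε) :=
    hP.continuousOn.comp hMc.continuousOn fun z hz => (hM z hz).1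
  have hlc : ContinuousOn l (Ioo (-ε) ε) := continuousOn_id.mul hPM
  have hΦl : ContinuousOn (fun z => Φ (l z)) (Ioo (-ε) ε) :=
    hΦ.continuousOn.comp hlc fun z hz => (hM z hz).2.1
  have hMeq : ∀ z ∈ Ioo (-ε) ε, M =ᶠ[𝓝 z] dilationAvg w fun z => Φ (l z) := fun z hz => by
    filter_upwards [isOpen_Ioo.mem_nhds hz] with y hy using (hM y hy).2.2
  have hMd : ∀ z ∈ Ioo (-ε) ε, z ≠ 0 → HasDerivAt M ((Φ (l z) - a * M z) / z) z :=
    fun z hz hz0 => by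
      have := (hasDerivAt_dilationAvg_rpow ha hΦl hz hz0).congr_of_eventuallyEq (hMeq z hz)
      rwa [← (hM z hz).2.2] at this
  have hPd : ∀ z ∈ Ioo (-ε) ε, HasDerivAt P (deriv P (M z)) (M z) := fun z hz =>
    ((hP.contDiffAt (hW.mem_nhds (hM z hz).1)).differentiableAt (by simp)).hasDerivAt
  -- The source of regularity: in l = z P(M) the factor z absorbs the singular 1/z of M', so l' is a
  -- smooth expression in M and l, valid at 0 too.
  have hld : ∀ z ∈ Ioo (-ε) ε,
      HasDerivAt l (P (M z) + deriv P (M z) * (Φ (l z) - a * M z)) z := fun z hz => by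
    by_cases hz0 : z = 0
    · subst hz0
      have h1 : Φ (l 0) - a * M 0 = 0 := by
        have : a ≠ 0 := by linarith
        rw [hM0, hl]
        simp only [zero_mul]
        field_simp
        ring
      rw [h1, mul_zero, add_zero, hasDerivAt_iff_tendsto_slope]
      have h2 : Tendsto (fun z => P (M z)) (𝓝[≠] 0) (𝓝 (P (M 0))) :=
        (hPM.continuousAt (isOpen_Ioo.mem_nhds hz)).tendsto.mono_left nhdsWithin_le_nhds
      refine h2.congr' ?_
      filter_upwards [self_mem_nhdsWithin] with y hy
      have : y ≠ 0 := hy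
      simp only [slope_def_field, hl]
      field_simp
      ring
    · refine ((hasDerivAt_id z).mul ((hPd z hz).comp z (hMd z hz hz0))).congr_deriv ?_
      simp only [id, Function.comp_apply]
      field_simp
  -- If M and l are C^m, then l' is C^m; M, being an average of Φ(l), then inherits class C^{m+1}
  -- from l.
  have hboot : ∀ m : ℕ, ContDiffOn ℝ m M (Ioo (-ε) ε) ∧ ContDiffOn ℝ m l (Ioo (-ε) ε) := by
    have hM_of_l : ∀ m : ℕ, ContDiffOn ℝ m l (Ioo (-ε) ε) → ContDiffOn ℝ m M (Ioo (-ε) ε) :=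
      fun m h => (contDiffOn_dilationAvg m hw ((hΦ.of_le (WithTop.coe_le_coe.2 le_top)).comp h
        fun z hz => (hM z hz).2.1)).congr fun z hz => (hM z hz).2.2
    intro m
    induction m with
    | zero =>
      rw [Nat.cast_zero, contDiffOn_zero, contDiffOn_zero]
      exact ⟨hMc.continuousOn, hlc⟩
    | succ m ih =>
      have hm : ∀ {f : ℝ → ℝ} {s : Set ℝ}, ContDiffOn ℝ ∞ f s → ContDiffOn ℝ m f s := fun h =>
        h.of_le (WithTop.coe_le_coe.2 le_top)
      have hP' : ContDiffOn ℝ m (deriv P) W :=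
        ((contDiffOn_succ_iff_deriv_of_isOpen hW).1
          (hP.of_le (WithTop.coe_le_coe.2 le_top) : ContDiffOn ℝ (m + 1) P W)).2.2
      have h1 : ContDiffOn ℝ (m + 1) l (Ioo (-ε) ε) := by
        rw [contDiffOn_succ_iff_deriv_of_isOpen isOpen_Ioo]
        refine ⟨fun z hz => (hld z hz).differentiableAt.differentiableWithinAt, by simp, ?_⟩
        refine ContDiffOn.congr ?_ fun z hz => (hld z hz).deriv
        exact ((hm hP).comp ih.1 fun z hz => (hM z hz).1).add
          ((hP'.comp ih.1 fun z hz => (hM z hz).1).mul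
            (((hm hΦ).comp ih.2 fun z hz => (hM z hz).2.1).sub (contDiffOn_const.mul ih.1)))
      have h2 : ContDiffOn ℝ (m + 1 : ℕ) l (Ioo (-ε) ε) := by push_cast; exact h1
      exact ⟨hM_of_l _ h2, h2⟩
  refine ⟨ε, hε, M, hM0, contDiffOn_infty.2 fun m => (hboot m).1, fun z hz =>
    ⟨(hM z hz).1, (hM z hz).2.1, ?_, (hM z hz).2.2⟩⟩
  by_cases hz0 : z = 0
  · subst hz0
    have : a ≠ 0 := by linarith
    rw [hM0]
    simp only [zero_mul]
    field_simp
    ring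
  · rw [(hMd z hz hz0).deriv]
    simp only [hl]
    field_simp

end KYamabe
-- The profile of a solution near the origin.
namespace KYamabe
open Filter Topology Set MeasureTheory

/-- The value of `σ_k^{1/k}` prescribed by the equation for the profile `φ`. -/
noncomputable def sourceTerm (θ ρ : ℝ) (φ : ℝ → ℝ) (s : ℝ) : ℝ :=
  2 * θ + ρ - 4 * θ * s * deriv φ s / φ s

/-- `φ` is, near `s`, the profile of a smooth admissible radial solution. -/
structure IsProfileAt (n k : ℕ) (θ ρ : ℝ) (φ : ℝ → ℝ) (s : ℝ) : Prop where
  smooth : ContDiffAt ℝ ∞ φ s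
  pos : 0 < φ s
  angular_pos : 0 < angular φ s
  source_pos : 0 < sourceTerm θ ρ φ s
  eq : ((n - 1).choose (k - 1) : ℝ) * angular φ s ^ (k - 1) * (n * angular φ s + k * defect φ s) =
    k * sourceTerm θ ρ φ s ^ k

lemma IsProfileAt.congr {n k : ℕ} {θ ρ : ℝ} {φ ψ : ℝ → ℝ} {s : ℝ} (h : IsProfileAt n k θ ρ φ s)
    (he : ψ =ᶠ[𝓝 s] φ) : IsProfileAt n k θ ρ ψ s := by
  have h1 : angular ψ s = angular φ s := by rw [angular, angular, he.deriv_eq, he.eq_of_nhds]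
  have h2 : sourceTerm θ ρ ψ s = sourceTerm θ ρ φ s := by
    rw [sourceTerm, sourceTerm, he.deriv_eq, he.eq_of_nhds]
  have h3 : defect ψ s = defect φ s := by
    rw [defect, defect, he.deriv.deriv_eq, he.eq_of_nhds]
  exact ⟨h.smooth.congr_of_eventuallyEq he, he.eq_of_nhds ▸ h.pos, h1 ▸ h.angular_pos,
    h2 ▸ h.source_pos, by rw [h1, h2, h3]; exact h.eq⟩

/-- The regular equation for `φ` once the angular eigenvalue `μ` is known as a function of
`z = s / φ²`. -/
noncomputable def profileField (μ : ℝ → ℝ) (p : ℝ × ℝ) : ℝ :=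
  μ (p.1 / p.2 ^ 2) / (p.2 * (1 + √(1 - 2 * (p.1 / p.2 ^ 2 * μ (p.1 / p.2 ^ 2)))))

lemma contDiffAt_profileField {μ : ℝ → ℝ} {p : ℝ × ℝ} (hp : 0 < p.2)
    (hμ : ContDiffAt ℝ ∞ μ (p.1 / p.2 ^ 2))
    (hl : p.1 / p.2 ^ 2 * μ (p.1 / p.2 ^ 2) < 1 / 2) : ContDiffAt ℝ ∞ (profileField μ) p := by
  have h1 : ContDiffAt ℝ ∞ (fun p : ℝ × ℝ => p.1 / p.2 ^ 2) p :=
    contDiffAt_fst.div (contDiffAt_snd.pow 2) (by positivity)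
  have h2 : ContDiffAt ℝ ∞ (fun p : ℝ × ℝ => μ (p.1 / p.2 ^ 2)) p :=
    ContDiffAt.comp (g := μ) p hμ h1
  have h3 : ContDiffAt ℝ ∞ (fun p : ℝ × ℝ => √(1 - 2 * (p.1 / p.2 ^ 2 * μ (p.1 / p.2 ^ 2)))) p :=
    (contDiffAt_const.sub (contDiffAt_const.mul (h1.mul h2))).sqrt
      (by linarith)
  exact h2.div (contDiffAt_snd.mul (contDiffAt_const.add h3)) (by positivity)

/-- `profileField` is the root of the quadratic 2φφ' - 2sφ'² = μ that is regular at s = 0, in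
rationalized form. The equation is made autonomous by adjoining s as the first coordinate. -/
lemma exists_solution_profileField {μ : ℝ → ℝ} {ε : ℝ} (hε : 0 < ε)
    (hμ : ContDiffOn ℝ ∞ μ (Ioo (-ε) ε)) (hl : ∀ z ∈ Ioo (-ε) ε, z * μ z < 1 / 2) :
    ∃ r > 0, ∃ φ : ℝ → ℝ, φ 0 = 1 ∧ ∀ s ∈ Ioo (-r) r, ContDiffAt ℝ ∞ φ s ∧ 0 < φ s ∧
      s / φ s ^ 2 ∈ Ioo (-ε) ε ∧ HasDerivAt φ (profileField μ (s, φ s)) s := by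
  let O : Set (ℝ × ℝ) := {p | 0 < p.2 ∧ p.1 / p.2 ^ 2 ∈ Ioo (-ε) ε}
  let V : ℝ × ℝ → ℝ × ℝ := fun p => (1, profileField μ p)
  have hO : ∀ p ∈ O, ContDiffAt ℝ ∞ V p := fun p hp =>
    contDiffAt_const.prodMk (contDiffAt_profileField hp.1
      (hμ.contDiffAt (isOpen_Ioo.mem_nhds hp.2)) (hl _ hp.2))
  have h0 : ((0 : ℝ), (1 : ℝ)) ∈ O := ⟨one_pos, by simp [hε]⟩
  have hOn : O ∈ 𝓝 ((0 : ℝ), (1 : ℝ)) := by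
    have h1 : ContinuousAt (fun p : ℝ × ℝ => p.1 / p.2 ^ 2) (0, 1) :=
      continuousAt_fst.div (continuousAt_snd.pow 2) (by simp)
    have h2 : Ioo (-ε) ε ∈ 𝓝 ((0 : ℝ) / 1 ^ 2) := Ioo_mem_nhds (by simp [hε]) (by simp [hε])
    filter_upwards [continuousAt_snd.eventually (lt_mem_nhds (show (0 : ℝ) < 1 from one_pos)),
      h1.eventually h2] with p hp1 hp2 using ⟨hp1, hp2⟩
  obtain ⟨α, hα0, e, he, hα⟩ :=
    ((hO _ h0).of_le (WithTop.coe_le_coe.2 le_top) :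
      ContDiffAt ℝ 1 V (0, 1)).exists_forall_mem_closedBall_exists_eq_forall_mem_Ioo_hasDerivAt₀ 0
  rw [zero_sub, zero_add] at hα
  have h0e : (0 : ℝ) ∈ Ioo (-e) e := ⟨by linarith, he⟩
  have hfst : ∀ t ∈ Ioo (-e) e, (α t).1 = t := fun t ht => by
    have hd : ∀ t ∈ Ioo (-e) e, HasDerivAt (fun t => (α t).1 - t) 0 t := fun t ht => by
      have h1 : HasDerivAt (fun t => (α t).1) 1 t := (hα t ht).fst
      exact (h1.sub (hasDerivAt_id t)).congr_deriv (by simp)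
    have := isOpen_Ioo.is_const_of_deriv_eq_zero isPreconnected_Ioo
      (fun t ht => (hd t ht).differentiableAt.differentiableWithinAt)
      (fun t ht => (hd t ht).deriv) ht h0e
    simp only [hα0] at this
    linarith
  have hcont : ContinuousAt α 0 := (hα 0 h0e).continuousAt
  obtain ⟨r', hr', hsub'⟩ := Metric.mem_nhds_iff.1
    (inter_mem (hcont.preimage_mem_nhds (hα0 ▸ hOn)) (isOpen_Ioo.mem_nhds h0e))
  rw [Real.ball_eq_Ioo, zero_sub, zero_add] at hsub'
  obtain ⟨r, hr, hrr'⟩ := exists_between hr'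
  have hsub : Icc (-r) r ⊆ Ioo (-r') r' := fun y hy => ⟨by linarith [hy.1], by linarith [hy.2]⟩
  have hsm : ContDiffOn ℝ ∞ α (Icc (-r) r) := by
    have hu : ContDiffOn ℝ ∞ (Function.uncurry fun _ : ℝ => V) (Icc (-r) r ×ˢ O) := fun p hp =>
      (ContDiffAt.comp (g := V) p (hO _ hp.2) contDiffAt_snd).contDiffWithinAt
    exact ODE.contDiffOn_enat_Icc_of_hasDerivWithinAt (n := ⊤) hu
      (fun t ht => (hα t (hsub' (hsub ht)).2).hasDerivWithinAt) fun t ht => (hsub' (hsub ht)).1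
  refine ⟨r, hr, fun t => (α t).2, by simp [hα0], fun s hs => ?_⟩
  have hs' := hsub' (hsub (Ioo_subset_Icc_self hs))
  have hfs := hfst s hs'.2
  have hsO : 0 < (α s).2 ∧ (α s).1 / (α s).2 ^ 2 ∈ Ioo (-ε) ε := hs'.1
  rw [hfs] at hsO
  refine ⟨contDiffAt_snd.comp s (hsm.contDiffAt (Icc_mem_nhds hs.1 hs.2)), hsO.1, hsO.2, ?_⟩
  have h1 : HasDerivAt (fun t => (α t).2) (profileField μ (α s)) s := (hα s hs'.2).snd
  rwa [show α s = (s, (α s).2) from Prod.ext hfs rfl] at h1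

lemma hasDerivAt_angular {φ : ℝ → ℝ} {s : ℝ} (hφ : ContDiffAt ℝ 2 φ s) :
    HasDerivAt (angular φ) (2 * deriv (deriv φ) s * (φ s - 2 * s * deriv φ s)) s := by
  have h1 : HasDerivAt φ (deriv φ s) s := (hφ.differentiableAt (by simp)).hasDerivAt
  have h2 : HasDerivAt (deriv φ) (deriv (deriv φ) s) s :=
    ((contDiffAt_deriv (m := 1) hφ (by norm_num)).differentiableAt (by simp)).hasDerivAt
  refine (((h1.const_mul 2).mul h2).sub
    (((hasDerivAt_id s).const_mul 2).mul (h2.pow 2))).congr_deriv ?_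
  simp only [id, Pi.pow_apply]
  ring

/-- Existence of the profile of a radial solution near the origin. -/
theorem exists_local_profile {n k : ℕ} (hn : 3 ≤ n) (hk : 1 ≤ k) (hkn : k ≤ n) {θ ρ : ℝ} (hθ : 0 < θ)
    (h0 : 0 < 2 * θ + ρ) :
    ∃ r > 0, ∃ φ : ℝ → ℝ, φ 0 = 1 ∧ ∀ s ∈ Ioo (-r) r, IsProfileAt n k θ ρ φ s ∧
      (0 ≤ s → k * sourceTerm θ ρ φ s ^ k ≤
        n * ((n - 1).choose (k - 1) : ℝ) * angular φ s ^ k) := by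
  have hn' : (3 : ℝ) ≤ n := by exact_mod_cast hn
  have hk' : (1 : ℝ) ≤ k := by exact_mod_cast hk
  set C : ℝ := ((n - 1).choose (k - 1) : ℝ) with hCdef
  have hC : 0 < C := by
    rw [hCdef]
    exact_mod_cast Nat.choose_pos (by omega)
  -- With M = L^k as a function of z = s/φ² and l = zL = (1-Y²)/2, so Y = -√(1-2l) near the origin,
  -- the equation becomes z M' = Φ(l) - (n/2) M, where 2CΦ = k f^k and l = z M^{1/k}.
  set a : ℝ := (n : ℝ) / 2 with ha
  let Φ : ℝ → ℝ := fun l => k / (2 * C) * (ρ + 2 * θ * √(1 - 2 * l)) ^ k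
  let P : ℝ → ℝ := fun m => m ^ (1 / (k : ℝ))
  have hΦ : ContDiffOn ℝ ∞ Φ (Iio (1 / 2)) := fun l hl => by
    have : 1 - 2 * l ≠ 0 := by have : l < 1 / 2 := hl
                               linarith
    exact (contDiffAt_const.mul ((contDiffAt_const.add (contDiffAt_const.mul
      ((contDiffAt_const.sub (contDiffAt_const.mul contDiffAt_id)).sqrt this))).pow k)).contDiffWithinAt
  have hP : ContDiffOn ℝ ∞ P (Ioi 0) := fun m hm =>
    (contDiffAt_id.rpow_const_of_ne (ne_of_gt hm)).contDiffWithinAt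
  have hΦ0 : 0 < Φ 0 := by
    have : Φ 0 = k / (2 * C) * (2 * θ + ρ) ^ k := by simp [Φ, add_comm]
    rw [this]
    positivity
  have hΦa : 0 < Φ 0 / a := by positivity
  obtain ⟨ε₀, hε₀, M, hM0, hMs, hM⟩ := exists_singular_solution (a := a)
    (by rw [ha]; linarith) isOpen_Iio (show (0 : ℝ) < 1 / 2 by norm_num) hΦ isOpen_Ioi hΦa hP
  let μ : ℝ → ℝ := fun z => P (M z)
  have hμs : ContDiffOn ℝ ∞ μ (Ioo (-ε₀) ε₀) := hP.comp hMs fun z hz => (hM z hz).1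
  have hμpos : ∀ z ∈ Ioo (-ε₀) ε₀, 0 < μ z := fun z hz => Real.rpow_pos_of_pos (hM z hz).1 _
  have hμk : ∀ z ∈ Ioo (-ε₀) ε₀, μ z ^ k = M z := fun z hz => by
    simp only [μ, P, one_div]
    exact Real.rpow_inv_natCast_pow (le_of_lt (hM z hz).1) (by omega)
  let l : ℝ → ℝ := fun z => z * μ z
  have h0I : (0 : ℝ) ∈ Ioo (-ε₀) ε₀ := ⟨by linarith, hε₀⟩
  have hls : ContDiffOn ℝ ∞ l (Ioo (-ε₀) ε₀) := contDiffOn_id.mul hμs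
  have hl0 : 0 < deriv l 0 := by
    have h1 : HasDerivAt μ (deriv μ 0) 0 :=
      ((hμs.contDiffAt (isOpen_Ioo.mem_nhds h0I)).differentiableAt (by simp)).hasDerivAt
    have h2 : HasDerivAt l _ 0 := (hasDerivAt_id (0 : ℝ)).mul h1
    rw [h2.deriv]
    simpa using hμpos 0 h0I
  have hldc : ContinuousAt (deriv l) 0 :=
    (hls.continuousOn_deriv_of_isOpen isOpen_Ioo (by simp)).continuousAt (isOpen_Ioo.mem_nhds h0I)
  have hsrc : ContinuousAt (fun z => ρ + 2 * θ * √(1 - 2 * l z)) 0 :=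
    continuousAt_const.add (continuousAt_const.mul (Real.continuous_sqrt.continuousAt.comp
      (continuousAt_const.sub (continuousAt_const.mul
        (hls.continuousOn.continuousAt (isOpen_Ioo.mem_nhds h0I))))))
  have hsrc0 : 0 < ρ + 2 * θ * √(1 - 2 * l 0) := by simp [l]; linarith
  obtain ⟨ε, hε, hsub⟩ := Metric.mem_nhds_iff.1 (inter_mem (isOpen_Ioo.mem_nhds h0I)
    (inter_mem (hldc.eventually (lt_mem_nhds hl0)) (hsrc.eventually (lt_mem_nhds hsrc0))))
  rw [Real.ball_eq_Ioo, zero_sub, zero_add] at hsub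
  have hI : Ioo (-ε) ε ⊆ Ioo (-ε₀) ε₀ := fun z hz => (hsub hz).1
  have hlmono : StrictMonoOn l (Ioo (-ε) ε) := by
    refine strictMonoOn_of_deriv_pos (convex_Ioo _ _) (hls.continuousOn.mono hI) fun z hz => ?_
    rw [interior_Ioo] at hz
    exact (hsub hz).2.1
  -- For θ > 0, Φ(l(z)) is nonincreasing in z, so its average over [0, z] is at least its value at
  -- z. This is the inequality d ≤ 0.
  have hge : ∀ z ∈ Ioo (-ε) ε, 0 ≤ z → Φ (l z) ≤ a * M z := fun z hz hz0 => by
    have hw : Continuous fun τ : ℝ => τ ^ (a - 1) :=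
      Real.continuous_rpow_const (by rw [ha]; linarith)
    have ha1 : 1 ≤ a := by rw [ha]; linarith
    have hapos : 0 < a := by linarith
    have h1 : dilationAvg (fun τ => τ ^ (a - 1)) (fun _ => Φ (l z)) z ≤ M z := by
      rw [(hM z (hI hz)).2.2.2]
      refine intervalIntegral.integral_mono_on zero_le_one ?_ ?_ fun τ hτ => ?_
      · exact (hw.mul continuous_const).intervalIntegrable _ _
      · refine ContinuousOn.intervalIntegrable ?_
        rw [uIcc_of_le zero_le_one]
        refine hw.continuousOn.mul (continuousOn_comp_mul (h := fun z => Φ (l z)) ?_ (hI hz))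
        exact hΦ.continuousOn.comp hls.continuousOn fun z hz => (hM z hz).2.1
      · refine mul_le_mul_of_nonneg_left ?_ (Real.rpow_nonneg hτ.1 _)
        have h2 : τ * z ≤ z := mul_le_of_le_one_left hz0 hτ.2
        have h3 : τ * z ∈ Ioo (-ε) ε :=
          ⟨by nlinarith [hz.1, mul_nonneg hτ.1 hz0], by linarith [hz.2]⟩
        have h4 : l (τ * z) ≤ l z := hlmono.monotoneOn h3 hz h2
        refine mul_le_mul_of_nonneg_left ?_ (by positivity)
        have h5 : √(1 - 2 * l z) ≤ √(1 - 2 * l (τ * z)) := Real.sqrt_le_sqrt (by linarith)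
        exact pow_le_pow_left₀ (le_of_lt (hsub hz).2.2) (by
          have := mul_le_mul_of_nonneg_left h5 (show 0 ≤ 2 * θ by linarith)
          linarith) k
    rw [dilationAvg_rpow_const ha1, div_le_iff₀ hapos] at h1
    linarith
  obtain ⟨r, hr, φ, hφ0, hφ⟩ := exists_solution_profileField hε (hμs.mono hI)
    fun z hz => (hM z (hI hz)).2.1
  have key : ∀ s ∈ Ioo (-r) r, angular φ s = μ (s / φ s ^ 2) ∧
      φ s - 2 * s * deriv φ s = φ s * √(1 - 2 * l (s / φ s ^ 2)) := fun s hs => by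
    obtain ⟨-, hpos, hz, hd⟩ := hφ s hs
    have hl2 : l (s / φ s ^ 2) < 1 / 2 := (hM _ (hI hz)).2.1
    have hR := Real.sq_sqrt (show 0 ≤ 1 - 2 * l (s / φ s ^ 2) by linarith)
    have hR0 := Real.sqrt_nonneg (1 - 2 * l (s / φ s ^ 2))
    have hR' : √(1 - 2 * (s / φ s ^ 2 * μ (s / φ s ^ 2))) = √(1 - 2 * l (s / φ s ^ 2)) := rfl
    rw [angular, hd.deriv, profileField]
    simp only
    rw [hR']
    set R := √(1 - 2 * l (s / φ s ^ 2))
    have hl' : s * μ (s / φ s ^ 2) = φ s ^ 2 * l (s / φ s ^ 2) := by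
      simp only [l]; field_simp
    set m := μ (s / φ s ^ 2)
    set L := l (s / φ s ^ 2)
    have h1R : (1 + R) ≠ 0 := by linarith
    have hL : L = (1 - R ^ 2) / 2 := by linarith
    constructor
    · have : 2 * s * (m / (φ s * (1 + R))) ^ 2 = 2 * (s * m) * m / (φ s * (1 + R)) ^ 2 := by
        rw [div_pow]
        ring
      rw [this, hl', hL]
      field_simp
      ring
    · have : 2 * s * (m / (φ s * (1 + R))) = 2 * (s * m) / (φ s * (1 + R)) := by ring
      rw [this, hl', hL]
      field_simp
      ring
  refine ⟨r, hr, φ, hφ0, fun s hs => ?_⟩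
  obtain ⟨hsm, hpos, hz, hd⟩ := hφ s hs
  obtain ⟨hang, hR⟩ := key s hs
  have hl2 : l (s / φ s ^ 2) < 1 / 2 := (hM _ (hI hz)).2.1
  have hR0 : 0 < √(1 - 2 * l (s / φ s ^ 2)) := Real.sqrt_pos.2 (by linarith)
  have hsource : sourceTerm θ ρ φ s = ρ + 2 * θ * √(1 - 2 * l (s / φ s ^ 2)) := by
    rw [sourceTerm]
    field_simp
    linear_combination (2 * θ) * hR
  have hsm2 : ContDiffAt ℝ 2 φ s := hsm.of_le (WithTop.coe_le_coe.2 le_top)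
  have hMz : M (s / φ s ^ 2) = angular φ s ^ k := by rw [hang, hμk _ (hI hz)]
  have hΦz : 2 * C * Φ (l (s / φ s ^ 2)) = k * sourceTerm θ ρ φ s ^ k := by
    rw [hsource]
    simp only [Φ]
    field_simp
  -- Differentiate L^k = M(s/φ²) in s. Both sides carry the factor φ - 2sφ' = φ√(1-2l), which is
  -- nonzero because l < 1/2 and can be cancelled.
  have hdefect : k * angular φ s ^ (k - 1) * defect φ s =
      2 * (Φ (l (s / φ s ^ 2)) - a * M (s / φ s ^ 2)) := by
    have h1 : HasDerivAt (fun s => angular φ s ^ k) _ s := (hasDerivAt_angular hsm2).pow k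
    have hφd : HasDerivAt φ (deriv φ s) s := hd.differentiableAt.hasDerivAt
    have h2 : HasDerivAt (fun s => s / φ s ^ 2) _ s :=
      (hasDerivAt_id s).div (hφd.pow 2) (by positivity)
    have h3 : HasDerivAt M (deriv M (s / φ s ^ 2)) (s / φ s ^ 2) :=
      ((hMs.contDiffAt (isOpen_Ioo.mem_nhds (hI hz))).differentiableAt (by simp)).hasDerivAt
    have h4 : HasDerivAt (fun s => M (s / φ s ^ 2)) _ s :=
      HasDerivAt.comp (h₂ := M) s h3 h2
    have h5 : (fun s => angular φ s ^ k) =ᶠ[𝓝 s] fun s => M (s / φ s ^ 2) := by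
      filter_upwards [isOpen_Ioo.mem_nhds hs] with y hy
      obtain ⟨-, -, hzy, -⟩ := hφ y hy
      rw [(key y hy).1, hμk _ (hI hzy)]
    have h6 := (h1.congr_of_eventuallyEq h5.symm).unique h4
    have h7 := (hM _ (hI hz)).2.2.1
    rw [show Φ (l (s / φ s ^ 2)) - a * M (s / φ s ^ 2) = s / φ s ^ 2 * deriv M (s / φ s ^ 2) from
      h7.symm]
    rw [hR] at h6
    have h8 : (1 * φ s ^ 2 - s * (2 * φ s ^ (2 - 1) * deriv φ s)) =
        φ s * (φ s * √(1 - 2 * l (s / φ s ^ 2))) := by rw [← hR]; ring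
    simp only [id, Nat.cast_ofNat] at h6
    rw [h8] at h6
    set R := √(1 - 2 * l (s / φ s ^ 2))
    rw [defect]
    have h9 : R ≠ 0 := hR0.ne'
    field_simp at h6 ⊢
    linear_combination (2 * s) * h6
  refine ⟨⟨hsm, hpos, hang ▸ hμpos _ (hI hz), hsource ▸ (hsub hz).2.2, ?_⟩, fun hs0 => ?_⟩
  · have hpow : angular φ s ^ k = angular φ s ^ (k - 1) * angular φ s := by
      rw [← pow_succ]; congr 1; omega
    rw [← hΦz]
    rw [hMz, hpow] at hdefect
    simp only [ha] at hdefect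
    linear_combination C * hdefect
  · rw [← hΦz, ← hMz]
    have h1 := hge _ hz (by positivity)
    have h2 := mul_le_mul_of_nonneg_left h1 (show 0 ≤ 2 * C by linarith)
    refine h2.trans (le_of_eq ?_)
    rw [ha]
    ring

end KYamabe
-- Global integral curves and differential inequalities.
namespace KYamabe
open Filter Topology Set MeasureTheory

lemma ode_solution_unique {F : Type*} [NormedAddCommGroup F] [NormedSpace ℝ F] {V : F → F}
    (hV : ContDiff ℝ 1 V) {a b t₀ : ℝ} (ht₀ : t₀ ∈ Ioo a b) {α β : ℝ → F}
    (hα : ∀ t ∈ Icc a b, HasDerivWithinAt α (V (α t)) (Icc a b) t)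
    (hβ : ∀ t ∈ Icc a b, HasDerivWithinAt β (V (β t)) (Icc a b) t) (h : α t₀ = β t₀) :
    EqOn α β (Icc a b) := by
  have hαc : ContinuousOn α (Icc a b) := fun t ht => (hα t ht).continuousWithinAt
  have hβc : ContinuousOn β (Icc a b) := fun t ht => (hβ t ht).continuousWithinAt
  have hcomp : IsCompact (α '' Icc a b ∪ β '' Icc a b) :=
    (isCompact_Icc.image_of_continuousOn hαc).union (isCompact_Icc.image_of_continuousOn hβc)
  obtain ⟨K, hK⟩ := (hV.locallyLipschitz.locallyLipschitzOn
    (s := α '' Icc a b ∪ β '' Icc a b)).exists_lipschitzOnWith_of_compact hcomp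
  exact ODE_solution_unique_of_mem_Icc (v := fun _ => V)
    (s := fun _ => α '' Icc a b ∪ β '' Icc a b) (fun _ _ => hK) ht₀ hαc
    (fun t ht => (hα t (Ioo_subset_Icc_self ht)).hasDerivAt (Icc_mem_nhds ht.1 ht.2))
    (fun t ht => Or.inl (mem_image_of_mem α (Ioo_subset_Icc_self ht))) hβc
    (fun t ht => (hβ t (Ioo_subset_Icc_self ht)).hasDerivAt (Icc_mem_nhds ht.1 ht.2))
    (fun t ht => Or.inr (mem_image_of_mem β (Ioo_subset_Icc_self ht))) h

/-- A bounded `C¹` vector field has global integral curves. -/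
theorem exists_global_integralCurve {F : Type*} [NormedAddCommGroup F] [NormedSpace ℝ F]
    [ProperSpace F] {V : F → F} (hV : ContDiff ℝ 1 V) {B : ℝ} (hB : ∀ x, ‖V x‖ ≤ B) (x₀ : F)
    (t₀ : ℝ) : ∃ α : ℝ → F, α t₀ = x₀ ∧ ∀ t, HasDerivAt α (V (α t)) t := by
  have hB0 : 0 ≤ B := (norm_nonneg _).trans (hB x₀)
  lift B to NNReal using hB0
  have hloc : ∀ m : ℕ, ∃ α : ℝ → F, α t₀ = x₀ ∧ ∀ t ∈ Icc (t₀ - (m + 1)) (t₀ + (m + 1)),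
      HasDerivWithinAt α (V (α t)) (Icc (t₀ - (m + 1)) (t₀ + (m + 1))) t := fun m => by
    have hm : (0 : ℝ) < m + 1 := by positivity
    -- A curve of speed at most B stays within B(m+1) of x₀ during time m+1, so Picard–Lindelöf
    -- applies on the whole interval.
    set A : NNReal := B * (m + 1) with hA
    obtain ⟨K, hK⟩ := (hV.locallyLipschitz.locallyLipschitzOn
      (s := Metric.closedBall x₀ A)).exists_lipschitzOnWith_of_compact (isCompact_closedBall _ _)
    have hpl : IsPicardLindelof (fun _ : ℝ => V) (tmin := t₀ - (m + 1)) (tmax := t₀ + (m + 1))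
        ⟨t₀, by linarith, by linarith⟩ x₀ A 0 B K := by
      refine IsPicardLindelof.of_time_independent (fun x _ => hB x) hK ?_
      rw [hA]
      simp
    exact hpl.exists_eq_forall_mem_Icc_hasDerivWithinAt₀
  choose α hα0 hα using hloc
  have hag : ∀ m m' : ℕ, m ≤ m' → EqOn (α m) (α m') (Icc (t₀ - (m + 1)) (t₀ + (m + 1))) :=
    fun m m' hmm => by
      have hm : (m : ℝ) ≤ m' := by exact_mod_cast hmm
      have hm0 : (0 : ℝ) < m + 1 := by positivity
      have hsub : Icc (t₀ - ((m : ℝ) + 1)) (t₀ + (m + 1)) ⊆ Icc (t₀ - ((m' : ℝ) + 1)) (t₀ + (m' + 1)) :=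
        Icc_subset_Icc (by linarith) (by linarith)
      exact ode_solution_unique hV (t₀ := t₀) ⟨by linarith, by linarith⟩ (hα m)
        (fun t ht => (hα m' t (hsub ht)).mono hsub) (by rw [hα0, hα0])
  refine ⟨fun t => α ⌈|t - t₀|⌉₊ t, by simp [hα0], fun t => ?_⟩
  have hev : (fun t => α ⌈|t - t₀|⌉₊ t) =ᶠ[𝓝 t] α (⌈|t - t₀|⌉₊ + 1) := by
    have h1 : ∀ᶠ y in 𝓝 t, |y - t₀| < ⌈|t - t₀|⌉₊ + 1 := by
      have hc : Continuous fun y : ℝ => |y - t₀| := by fun_prop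
      exact hc.continuousAt.eventually (gt_mem_nhds (by
        have := Nat.le_ceil |t - t₀|
        linarith))
    filter_upwards [h1] with y hy
    have hle : ⌈|y - t₀|⌉₊ ≤ ⌈|t - t₀|⌉₊ + 1 := Nat.ceil_le.2 (by push_cast; exact hy.le)
    refine hag _ _ hle ?_
    have h2 := Nat.le_ceil |y - t₀|
    have h3 := abs_le.1 h2
    exact ⟨by linarith [h3.1], by linarith [h3.2]⟩
  have hmem : t ∈ Ioo (t₀ - (((⌈|t - t₀|⌉₊ + 1 : ℕ) : ℝ) + 1)) (t₀ + (((⌈|t - t₀|⌉₊ + 1 : ℕ) : ℝ) + 1)) := by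
    have h3 := abs_le.1 (Nat.le_ceil |t - t₀|)
    push_cast
    exact ⟨by linarith [h3.1], by linarith [h3.2]⟩
  have h4 := (hα _ t (Ioo_subset_Icc_self hmem)).hasDerivAt (Icc_mem_nhds hmem.1 hmem.2)
  rw [← hev.eq_of_nhds] at h4
  exact h4.congr_of_eventuallyEq hev

/-- -g cannot cross η e^{(K+1)(t-a)}, which grows strictly faster than the inequality allows at a
contact point; then η → 0. -/
lemma nonneg_of_neg_mul_abs_le_deriv {g g' : ℝ → ℝ} {a b K : ℝ}
    (hg : ∀ t ∈ Icc a b, HasDerivAt g (g' t) t) (h : ∀ t ∈ Icc a b, -(K * |g t|) ≤ g' t)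
    (ha : 0 ≤ g a) : ∀ t ∈ Icc a b, 0 ≤ g t := by
  intro t ht
  refine le_of_forall_pos_le_add fun δ hδ => ?_
  have hexp := Real.exp_pos ((K + 1) * (t - a))
  have key : ∀ η > 0, -g t ≤ η * Real.exp ((K + 1) * (t - a)) := fun η hη => by
    refine image_le_of_deriv_right_lt_deriv_boundary (f := fun t => -g t) (f' := fun t => -g' t)
      (a := a) (b := b) (B := fun t => η * Real.exp ((K + 1) * (t - a)))
      (B' := fun t => η * (Real.exp ((K + 1) * (t - a)) * (K + 1)))
      (fun t ht => (hg t ht).neg.continuousAt.continuousWithinAt)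
      (fun t ht => (hg t ⟨ht.1, ht.2.le⟩).neg.hasDerivWithinAt) (by simp; linarith) (fun t => ?_)
      (fun x hx h1 => ?_) ht
    · have := ((((hasDerivAt_id t).sub_const a).const_mul (K + 1)).exp).const_mul η
      exact this.congr_deriv (by simp)
    · have h2 := h x ⟨hx.1, hx.2.le⟩
      have h3 : 0 < η * Real.exp ((K + 1) * (x - a)) := mul_pos hη (Real.exp_pos _)
      have h4 : |g x| = η * Real.exp ((K + 1) * (x - a)) := by
        rw [← h1, ← abs_neg, abs_of_pos]
        rw [h1]
        exact h3
      rw [h4] at h2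
      linarith
  have := key (δ / Real.exp ((K + 1) * (t - a))) (by positivity)
  rw [div_mul_cancel₀ _ hexp.ne'] at this
  linarith

lemma pos_of_neg_mul_abs_le_deriv {g g' : ℝ → ℝ} {a b K : ℝ}
    (hg : ∀ t ∈ Icc a b, HasDerivAt g (g' t) t) (h : ∀ t ∈ Icc a b, -(K * |g t|) ≤ g' t)
    (ha : 0 < g a) : ∀ t ∈ Icc a b, 0 < g t := by
  intro t ht
  have hnn := nonneg_of_neg_mul_abs_le_deriv hg h ha.le
  have hm : MonotoneOn (fun t => g t * Real.exp (K * t)) (Icc a b) := by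
    have hd : ∀ t ∈ Icc a b, HasDerivAt (fun t => g t * Real.exp (K * t))
        ((g' t + K * g t) * Real.exp (K * t)) t := fun t ht => by
      have := (hg t ht).mul (((hasDerivAt_id t).const_mul K).exp)
      exact this.congr_deriv (by simp; ring)
    refine monotoneOn_of_deriv_nonneg (convex_Icc a b)
      (fun t ht => (hd t ht).continuousAt.continuousWithinAt)
      (fun t ht => (hd t (interior_subset ht)).differentiableAt.differentiableWithinAt)
      fun t ht => ?_
    rw [(hd t (interior_subset ht)).deriv]
    have h1 := h t (interior_subset ht)
    rw [abs_of_nonneg (hnn t (interior_subset ht))] at h1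
    exact mul_nonneg (by linarith) (Real.exp_pos _).le
  have h1 := hm (left_mem_Icc.2 (ht.1.trans ht.2)) ht ht.1
  have h2 : 0 < g a * Real.exp (K * a) := mul_pos ha (Real.exp_pos _)
  exact pos_of_mul_pos_left (h2.trans_le h1) (Real.exp_pos _).le

end KYamabe
-- The truncated autonomous system and its invariant region.
namespace KYamabe
open Filter Topology Set MeasureTheory

/-- The hyperbolic tangent, in a form with an elementary derivative. -/
noncomputable def slopeOf (x : ℝ) : ℝ := 1 - 2 / (Real.exp (2 * x) + 1)

lemma hasDerivAt_slopeOf (x : ℝ) : HasDerivAt slopeOf (1 - slopeOf x ^ 2) x := by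
  have h := Real.exp_pos (2 * x)
  have h1 := ((hasDerivAt_exp_two_mul x).add_const 1)
  have h2 := ((hasDerivAt_const x (2 : ℝ)).div h1 (by positivity)).const_sub 1
  refine h2.congr_deriv ?_
  rw [slopeOf]
  field_simp
  ring

lemma contDiff_slopeOf : ContDiff ℝ ∞ slopeOf :=
  contDiff_const.sub (contDiff_const.div ((contDiff_const.mul contDiff_id).exp.add contDiff_const)
    fun x => by have := Real.exp_pos (2 * x); positivity)

lemma slopeOf_mem (x : ℝ) : slopeOf x ∈ Ioo (-1 : ℝ) 1 := by
  have h := Real.exp_pos (2 * x)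
  have h1 : 2 / (Real.exp (2 * x) + 1) < 2 := by rw [div_lt_iff₀ (by positivity)]; linarith
  have h2 : 0 < 2 / (Real.exp (2 * x) + 1) := by positivity
  rw [slopeOf]
  exact ⟨by linarith, by linarith⟩

lemma one_sub_slopeOf_sq_pos (x : ℝ) : 0 < 1 - slopeOf x ^ 2 := by
  have := slopeOf_mem x
  nlinarith [this.1, this.2]

/-- The inverse of `slopeOf`. -/
noncomputable def ofSlope (y : ℝ) : ℝ := (Real.log (1 + y) - Real.log (1 - y)) / 2

lemma slopeOf_ofSlope {y : ℝ} (hy : y ∈ Ioo (-1 : ℝ) 1) : slopeOf (ofSlope y) = y := by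
  have h1 : 0 < 1 + y := by linarith [hy.1]
  have h2 : 0 < 1 - y := by linarith [hy.2]
  rw [slopeOf, ofSlope, mul_div_cancel₀ _ (two_ne_zero), Real.exp_sub, Real.exp_log h1,
    Real.exp_log h2]
  field_simp
  ring

lemma hasDerivAt_ofSlope {y : ℝ} (hy : y ∈ Ioo (-1 : ℝ) 1) :
    HasDerivAt ofSlope (1 / (1 - y ^ 2)) y := by
  have h1 : 0 < 1 + y := by linarith [hy.1]
  have h2 : 0 < 1 - y := by linarith [hy.2]
  have h3 : 1 - y ^ 2 ≠ 0 := by nlinarith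
  refine (((((hasDerivAt_id y).const_add 1).log h1.ne').sub
    (((hasDerivAt_id y).const_sub 1).log h2.ne')).div_const 2).congr_deriv ?_
  simp only [id]
  field_simp
  ring

/-- A smooth, bounded and Lipschitz truncation of `c X^k`. -/
lemma exists_truncated_pow {k : ℕ} (hk : 1 ≤ k) (c : ℝ) {B : ℝ} (hB : 0 < B) :
    ∃ χ : ℝ → ℝ, ContDiff ℝ ∞ χ ∧ χ 0 = 0 ∧ (∀ X ∈ Icc (0 : ℝ) B, χ X = c * X ^ k) ∧
      ∃ A > 0, (∀ X, |χ X| ≤ A) ∧ ∀ X X', |χ X - χ X'| ≤ A * |X - X'| := by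
  let b : ContDiffBump (0 : ℝ) := ⟨B, B + 1, hB, by linarith⟩
  let χ : ℝ → ℝ := fun X => c * X ^ k * b X
  have hχ : ContDiff ℝ ∞ χ := (contDiff_const.mul (contDiff_id.pow k)).mul b.contDiff
  have hsupp : HasCompactSupport χ := b.hasCompactSupport.mul_left
  obtain ⟨K, hK⟩ := ContDiff.lipschitzWith_of_hasCompactSupport hsupp hχ (by simp)
  obtain ⟨D, hD⟩ := hsupp.exists_bound_of_continuous hχ.continuous
  refine ⟨χ, hχ, by simp [χ, zero_pow (show k ≠ 0 by omega)], fun X hX => ?_,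
    max (K + 1) D, lt_max_of_lt_left (by positivity), fun X => ?_, fun X X' => ?_⟩
  · have : b X = 1 := b.one_of_mem_closedBall (by
      rw [mem_closedBall_zero_iff, Real.norm_eq_abs, abs_of_nonneg hX.1]; exact hX.2)
    simp [χ, this]
  · exact (hD X).trans (le_max_right _ _)
  · have h1 := hK.dist_le_mul X X'
    rw [Real.dist_eq, Real.dist_eq] at h1
    refine h1.trans (mul_le_mul_of_nonneg_right ?_ (abs_nonneg _))
    exact le_trans (by linarith) (le_max_left _ _)

/-- The autonomous system for the slope (through `slopeOf`) and `-log` of the angular eigenvalue. -/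
noncomputable def phaseField (n k : ℕ) (θ ρ : ℝ) (χ : ℝ → ℝ) (p : ℝ × ℝ) : ℝ × ℝ :=
  ((χ ((ρ - 2 * θ * slopeOf p.1) * Real.exp p.2) - (n - 2 * k)) / (2 * k),
    slopeOf p.1 / k * (χ ((ρ - 2 * θ * slopeOf p.1) * Real.exp p.2) - n))

section PhaseField
variable {n k : ℕ} {θ ρ : ℝ} {χ : ℝ → ℝ}

lemma contDiff_phaseField (hχ : ContDiff ℝ ∞ χ) : ContDiff ℝ ∞ (phaseField n k θ ρ χ) := by
  have h1 : ContDiff ℝ ∞ fun p : ℝ × ℝ => slopeOf p.1 := contDiff_slopeOf.comp contDiff_fst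
  have h2 : ContDiff ℝ ∞ fun p : ℝ × ℝ => χ ((ρ - 2 * θ * slopeOf p.1) * Real.exp p.2) :=
    hχ.comp ((contDiff_const.sub (contDiff_const.mul h1)).mul contDiff_snd.exp)
  exact ((h2.sub contDiff_const).div_const _).prodMk ((h1.div_const _).mul (h2.sub contDiff_const))

lemma norm_phaseField_le (hk : 1 ≤ k) {A : ℝ} (hA : ∀ X, |χ X| ≤ A) (p : ℝ × ℝ) :
    ‖phaseField n k θ ρ χ p‖ ≤ A + n + 2 * k := by
  have hk' : (1 : ℝ) ≤ k := by exact_mod_cast hk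
  have hn' : (0 : ℝ) ≤ n := by positivity
  have h1 := abs_le.1 (hA ((ρ - 2 * θ * slopeOf p.1) * Real.exp p.2))
  have hs := slopeOf_mem p.1
  have hA0 : 0 ≤ A := (abs_nonneg _).trans (hA 0)
  rw [phaseField, Prod.norm_def]
  refine max_le ?_ ?_
  · simp only [Real.norm_eq_abs, abs_div]
    rw [abs_of_pos (show (0 : ℝ) < 2 * k by linarith)]
    refine (div_le_self (abs_nonneg _) (by linarith)).trans (abs_le.2 ⟨by linarith, by linarith⟩)
  · simp only [Real.norm_eq_abs, abs_mul]
    have h2 : |slopeOf p.1 / k| ≤ 1 := by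
      rw [abs_div, abs_of_pos (show (0 : ℝ) < k by linarith), div_le_one (by linarith)]
      exact (abs_le.2 ⟨hs.1.le, hs.2.le⟩).trans hk'
    have h3 : |χ ((ρ - 2 * θ * slopeOf p.1) * Real.exp p.2) - n| ≤ A + n + 2 * k :=
      abs_le.2 ⟨by linarith, by linarith⟩
    exact (mul_le_of_le_one_left (abs_nonneg _) h2).trans h3

variable {α : ℝ → ℝ × ℝ}

lemma hasDerivAt_phase_fst (hα : ∀ t, HasDerivAt α (phaseField n k θ ρ χ (α t)) t) (t : ℝ) :
    HasDerivAt (fun t => (α t).1)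
      ((χ ((ρ - 2 * θ * slopeOf (α t).1) * Real.exp (α t).2) - (n - 2 * k)) / (2 * k)) t :=
  (hα t).fst

lemma hasDerivAt_phase_snd (hα : ∀ t, HasDerivAt α (phaseField n k θ ρ χ (α t)) t) (t : ℝ) :
    HasDerivAt (fun t => (α t).2)
      (slopeOf (α t).1 / k * (χ ((ρ - 2 * θ * slopeOf (α t).1) * Real.exp (α t).2) - n)) t :=
  (hα t).snd

lemma hasDerivAt_source (hα : ∀ t, HasDerivAt α (phaseField n k θ ρ χ (α t)) t) (t : ℝ) :
    HasDerivAt (fun t => ρ - 2 * θ * slopeOf (α t).1)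
      (-(θ / k * (1 - slopeOf (α t).1 ^ 2) *
        (χ ((ρ - 2 * θ * slopeOf (α t).1) * Real.exp (α t).2) - (n - 2 * k)))) t := by
  have h := (hasDerivAt_slopeOf (α t).1).comp t (hasDerivAt_phase_fst hα t)
  refine ((h.const_mul (2 * θ)).const_sub ρ).congr_deriv ?_
  rcases eq_or_ne (k : ℝ) 0 with hk | hk
  · simp [hk]
  · field_simp

/-- Along the flow the source term stays positive, for `θ > 0`. -/
lemma source_pos_of_phase (hθ : 0 < θ) (hk : 1 ≤ k) (hkn : 2 * k ≤ n) (hχ0 : χ 0 = 0)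
    {A : ℝ} (hA : 0 < A) (hlip : ∀ X X', |χ X - χ X'| ≤ A * |X - X'|)
    (hα : ∀ t, HasDerivAt α (phaseField n k θ ρ χ (α t)) t) {t₀ : ℝ}
    (h0 : 0 < ρ - 2 * θ * slopeOf (α t₀).1) {t : ℝ} (ht : t₀ ≤ t) :
    0 < ρ - 2 * θ * slopeOf (α t).1 := by
  have hk' : (1 : ℝ) ≤ k := by exact_mod_cast hk
  have hkn' : 2 * (k : ℝ) ≤ n := by exact_mod_cast hkn
  have hc : Continuous fun t => Real.exp (α t).2 :=
    Real.continuous_exp.comp (continuous_snd.comp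
      (continuous_iff_continuousAt.2 fun t => (hα t).continuousAt))
  obtain ⟨D, hD⟩ := (isCompact_Icc (a := t₀) (b := t)).exists_bound_of_continuousOn hc.continuousOn
  refine pos_of_neg_mul_abs_le_deriv (K := θ / k * (A * D)) (fun t _ => hasDerivAt_source hα t)
    (fun τ hτ => ?_) h0 t (right_mem_Icc.2 ht)
  set f := ρ - 2 * θ * slopeOf (α τ).1
  -- As χ(0) = 0, χ is at most A|f|e^p, where p is the second coordinate; the remaining term of f'
  -- has a favourable sign because n ≥ 2k.
  have h1 := hlip (f * Real.exp (α τ).2) 0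
  rw [hχ0, sub_zero, sub_zero, abs_mul] at h1
  have h2 : A * (|f| * |Real.exp (α τ).2|) ≤ A * (|f| * D) :=
    mul_le_mul_of_nonneg_left (mul_le_mul_of_nonneg_left (hD τ hτ) (abs_nonneg _)) hA.le
  have h3 := le_abs_self (χ (f * Real.exp (α τ).2))
  have h4 : 0 < 1 - slopeOf (α τ).1 ^ 2 := one_sub_slopeOf_sq_pos _
  have h5 : 1 - slopeOf (α τ).1 ^ 2 ≤ 1 := by nlinarith [sq_nonneg (slopeOf (α τ).1)]
  have hD0 : 0 ≤ D := (norm_nonneg _).trans (hD τ hτ)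
  have h6 : 0 ≤ A * (|f| * D) := by positivity
  have h7 : (1 - slopeOf (α τ).1 ^ 2) * (χ (f * Real.exp (α τ).2) - (n - 2 * k)) ≤ A * (|f| * D) :=
    calc _ ≤ (1 - slopeOf (α τ).1 ^ 2) * (A * (|f| * D)) :=
          mul_le_mul_of_nonneg_left (by linarith) h4.le
      _ ≤ _ := mul_le_of_le_one_left h6 h5
  have h8 := mul_le_mul_of_nonneg_left h7 (show 0 ≤ θ / k by positivity)
  rw [neg_le_neg_iff, mul_assoc (θ / k)]
  refine h8.trans (le_of_eq (by ring))

/-- Along the flow the truncation threshold is not crossed, for `θ > 0`. -/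
lemma mul_exp_le_of_phase (hθ : 0 < θ) (hk : 1 ≤ k) {B : ℝ} (hχB : χ B = n)
    {A : ℝ} (hlip : ∀ X X', |χ X - χ X'| ≤ A * |X - X'|)
    (hα : ∀ t, HasDerivAt α (phaseField n k θ ρ χ (α t)) t) {t₀ : ℝ}
    (h0 : (ρ - 2 * θ * slopeOf (α t₀).1) * Real.exp (α t₀).2 ≤ B) {t : ℝ} (ht : t₀ ≤ t) :
    (ρ - 2 * θ * slopeOf (α t).1) * Real.exp (α t).2 ≤ B := by
  have hk' : (1 : ℝ) ≤ k := by exact_mod_cast hk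
  have hαc : Continuous α := continuous_iff_continuousAt.2 fun t => (hα t).continuousAt
  have hc : Continuous fun t => Real.exp (α t).2 := Real.continuous_exp.comp (continuous_snd.comp hαc)
  have hcX : Continuous fun t => (ρ - 2 * θ * slopeOf (α t).1) * Real.exp (α t).2 :=
    (continuous_const.sub (continuous_const.mul
      (contDiff_slopeOf.continuous.comp (continuous_fst.comp hαc)))).mul hc
  obtain ⟨D, hD⟩ := (isCompact_Icc (a := t₀) (b := t)).exists_bound_of_continuousOn hc.continuousOn
  obtain ⟨D', hD'⟩ := (isCompact_Icc (a := t₀) (b := t)).exists_bound_of_continuousOn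
    hcX.continuousOn
  have hX : ∀ τ, HasDerivAt (fun t => B - (ρ - 2 * θ * slopeOf (α t).1) * Real.exp (α t).2) _ τ :=
    fun τ => ((hasDerivAt_source hα τ).mul (hasDerivAt_phase_snd hα τ).exp).const_sub B
  have := nonneg_of_neg_mul_abs_le_deriv (K := A * (θ / k * D + D' / k)) (fun t _ => hX t)
    (fun τ hτ => ?_) (sub_nonneg.2 h0) t (right_mem_Icc.2 ht)
  · linarith
  · have hDτ : Real.exp (α τ).2 ≤ D := (le_abs_self _).trans (hD τ hτ)
    have hDτ' := hD' τ hτ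
    have h1 := hlip B ((ρ - 2 * θ * slopeOf (α τ).1) * Real.exp (α τ).2)
    rw [hχB] at h1
    have hy := slopeOf_mem (α τ).1
    set y := slopeOf (α τ).1
    set X := (ρ - 2 * θ * y) * Real.exp (α τ).2
    set e := n - χ X
    have he : χ X = n - e := by simp only [e]; ring
    have h4 : 0 < 1 - y ^ 2 := by nlinarith [hy.1, hy.2]
    have h5 : 1 - y ^ 2 ≤ 1 := by nlinarith [sq_nonneg y]
    have hE := Real.exp_pos (α τ).2
    -- X' is split into its value at χ = n, which is nonpositive for θ > 0, and terms proportional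
    -- to e = n - χ(X), controlled by |B - X|.
    have h6 : -(θ / k * (1 - y ^ 2) * (χ X - (n - 2 * k))) * Real.exp (α τ).2 +
        (ρ - 2 * θ * y) * (Real.exp (α τ).2 * (y / k * (χ X - n))) =
        -(2 * θ * (1 - y ^ 2) * Real.exp (α τ).2) +
          (θ / k * (1 - y ^ 2) * Real.exp (α τ).2 * e - X * y / k * e) := by
      rw [he]
      simp only [X]
      field_simp
      ring
    have h7 : 0 ≤ 2 * θ * (1 - y ^ 2) * Real.exp (α τ).2 := by positivity
    have h8 : θ / k * (1 - y ^ 2) * Real.exp (α τ).2 * e ≤ θ / k * D * |e| := by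
      have : θ / k * (1 - y ^ 2) * Real.exp (α τ).2 ≤ θ / k * D := by
        have h9 : (1 - y ^ 2) * Real.exp (α τ).2 ≤ 1 * D := mul_le_mul h5 hDτ hE.le zero_le_one
        rw [mul_assoc]
        exact mul_le_mul_of_nonneg_left (by linarith) (by positivity)
      calc _ ≤ θ / k * (1 - y ^ 2) * Real.exp (α τ).2 * |e| :=
            mul_le_mul_of_nonneg_left (le_abs_self e) (by positivity)
        _ ≤ _ := mul_le_mul_of_nonneg_right this (abs_nonneg _)
    have h10 : -(X * y / k * e) ≤ D' / k * |e| := by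
      refine (neg_le_abs _).trans ?_
      rw [abs_mul, abs_div, abs_mul, abs_of_pos (show (0 : ℝ) < k by linarith)]
      refine mul_le_mul_of_nonneg_right ?_ (abs_nonneg _)
      have h11 : |X| * |y| ≤ D' * 1 := mul_le_mul hDτ' (abs_le.2 ⟨hy.1.le, hy.2.le⟩)
        (abs_nonneg _) ((norm_nonneg _).trans hDτ')
      gcongr
      linarith
    have hD0 : 0 ≤ D := hE.le.trans hDτ
    have hD0' : 0 ≤ D' := (norm_nonneg _).trans hDτ'
    have h12 : (θ / k * D + D' / k) * |e| ≤ (θ / k * D + D' / k) * (A * |B - X|) :=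
      mul_le_mul_of_nonneg_left h1 (by positivity)
    rw [h6]
    linarith

end PhaseField

end KYamabe
-- Recovering the profile from a phase curve, and gluing.
namespace KYamabe
open Filter Topology Set MeasureTheory

section Reconstruction
variable {n k : ℕ} {θ ρ : ℝ} {χ : ℝ → ℝ} {α : ℝ → ℝ × ℝ}

/-- The logarithm of the profile associated with an integral curve of `phaseField`. -/
noncomputable def logProfile (α : ℝ → ℝ × ℝ) (t : ℝ) : ℝ :=
  t - (Real.log ((1 - slopeOf (α t).1 ^ 2) / 2) + (α t).2) / 2

/-- The profile associated with an integral curve of `phaseField`. -/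
noncomputable def profileOf (α : ℝ → ℝ × ℝ) (s : ℝ) : ℝ := Real.exp (logProfile α (Real.log s / 2))

/-- The contributions of χ from the two coordinates cancel, which confirms that slopeOf of the first
coordinate is the logarithmic slope Y. -/
lemma hasDerivAt_logProfile (hk : 1 ≤ k)
    (hα : ∀ t, HasDerivAt α (phaseField n k θ ρ χ (α t)) t) (t : ℝ) :
    HasDerivAt (logProfile α) (1 + slopeOf (α t).1) t := by
  have hk' : (1 : ℝ) ≤ k := by exact_mod_cast hk
  have hpos := one_sub_slopeOf_sq_pos (α t).1
  have h1 := (hasDerivAt_slopeOf (α t).1).comp t (hasDerivAt_phase_fst hα t)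
  have h2 := ((((h1.pow 2).const_sub 1).div_const 2).log (by
    simp only [Pi.pow_apply, Function.comp_apply]; positivity))
  refine ((hasDerivAt_id t).sub ((h2.add (hasDerivAt_phase_snd hα t)).div_const 2)).congr_deriv ?_
  simp only [Pi.pow_apply, Function.comp_apply]
  field_simp
  ring

lemma exp_two_mul_log_div_two {s : ℝ} (hs : 0 < s) : Real.exp (2 * (Real.log s / 2)) = s := by
  rw [mul_div_cancel₀ _ two_ne_zero, Real.exp_log hs]

/-- This is LZ = (1-Y²)/2 with Z = s/φ² and L = e^{-p}, p being the second coordinate. -/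
lemma profileOf_sq {s : ℝ} (hs : 0 < s) :
    profileOf α s ^ 2 * ((1 - slopeOf (α (Real.log s / 2)).1 ^ 2) / 2 *
      Real.exp (α (Real.log s / 2)).2) = s := by
  have hpos := one_sub_slopeOf_sq_pos (α (Real.log s / 2)).1
  rw [profileOf, ← Real.exp_nat_mul, logProfile]
  set t := Real.log s / 2 with ht
  set l := (1 - slopeOf (α t).1 ^ 2) / 2 with hl
  have hl0 : 0 < l := by positivity
  have h1 : l * Real.exp (α t).2 = Real.exp (Real.log l + (α t).2) := by
    rw [Real.exp_add, Real.exp_log hl0]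
  rw [h1, ← Real.exp_add]
  have h2 : ((2 : ℕ) : ℝ) * (t - (Real.log l + (α t).2) / 2) + (Real.log l + (α t).2) = 2 * t := by
    push_cast; ring
  rw [h2, ht, exp_two_mul_log_div_two hs]

lemma hasDerivAt_profileOf (hk : 1 ≤ k)
    (hα : ∀ t, HasDerivAt α (phaseField n k θ ρ χ (α t)) t) {s : ℝ} (hs : 0 < s) :
    HasDerivAt (profileOf α)
      (profileOf α s * (1 + slopeOf (α (Real.log s / 2)).1) / (2 * s)) s := by
  have h1 : HasDerivAt (fun s => Real.log s / 2) (s⁻¹ / 2) s :=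
    (Real.hasDerivAt_log hs.ne').div_const 2
  have h2 := ((hasDerivAt_logProfile hk hα (Real.log s / 2)).comp s h1).exp
  refine h2.congr_deriv ?_
  rw [profileOf, Function.comp_apply]
  field_simp

lemma contDiff_integralCurve (hχ : ContDiff ℝ ∞ χ)
    (hα : ∀ t, HasDerivAt α (phaseField n k θ ρ χ (α t)) t) : ContDiff ℝ ∞ α := by
  refine contDiff_iff_contDiffAt.2 fun t => ?_
  have h1 : ContDiffOn ℝ ∞ (Function.uncurry fun _ : ℝ => phaseField n k θ ρ χ)
      (Icc (t - 1) (t + 1) ×ˢ univ) := ((contDiff_phaseField hχ).comp contDiff_snd).contDiffOn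
  have h2 := ODE.contDiffOn_enat_Icc_of_hasDerivWithinAt (n := ⊤) h1
    (fun t _ => (hα t).hasDerivWithinAt) (mapsTo_univ _ _)
  exact h2.contDiffAt (Icc_mem_nhds (by linarith) (by linarith))

lemma contDiffAt_profileOf (hχ : ContDiff ℝ ∞ χ)
    (hα : ∀ t, HasDerivAt α (phaseField n k θ ρ χ (α t)) t) {s : ℝ} (hs : 0 < s) :
    ContDiffAt ℝ ∞ (profileOf α) s := by
  have hc := contDiff_integralCurve hχ hα
  have h1 : ContDiff ℝ ∞ (logProfile α) := by
    refine contDiff_id.sub (ContDiff.div_const (ContDiff.add (ContDiff.log ?_ fun t => ?_) ?_) 2)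
    · exact (contDiff_const.sub ((contDiff_slopeOf.comp (contDiff_fst.comp hc)).pow 2)).div_const 2
    · have := one_sub_slopeOf_sq_pos (α t).1
      positivity
    · exact contDiff_snd.comp hc
  have h2 : ContDiffAt ℝ ∞ (fun s => Real.log s / 2) s :=
    (Real.contDiffAt_log.2 hs.ne').div_const 2
  exact Real.contDiff_exp.contDiffAt.comp s (h1.contDiffAt.comp s h2)

lemma isProfileAt_profileOf (hk : 1 ≤ k) {C : ℝ} (hC : C = ((n - 1).choose (k - 1) : ℝ))
    (hC0 : 0 < C) (hχ : ContDiff ℝ ∞ χ)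
    (hα : ∀ t, HasDerivAt α (phaseField n k θ ρ χ (α t)) t) {s : ℝ} (hs : 0 < s)
    (hf : 0 < ρ - 2 * θ * slopeOf (α (Real.log s / 2)).1)
    (hχX : χ ((ρ - 2 * θ * slopeOf (α (Real.log s / 2)).1) * Real.exp (α (Real.log s / 2)).2) =
      k / C * ((ρ - 2 * θ * slopeOf (α (Real.log s / 2)).1) * Real.exp (α (Real.log s / 2)).2) ^ k) :
    IsProfileAt n k θ ρ (profileOf α) s := by
  have hk' : (1 : ℝ) ≤ k := by exact_mod_cast hk
  have hpos : 0 < profileOf α s := Real.exp_pos _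
  have hd := hasDerivAt_profileOf hk hα hs
  have hdd : deriv (deriv (profileOf α)) s = profileOf α s / (4 * s ^ 2) *
      ((1 + slopeOf (α (Real.log s / 2)).1) ^ 2 +
        (1 - slopeOf (α (Real.log s / 2)).1 ^ 2) * ((χ ((ρ - 2 * θ * slopeOf (α (Real.log s / 2)).1) *
          Real.exp (α (Real.log s / 2)).2) - (n - 2 * k)) / (2 * k))
        - 2 * (1 + slopeOf (α (Real.log s / 2)).1)) := by
    have he : deriv (profileOf α) =ᶠ[𝓝 s]
        fun s => profileOf α s * (1 + slopeOf (α (Real.log s / 2)).1) / (2 * s) := by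
      filter_upwards [lt_mem_nhds hs] with y hy using (hasDerivAt_profileOf hk hα hy).deriv
    have h1 : HasDerivAt (fun s => Real.log s / 2) (s⁻¹ / 2) s :=
      (Real.hasDerivAt_log hs.ne').div_const 2
    have h0 := (hasDerivAt_slopeOf (α (Real.log s / 2)).1).comp (Real.log s / 2)
      (hasDerivAt_phase_fst hα (Real.log s / 2))
    have h2 := HasDerivAt.comp (h₂ := slopeOf ∘ fun t => (α t).1) s h0 h1
    have h3 := (hd.mul (h2.const_add 1)).div ((hasDerivAt_id s).const_mul 2)
      (by simp only [id]; positivity)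
    rw [he.deriv_eq]
    refine h3.deriv.trans ?_
    simp only [id, Function.comp_apply, Pi.mul_apply]
    field_simp
    ring
  have hsq := profileOf_sq (α := α) hs
  have hsm := contDiffAt_profileOf hχ hα hs
  rw [hχX] at hdd
  have hE := Real.exp_pos (α (Real.log s / 2)).2
  have hy := one_sub_slopeOf_sq_pos (α (Real.log s / 2)).1
  set y := slopeOf (α (Real.log s / 2)).1
  set e := Real.exp (α (Real.log s / 2)).2
  set Q := k / C * ((ρ - 2 * θ * y) * e) ^ k with hQ
  have hratio : profileOf α s ^ 2 * (1 - y ^ 2) / s = 2 * e⁻¹ := by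
    field_simp
    linarith
  have hang : angular (profileOf α) s = e⁻¹ := by
    have : angular (profileOf α) s = (profileOf α s ^ 2 * (1 - y ^ 2) / s) / 2 := by
      rw [angular, hd.deriv]
      field_simp
      ring
    rw [this, hratio]
    ring
  have hdef : defect (profileOf α) s = e⁻¹ * (Q - n) / k := by
    have : defect (profileOf α) s =
        (profileOf α s ^ 2 * (1 - y ^ 2) / s) * ((Q - (n - 2 * k)) / (2 * k) - 1) := by
      rw [defect, hdd]
      field_simp
      ring
    rw [this, hratio]
    field_simp
    ring
  have hsrc : sourceTerm θ ρ (profileOf α) s = ρ - 2 * θ * y := by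
    rw [sourceTerm, hd.deriv]
    field_simp
    ring
  refine ⟨hsm, hpos, by rw [hang]; positivity, hsrc ▸ hf, ?_⟩
  rw [hang, hdef, hsrc, ← hC]
  have h1 : n * e⁻¹ + k * (e⁻¹ * (Q - n) / k) = e⁻¹ * Q := by field_simp; ring
  have h2 : C * e⁻¹ ^ (k - 1) * (e⁻¹ * Q) = C * e⁻¹ ^ k * Q := by
    have : e⁻¹ ^ k = e⁻¹ ^ (k - 1) * e⁻¹ := by rw [← pow_succ]; congr 1; omega
    rw [this]
    ring
  rw [h1, h2, hQ, mul_pow]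
  have h3 : e⁻¹ ^ k * e ^ k = 1 := by rw [← mul_pow, inv_mul_cancel₀ hE.ne', one_pow]
  calc C * e⁻¹ ^ k * (k / C * ((ρ - 2 * θ * y) ^ k * e ^ k))
      = C / C * (k * (ρ - 2 * θ * y) ^ k * (e⁻¹ ^ k * e ^ k)) := by ring
    _ = k * (ρ - 2 * θ * y) ^ k := by rw [h3, div_self hC0.ne', one_mul, mul_one]

end Reconstruction

/-- Existence of the profile of an entire radial solution. -/
theorem exists_global_profile {n k : ℕ} (hn : 3 ≤ n) (hk : 1 ≤ k) (hkn : 2 * k ≤ n) {θ ρ : ℝ}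
    (hθ : 0 < θ) (h0 : 0 < 2 * θ + ρ) :
    ∃ φ : ℝ → ℝ, φ 0 = 1 ∧ ∀ s, 0 ≤ s → IsProfileAt n k θ ρ φ s := by
  have hn' : (3 : ℝ) ≤ n := by exact_mod_cast hn
  have hk' : (1 : ℝ) ≤ k := by exact_mod_cast hk
  obtain ⟨r, hr, φ, hφ0, hφ⟩ := exists_local_profile hn hk (by omega) hθ h0
  set C : ℝ := ((n - 1).choose (k - 1) : ℝ) with hCdef
  have hC : 0 < C := by
    rw [hCdef]
    exact_mod_cast Nat.choose_pos (by omega)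
  -- B is the value of X = f/L at which d = 0, because (k/C) X^k = n + kd/L. Hence X ≤ B is the
  -- condition d ≤ 0.
  set B : ℝ := (n * C / k) ^ (1 / (k : ℝ)) with hBdef
  have hB : 0 < B := Real.rpow_pos_of_pos (by positivity) _
  have hBk : B ^ k = n * C / k := by
    rw [hBdef, one_div]
    exact Real.rpow_inv_natCast_pow (by positivity) (by omega)
  obtain ⟨χ, hχ, hχ0, hχX, A, hA, hχA, hlip⟩ := exists_truncated_pow hk (k / C) hB
  have hχB : χ B = n := by
    rw [hχX B ⟨hB.le, le_rfl⟩, hBk]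
    field_simp
  have hmem : ∀ t, Real.exp (2 * t) < r → Real.exp (2 * t) ∈ Ioo (-r) r := fun t ht =>
    ⟨by linarith [Real.exp_pos (2 * t)], ht⟩
  have hP : ∀ t, Real.exp (2 * t) < r → IsProfileAt n k θ ρ φ (Real.exp (2 * t)) := fun t ht =>
    (hφ _ (hmem t ht)).1
  have hslope : ∀ t, Real.exp (2 * t) < r → phaseSlope φ t ∈ Ioo (-1 : ℝ) 1 := fun t ht => by
    have h1 := angular_mul_phaseFactor (t := t) (hP t ht).pos.ne'
    have h2 : 0 < phaseFactor φ t := div_pos (Real.exp_pos _) (pow_pos (hP t ht).pos 2)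
    have h3 := mul_pos (hP t ht).angular_pos h2
    rw [h1] at h3
    exact abs_lt.1 ((sq_lt_one_iff_abs_lt_one _).1 (by linarith))
  have hsource : ∀ t, Real.exp (2 * t) < r →
      sourceTerm θ ρ φ (Real.exp (2 * t)) = ρ - 2 * θ * phaseSlope φ t := fun t _ => by
    rw [sourceTerm, phaseSlope]
    ring
  have hXmem : ∀ t, Real.exp (2 * t) < r → (ρ - 2 * θ * phaseSlope φ t) *
      Real.exp (-Real.log (angular φ (Real.exp (2 * t)))) ∈ Icc 0 B := fun t ht => by
    have h1 := (hφ _ (hmem t ht)).2 (Real.exp_pos _).le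
    have hL := (hP t ht).angular_pos
    have hS := (hP t ht).source_pos
    rw [hsource t ht] at h1 hS
    rw [Real.exp_neg, Real.exp_log hL]
    refine ⟨by positivity, le_of_pow_le_pow_left₀ (show k ≠ 0 by omega) hB.le ?_⟩
    rw [hBk, mul_pow, inv_pow, ← div_eq_mul_inv, div_le_div_iff₀ (by positivity) (by positivity)]
    linarith
  -- The local profile in phase coordinates. By `hXmem` it lies where χ is the untruncated power, so
  -- it is an integral curve of `phaseField`.
  let β : ℝ → ℝ × ℝ := fun t =>
    (ofSlope (phaseSlope φ t), -Real.log (angular φ (Real.exp (2 * t))))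
  have hβ : ∀ t, Real.exp (2 * t) < r → HasDerivAt β (phaseField n k θ ρ χ (β t)) t := fun t ht => by
    have hp := hP t ht
    have hL := hp.angular_pos
    have hsm : ContDiffAt ℝ 2 φ (Real.exp (2 * t)) := hp.smooth.of_le (WithTop.coe_le_coe.2 le_top)
    have hsl := hslope t ht
    have h1 := (hasDerivAt_ofSlope hsl).comp t (hasDerivAt_phaseSlope hsm hp.pos.ne')
    have h2 := ((hasDerivAt_angular_exp hsm hp.pos.ne').log hL.ne').neg
    have h3 := angular_mul_phaseFactor (t := t) hp.pos.ne'
    have heq := hp.eq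
    rw [hsource t ht, ← hCdef] at heq
    have hX := hχX _ (hXmem t ht)
    refine (h1.prodMk h2).congr_deriv ?_
    simp only [phaseField, β, slopeOf_ofSlope hsl]
    rw [hX, Real.exp_neg, Real.exp_log hL, mul_pow, inv_pow]
    set y := phaseSlope φ t
    set L := angular φ (Real.exp (2 * t))
    set d := defect φ (Real.exp (2 * t))
    set z := phaseFactor φ t
    have hy : 1 - y ^ 2 ≠ 0 := by nlinarith [hsl.1, hsl.2]
    have hLk : L ^ k = L ^ (k - 1) * L := by rw [← pow_succ]; congr 1; omega
    have hLk0 : L ^ (k - 1) ≠ 0 := (pow_pos hL _).ne'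
    have hQ : k / C * ((ρ - 2 * θ * y) ^ k * (L ^ k)⁻¹) = n + k * d / L := by
      rw [hLk]
      field_simp
      linear_combination -heq
    rw [hQ]
    have hz : z = (1 - y ^ 2) / (2 * L) := by
      field_simp
      linarith
    refine Prod.ext ?_ ?_
    · simp only
      rw [hz]
      field_simp
      ring
    · simp only
      field_simp
      ring
  set s₀ : ℝ := r / 2 with hs₀
  have hs₀pos : 0 < s₀ := by positivity
  set t₀ : ℝ := Real.log s₀ / 2 with ht₀
  have hexp₀ : Real.exp (2 * t₀) = s₀ := exp_two_mul_log_div_two hs₀pos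
  have ht₀r : Real.exp (2 * t₀) < r := by rw [hexp₀]; linarith
  have hα' := exists_global_integralCurve (V := phaseField n k θ ρ χ)
    ((contDiff_phaseField hχ).of_le (WithTop.coe_le_coe.2 le_top)) (norm_phaseField_le hk hχA)
    (β t₀) t₀
  obtain ⟨α, hα0, hα⟩ := hα'
  have hαβ : α =ᶠ[𝓝 t₀] β := by
    have h1 : ∀ᶠ t in 𝓝 t₀, Real.exp (2 * t) < r :=
      (hasDerivAt_exp_two_mul t₀).continuousAt.eventually (gt_mem_nhds ht₀r)
    obtain ⟨δ, hδ, hsub⟩ := Metric.nhds_basis_closedBall.mem_iff.1 h1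
    rw [Real.closedBall_eq_Icc] at hsub
    have h2 := ode_solution_unique ((contDiff_phaseField hχ).of_le (WithTop.coe_le_coe.2 le_top))
      (t₀ := t₀) (a := t₀ - δ) (b := t₀ + δ) ⟨by linarith, by linarith⟩
      (fun t _ => (hα t).hasDerivWithinAt) (fun t ht => (hβ t (hsub ht)).hasDerivWithinAt) hα0
    filter_upwards [Icc_mem_nhds (show t₀ - δ < t₀ by linarith) (show t₀ < t₀ + δ by linarith)]
      with t ht using h2 ht
  -- The phase coordinates determine φ² through `profileOf_sq`, and both profiles are positive.
  have hglue : profileOf α =ᶠ[𝓝 s₀] φ := by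
    have h1 : ContinuousAt (fun s => Real.log s / 2) s₀ :=
      (Real.continuousAt_log hs₀pos.ne').div_const 2
    filter_upwards [h1.eventually hαβ, lt_mem_nhds hs₀pos,
      gt_mem_nhds (show s₀ < r by linarith)] with s hs hs1 hs2
    have hes := exp_two_mul_log_div_two hs1
    have hlt : Real.exp (2 * (Real.log s / 2)) < r := hes.symm ▸ hs2
    have hp := hP _ hlt
    have hsq := profileOf_sq (α := α) hs1
    have h3 := angular_mul_phaseFactor (t := Real.log s / 2) hp.pos.ne'
    have hL := hp.angular_pos
    rw [hs] at hsq
    simp only [β, slopeOf_ofSlope (hslope _ hlt)] at hsq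
    rw [← h3, Real.exp_neg, Real.exp_log hL, phaseFactor, hes] at hsq
    rw [hes] at hp hL
    have hpos : 0 < profileOf α s := Real.exp_pos _
    have hφs := hp.pos
    have h4 : profileOf α s ^ 2 = φ s ^ 2 := by
      field_simp at hsq
      linarith
    exact (pow_left_inj₀ hpos.le hφs.le two_ne_zero).1 h4
  have hβ0 : slopeOf (α t₀).1 = phaseSlope φ t₀ := by
    rw [hα0]
    exact slopeOf_ofSlope (hslope t₀ ht₀r)
  have hf0 : 0 < ρ - 2 * θ * slopeOf (α t₀).1 := by
    rw [hβ0, ← hsource t₀ ht₀r]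
    exact (hP t₀ ht₀r).source_pos
  have hX0 : (ρ - 2 * θ * slopeOf (α t₀).1) * Real.exp (α t₀).2 ≤ B := by
    rw [hβ0, hα0]
    exact (hXmem t₀ ht₀r).2
  have hglobal : ∀ s, s₀ ≤ s → IsProfileAt n k θ ρ (profileOf α) s := fun s hs => by
    have hspos : 0 < s := hs₀pos.trans_le hs
    have ht : t₀ ≤ Real.log s / 2 := by
      have := Real.log_le_log hs₀pos hs
      linarith
    have hf := source_pos_of_phase hθ hk hkn hχ0 hA hlip hα hf0 ht
    have hXB := mul_exp_le_of_phase hθ hk hχB hlip hα hX0 ht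
    exact isProfileAt_profileOf hk hCdef hC hχ hα hspos hf
      (hχX _ ⟨by positivity, hXB⟩)
  refine ⟨fun s => if s < s₀ then φ s else profileOf α s, by simp [hs₀pos, hφ0], fun s hs => ?_⟩
  rcases lt_trichotomy s s₀ with hlt | heq | hgt
  · refine (hφ s ⟨by linarith, by linarith⟩).1.congr ?_
    filter_upwards [gt_mem_nhds hlt] with y hy
    simp [hy]
  · refine (hglobal s heq.ge).congr ?_
    rw [heq]
    filter_upwards [hglue] with y hy
    split_ifs
    · exact hy.symm
    · rfl
  · refine (hglobal s hgt.le).congr ?_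
    filter_upwards [lt_mem_nhds hgt] with y hy
    simp [not_lt.2 hy.le]

end KYamabe
-- Scaling, and the return to a solution on the whole space.
namespace KYamabe
open Filter Topology Set

/-- Dilation invariance: the eigenvalues and x·Dv/v are unchanged by v ↦ c v(x/c), while v(0) is
multiplied by c. -/
lemma IsProfileAt.rescale {n k : ℕ} {θ ρ : ℝ} {φ : ℝ → ℝ} {s c : ℝ} (hc : 0 < c)
    (h : IsProfileAt n k θ ρ φ ((c ^ 2)⁻¹ * s)) :
    IsProfileAt n k θ ρ (fun s => c * φ ((c ^ 2)⁻¹ * s)) s := by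
  have hd : deriv (fun s => c * φ ((c ^ 2)⁻¹ * s)) =
      fun s => c⁻¹ * deriv φ ((c ^ 2)⁻¹ * s) := by
    funext s
    rw [deriv_const_mul_field, deriv_comp_mul_left, smul_eq_mul]
    field_simp
  have hdd : deriv (deriv (fun s => c * φ ((c ^ 2)⁻¹ * s))) s =
      (c ^ 3)⁻¹ * deriv (deriv φ) ((c ^ 2)⁻¹ * s) := by
    rw [hd, deriv_const_mul_field, deriv_comp_mul_left, smul_eq_mul]
    field_simp
  have hpos := h.pos
  have hang : angular (fun s => c * φ ((c ^ 2)⁻¹ * s)) s = angular φ ((c ^ 2)⁻¹ * s) := by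
    simp only [angular, hd]
    field_simp
  have hdef : defect (fun s => c * φ ((c ^ 2)⁻¹ * s)) s = defect φ ((c ^ 2)⁻¹ * s) := by
    simp only [defect, hdd]
    field_simp
  have hsrc : sourceTerm θ ρ (fun s => c * φ ((c ^ 2)⁻¹ * s)) s =
      sourceTerm θ ρ φ ((c ^ 2)⁻¹ * s) := by
    simp only [sourceTerm, hd]
    field_simp
  refine ⟨?_, mul_pos hc hpos, hang ▸ h.angular_pos, hsrc ▸ h.source_pos, ?_⟩
  · exact contDiffAt_const.mul
      (ContDiffAt.comp (g := φ) s h.smooth (contDiffAt_const.mul contDiffAt_id))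
  · rw [hang, hdef, hsrc]
    exact h.eq

section Solution
variable {n k : ℕ} {θ ρ : ℝ} {φ : ℝ → ℝ} {s : ℝ}

lemma IsProfileAt.radialSigma_eq (h : IsProfileAt n k θ ρ φ s) (hn : 1 ≤ n) (hk : 1 ≤ k)
    (hkn : k ≤ n) : radialSigma n k (angular φ s) (defect φ s) = sourceTerm θ ρ φ s ^ k := by
  have hk' : (k : ℝ) ≠ 0 := by exact_mod_cast (by omega : k ≠ 0)
  exact mul_left_cancel₀ hk' ((k_mul_radialSigma hn hk hkn _ _).trans h.eq)

/-- The equation gives nL + kd > 0; with L > 0 this implies nL + jd > 0 for every j ≤ k, whatever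
the sign of d. -/
lemma IsProfileAt.radialSigma_pos (h : IsProfileAt n k θ ρ φ s) (hn : 1 ≤ n) (hkn : k ≤ n) {j : ℕ}
    (hj : 1 ≤ j) (hjk : j ≤ k) : 0 < radialSigma n j (angular φ s) (defect φ s) := by
  have hL := h.angular_pos
  have hj' : (1 : ℝ) ≤ j := by exact_mod_cast hj
  have hjk' : (j : ℝ) ≤ k := by exact_mod_cast hjk
  have hn' : (1 : ℝ) ≤ n := by exact_mod_cast hn
  have hC : ∀ i, i ≤ k → (0 : ℝ) < ((n - 1).choose (i - 1) : ℝ) := fun i hi => by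
    exact_mod_cast Nat.choose_pos (by omega)
  have h1 : 0 < n * angular φ s + k * defect φ s := by
    have h2 : 0 < k * sourceTerm θ ρ φ s ^ k :=
      mul_pos (by linarith) (pow_pos h.source_pos k)
    rw [← h.eq] at h2
    exact pos_of_mul_pos_right h2 (mul_pos (hC k le_rfl) (pow_pos hL _)).le
  have h3 : 0 < n * angular φ s + j * defect φ s := by
    rcases le_or_gt 0 (defect φ s) with hd | hd
    · have : 0 < n * angular φ s := by positivity
      have : 0 ≤ j * defect φ s := by positivity
      linarith
    · nlinarith
  have h4 := k_mul_radialSigma (k := j) hn hj (hjk.trans hkn) (angular φ s) (defect φ s)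
  have h5 : 0 < j * radialSigma n j (angular φ s) (defect φ s) := by
    rw [h4]
    exact mul_pos (mul_pos (hC j hjk) (pow_pos hL _)) h3
  exact pos_of_mul_pos_right h5 (by linarith)

/-- A profile on `[0, ∞)` yields an entire radial solution. -/
lemma exists_solution_of_profile (hn : 3 ≤ n) (hk : 1 ≤ k) (hkn : k ≤ n) (hθ : 0 < θ)
    (hφ : ∀ s, 0 ≤ s → IsProfileAt n k θ ρ φ s) {α : ℝ} (hα : 0 < α)
    (hφ0 : φ 0 = α ^ (-(2 * (k : ℝ) / ((n : ℝ) + 2 * k)))) :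
    ∃ u : E n → ℝ, ContDiff ℝ ∞ u ∧ (∀ x, 0 < u x) ∧ Radial u ∧ SolvesEquation n k θ ρ u ∧
      Admissible n k u ∧ ¬ Trivial n k u ∧ u 0 = α := by
  have hq0 := conf_exponent_pos (n := n) hk
  set q : ℝ := 2 * (k : ℝ) / ((n : ℝ) + 2 * k) with hq
  have hP : ∀ x : E n, IsProfileAt n k θ ρ φ (‖x‖ ^ 2) := fun x => hφ _ (sq_nonneg _)
  let v : E n → ℝ := fun x => φ (‖x‖ ^ 2)
  have hvpos : ∀ x, 0 < v x := fun x => (hP x).pos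
  have hvs : ContDiff ℝ ∞ v := contDiff_iff_contDiffAt.2 fun x =>
    ContDiffAt.comp (g := φ) x (hP x).smooth (contDiff_norm_sq ℝ).contDiffAt
  let u : E n → ℝ := fun x => v x ^ (-q⁻¹)
  have hu : ContDiff ℝ ∞ u := contDiff_rpow_of_pos hvs hvpos _
  have hupos : ∀ x, 0 < u x := fun x => Real.rpow_pos_of_pos (hvpos x) _
  have hvu : ∀ x, v x = u x ^ (-q) := fun x => by
    rw [← Real.rpow_mul (hvpos x).le, neg_mul_neg, inv_mul_cancel₀ hq0.ne', Real.rpow_one]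
  have hφ2 : ∀ x : E n, ContDiffAt ℝ 2 φ (‖x‖ ^ 2) := fun x =>
    (hP x).smooth.of_le (WithTop.coe_le_coe.2 le_top)
  have hσ : ∀ x, ∀ j, 1 ≤ j →
      sigma j (v x • hess v x - (gradSq v x / 2) • (1 : Matrix (Fin n) (Fin n) ℝ)) =
        radialSigma n j (angular φ (‖x‖ ^ 2)) (defect φ (‖x‖ ^ 2)) := fun x j hj =>
    sigma_radial (by omega) .rfl (hφ2 x) hj
  refine ⟨u, hu, hupos, fun x y h => by simp only [u, v, h], fun x => ?_, fun x j hj => ?_, ?_, ?_⟩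
  · rw [show (fun x => u x ^ (-q)) = v from (funext hvu).symm]
    have hS := hσ x k hk
    rw [(hP x).radialSigma_eq (by omega) hk hkn] at hS
    have hsrc := (hP x).source_pos
    refine (equation_iff hk θ ρ hu hupos hvu (by rw [hS]; positivity)).2 ?_
    rw [hS, one_div, Real.pow_rpow_inv_natCast hsrc.le (by omega), sourceTerm,
      fderiv_radial_apply (φ := φ) .rfl ((hφ2 x).differentiableAt (by simp))]
    ring
  · rw [Finset.mem_Icc] at hj
    rw [sigmaCurv_confMetric hn hu hupos hvu, hσ x j hj.1]
    exact (hP x).radialSigma_pos (by omega) hkn hj.1 hj.2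
  -- Constant σ_k would make the source term equal at |x| = 0 and |x| = 1, forcing φ'(1) = 0 as θ >
  -- 0; but `angular φ 1 > 0` requires φ'(1) > 0.
  · rintro ⟨c, hc⟩
    have h : ∀ x, sourceTerm θ ρ φ (‖x‖ ^ 2) ^ k = c := fun x => by
      rw [← hc x, sigmaCurv_confMetric hn hu hupos hvu, hσ x k hk,
        (hP x).radialSigma_eq (by omega) hk hkn]
    let e : E n := EuclideanSpace.single ⟨0, by omega⟩ 1
    have he : ‖e‖ ^ 2 = 1 := by simp [e]
    have h01 := (h e).trans (h 0).symm
    have hp := he ▸ hP e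
    rw [he] at h01
    have h0 := (hP 0).source_pos
    have h1 := (pow_left_inj₀ hp.source_pos.le h0.le (by omega)).1 h01
    have hd : 0 < deriv φ 1 := by
      have hL := hp.angular_pos
      have hφ1 := hp.pos
      rw [angular] at hL
      nlinarith [sq_nonneg (deriv φ 1)]
    have h2 : 0 < 4 * θ * 1 * deriv φ 1 / φ 1 := div_pos (by positivity) hp.pos
    simp [sourceTerm] at h1 h2
    rcases h1 with (h1 | h1) | h1
    · exact hθ.ne' h1
    · exact hd.ne' h1
    · exact hp.pos.ne' h1
  · have : v 0 = α ^ (-q) := by simpa [v] using hφ0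
    rw [show u 0 = v 0 ^ (-q⁻¹) from rfl, this, ← Real.rpow_mul hα.le, neg_mul_neg,
      mul_inv_cancel₀ hq0.ne', Real.rpow_one]

end Solution

end KYamabe

theorem theorem1p2 (n k : ℕ) (hn : 3 ≤ n) (hk : 1 ≤ k) (hnk : 2 * k ≤ n)
    (θ ρ : ℝ) (α : ℝ) (hα : 0 < α) :
    (∃ u : KYamabe.E n → ℝ,
        ContDiff ℝ ∞ u ∧ (∀ x, 0 < u x) ∧ KYamabe.Radial u ∧
        KYamabe.SolvesEquation n k θ ρ u ∧ KYamabe.Admissible n k u ∧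
        ¬ KYamabe.Trivial n k u ∧ u 0 = α) ↔
      (0 < θ ∧ 0 < 2 * θ + ρ) := by
  constructor
  · rintro ⟨u, hu, hpos, hrad, hsol, hadm, hnt, -⟩
    exact ⟨lt_of_le_of_ne
      (not_lt.1 (KYamabe.not_neg_of_solution hn hk hnk hu hpos hrad hsol hadm))
      (KYamabe.ne_zero_of_solution hn hk hu hpos hsol hadm hnt).symm,
      KYamabe.sum_pos_of_solution hn hk hu hpos hsol hadm⟩
  · rintro ⟨hθ, h0⟩
    obtain ⟨φ, hφ0, hφ⟩ := KYamabe.exists_global_profile hn hk hnk hθ h0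
    -- The scaling factor is the required v(0), since the profile is normalized by φ(0) = 1.
    have hc : 0 < α ^ (-(2 * (k : ℝ) / ((n : ℝ) + 2 * k))) := Real.rpow_pos_of_pos hα _
    exact KYamabe.exists_solution_of_profile hn hk (by omega) hθ
      (fun s hs => (hφ _ (by positivity)).rescale hc) hα (by simp [hφ0])
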